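/- Let $G=(V,E)$ be a directed acyclic graph with $n=|V|$ vertices and $m=|E|\ge 1$ edges (no parallel edges), let $a=(a_e)_{e\in E}$ be positive integers and let $x\ge 0$ be a real number. Let $\Pi(G)$ be the set of all directed paths that start at a source of $G$ (a vertex without incoming edge) and end at a terminal (a vertex without outgoing edge), and put $$K_G(a,x)=\Big\{y\in[0,1]^E \;:\; \sum_{e\in E(\pi)}a_e y_e\le x\ \text{ for all }\pi\in\Pi(G)\Big\}.$$ (i) If the lengths $Y_e$ $(e\in E)$ are independent random variables, $Y_e$ uniformly distributed on $[0,a_e]$, and $X_{\rm MAX}=\max_{\pi\in\Pi(G)}\sum_{e\in E(\pi)}Y_e$, then $\Pr[X_{\rm MAX}\le x]={\rm Vol}(K_G(a,x))$. (ii) There is a constant $C$ such that for every $k$ there is a deterministic algorithm which, given any such $G$ whose underlying undirected graph has treewidth at most $k$, any such $a$ and $x$, and any real $\epsilon>0$, outputs a number $V'$ with $${\rm Vol}(K_G(a,x))\le V'\le(1+\epsilon)\,{\rm Vol}(K_G(a,x)),$$ so that $1\le V'/{\rm Vol}(K_G(a,x))\le 1+\epsilon$ if $x>0$, in at most $$C\,(3k+2)^2\,n\left(\frac{(6k+6)mn}{\min(\epsilon,1)}\right)^{9k^2+15k+6}$$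 steps. Here an algorithm is a program of a real random access machine: each arithmetic operation ($+,-,\times,/$) or comparison of real numbers, each addition, truncated subtraction or comparison of natural numbers, each conversion of a natural number to a real number, and each memory access takes one step, and the constants in the program are natural numbers. The input consists of $n$, $m$, the list of the edges, and the numbers $a_e$, $x$, $\epsilon$; no tree decomposition is given. For each fixed $k$ the number of steps is polynomial in $n$, $m$ and $1/\epsilon$, so this is a deterministic fully polynomial time approximation scheme, in the sense of this unit-cost model, for $\Pr[X_{\rm MAX}\le x]$. -/

import Mathlib

open MeasureTheory ProbabilityTheory

/-! ### A real RAM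

A deterministic random access machine with finitely many arrays of natural numbers (used for
indices and counters) and finitely many arrays of real numbers, programmed in a structured
language.  Every arithmetic operation, memory access, comparison and assignment costs one step.
On natural numbers only addition and truncated subtraction are available; on real numbers the
four field operations and exact comparison (no rounding).  The only constants a program can
contain are natural numbers. -/

namespace RealRAM

/-- Memory: `nat A i` and `real A i` are the cells with index `i` of the natural-number array and
of the real array named `A`. -/
structure State where
  nat : ℕ → ℕ → ℕ
  real : ℕ → ℕ → ℝ

/-- Expressions with values in the natural numbers. -/
inductive NExp where
  | lit (c : ℕ)
  | read (A : ℕ) (i : NExp)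
  | add (e f : NExp)
  | sub (e f : NExp)

namespace NExp

/-- Value of an expression. -/
def eval (s : State) : NExp → ℕ
  | lit c => c
  | read A i => s.nat A (i.eval s)
  | add e f => e.eval s + f.eval s
  | sub e f => e.eval s - f.eval s

/-- Number of steps used to evaluate an expression. -/
def cost : NExp → ℕ
  | lit _ => 1
  | read _ i => i.cost + 1
  | add e f => e.cost + f.cost + 1
  | sub e f => e.cost + f.cost + 1

end NExp

/-- Expressions with values in the real numbers. -/
inductive RExp where
  | ofNat (e : NExp)
  | read (A : ℕ) (i : NExp)
  | add (e f : RExp)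
  | sub (e f : RExp)
  | mul (e f : RExp)
  | div (e f : RExp)

namespace RExp

/-- Value of an expression; a division by zero returns zero. -/
noncomputable def eval (s : State) : RExp → ℝ
  | ofNat e => (e.eval s : ℝ)
  | read A i => s.real A (i.eval s)
  | add e f => e.eval s + f.eval s
  | sub e f => e.eval s - f.eval s
  | mul e f => e.eval s * f.eval s
  | div e f => e.eval s / f.eval s

/-- Number of steps used to evaluate an expression. -/
def cost : RExp → ℕ
  | ofNat e => e.cost + 1
  | read _ i => i.cost + 1
  | add e f => e.cost + f.cost + 1
  | sub e f => e.cost + f.cost + 1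
  | mul e f => e.cost + f.cost + 1
  | div e f => e.cost + f.cost + 1

end RExp

/-- Tests. -/
inductive BExp where
  | natLE (e f : NExp)
  | realLE (e f : RExp)
  | not (b : BExp)
  | and (b c : BExp)

namespace BExp

/-- Truth value of a test. -/
def Holds (s : State) : BExp → Prop
  | natLE e f => e.eval s ≤ f.eval s
  | realLE e f => e.eval s ≤ f.eval s
  | not b => ¬ b.Holds s
  | and b c => b.Holds s ∧ c.Holds s

/-- Number of steps used to evaluate a test. -/
def cost : BExp → ℕ
  | natLE e f => e.cost + f.cost + 1
  | realLE e f => e.cost + f.cost + 1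
  | not b => b.cost + 1
  | and b c => b.cost + c.cost + 1

end BExp

/-- Programs. -/
inductive Program where
  | skip
  | setNat (A : ℕ) (i e : NExp)
  | setReal (A : ℕ) (i : NExp) (e : RExp)
  | seq (P Q : Program)
  | ite (b : BExp) (P Q : Program)
  | loop (b : BExp) (P : Program)

/-- Overwrite one natural-number cell. -/
def State.updateNat (s : State) (A i v : ℕ) : State :=
  { s with nat := Function.update s.nat A (Function.update (s.nat A) i v) }

/-- Overwrite one real cell. -/
noncomputable def State.updateReal (s : State) (A i : ℕ) (v : ℝ) : State :=
  { s with real := Function.update s.real A (Function.update (s.real A) i v) }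

/-- `Exec P s s' t`: started in the memory state `s`, the program `P` halts in the memory state
`s'` after exactly `t` steps.  (`loop b P` is the loop "while `b` holds, do `P`".) -/
inductive Exec : Program → State → State → ℕ → Prop where
  | skip (s : State) : Exec .skip s s 1
  | setNat (A : ℕ) (i e : NExp) (s : State) :
      Exec (.setNat A i e) s (s.updateNat A (i.eval s) (e.eval s)) (i.cost + e.cost + 1)
  | setReal (A : ℕ) (i : NExp) (e : RExp) (s : State) :
      Exec (.setReal A i e) s (s.updateReal A (i.eval s) (e.eval s)) (i.cost + e.cost + 1)
  | seq {P Q : Program} {s s' s'' : State} {t t' : ℕ} :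
      Exec P s s' t → Exec Q s' s'' t' → Exec (.seq P Q) s s'' (t + t')
  | iteTrue {b : BExp} {P Q : Program} {s s' : State} {t : ℕ} :
      b.Holds s → Exec P s s' t → Exec (.ite b P Q) s s' (b.cost + 1 + t)
  | iteFalse {b : BExp} {P Q : Program} {s s' : State} {t : ℕ} :
      ¬ b.Holds s → Exec Q s s' t → Exec (.ite b P Q) s s' (b.cost + 1 + t)
  | loopFalse {b : BExp} {P : Program} {s : State} :
      ¬ b.Holds s → Exec (.loop b P) s s (b.cost + 1)
  | loopTrue {b : BExp} {P : Program} {s s' s'' : State} {t t' : ℕ} :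
      b.Holds s → Exec P s s' t → Exec (.loop b P) s' s'' t' →
      Exec (.loop b P) s s'' (b.cost + 1 + t + t')

/-- The machine is deterministic: final state and number of steps are determined by the program
and the initial state. -/
theorem Exec.deterministic {P : Program} {s s₁ s₂ : State} {t₁ t₂ : ℕ}
    (h₁ : Exec P s s₁ t₁) (h₂ : Exec P s s₂ t₂) : s₁ = s₂ ∧ t₁ = t₂ := by
  induction h₁ generalizing s₂ t₂ with
  | skip s => cases h₂; exact ⟨rfl, rfl⟩
  | setNat A i e s => cases h₂; exact ⟨rfl, rfl⟩
  | setReal A i e s => cases h₂; exact ⟨rfl, rfl⟩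
  | seq _ _ ih ih' =>
    cases h₂ with
    | seq g g' =>
      obtain ⟨rfl, rfl⟩ := ih g
      obtain ⟨rfl, rfl⟩ := ih' g'
      exact ⟨rfl, rfl⟩
  | iteTrue hb _ ih =>
    cases h₂ with
    | iteTrue _ g => obtain ⟨rfl, rfl⟩ := ih g; exact ⟨rfl, rfl⟩
    | iteFalse hb' _ => exact absurd hb hb'
  | iteFalse hb _ ih =>
    cases h₂ with
    | iteTrue hb' _ => exact absurd hb' hb
    | iteFalse _ g => obtain ⟨rfl, rfl⟩ := ih g; exact ⟨rfl, rfl⟩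
  | loopFalse hb =>
    cases h₂ with
    | loopFalse _ => exact ⟨rfl, rfl⟩
    | loopTrue hb' _ _ => exact absurd hb' hb
  | loopTrue hb _ _ ih ih' =>
    cases h₂ with
    | loopFalse hb' => exact absurd hb hb'
    | loopTrue _ g g' =>
      obtain ⟨rfl, rfl⟩ := ih g
      obtain ⟨rfl, rfl⟩ := ih' g'
      exact ⟨rfl, rfl⟩

end RealRAM

/-! ### Tree decompositions -/

/-- A tree decomposition of a graph `H`: a tree on finitely many nodes with a bag of vertices at
every node. -/
structure TreeDecomposition {V : Type*} [DecidableEq V] (H : SimpleGraph V) where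
  /-- number of nodes -/
  size : ℕ
  /-- the tree -/
  tree : SimpleGraph (Fin size)
  /-- the bags -/
  bag : Fin size → Finset V
  isTree : tree.IsTree
  cover : ∀ v, ∃ i, v ∈ bag i
  edge : ∀ u v, H.Adj u v → ∃ i, u ∈ bag i ∧ v ∈ bag i
  inter : ∀ (h i j : Fin size) (w : tree.Walk h j), w.IsPath → i ∈ w.support →
    bag h ∩ bag j ⊆ bag i

/-- The width of a tree decomposition: the largest cardinality of a bag, minus one. -/
def TreeDecomposition.width {V : Type*} [DecidableEq V] {H : SimpleGraph V}
    (D : TreeDecomposition H) : ℕ :=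
  (Finset.univ.sup fun i => (D.bag i).card) - 1

/-- The treewidth of a graph: the minimum width of its tree decompositions. -/
noncomputable def treewidth {V : Type*} [DecidableEq V] (H : SimpleGraph V) : ℕ :=
  sInf (Set.range fun D : TreeDecomposition H => D.width)

/-- A finite graph has a tree decomposition (with a single bag), so that the minimum in the
definition of the treewidth is attained. -/
theorem exists_width_eq_treewidth {V : Type*} [DecidableEq V] [Fintype V] (H : SimpleGraph V) :
    ∃ D : TreeDecomposition H, D.width = treewidth H := by
  have hne : (Set.range fun D : TreeDecomposition H => D.width).Nonempty :=
    ⟨_, ⟨{ size := 1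
           tree := ⊥
           bag := fun _ => Finset.univ
           isTree := SimpleGraph.IsTree.of_subsingleton
           cover := fun v => ⟨0, Finset.mem_univ v⟩
           edge := fun u v _ => ⟨0, Finset.mem_univ u, Finset.mem_univ v⟩
           inter := fun _ _ _ _ _ _ _ _ => Finset.mem_univ _ }, rfl⟩⟩
  exact Nat.sInf_mem hne

/-! ### Directed acyclic graphs with edge lengths -/

/-- A directed acyclic graph with `n` vertices and `m` edges, given by the list of its edges:
edge `e` goes from `src e` to `tgt e`, there are no parallel edges and no directed cycles. -/
structure DAG (n m : ℕ) where
  src : Fin m → Fin n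
  tgt : Fin m → Fin n
  inj : Function.Injective fun e => (src e, tgt e)
  acyclic : ∀ v, ¬ Relation.TransGen (fun u w => ∃ e, src e = u ∧ tgt e = w) v v

namespace DAG

variable {n m : ℕ}

/-- The underlying undirected graph. -/
def underlying (G : DAG n m) : SimpleGraph (Fin n) :=
  SimpleGraph.fromRel fun u v => ∃ e, G.src e = u ∧ G.tgt e = v

/-- A source is a vertex without incoming edge. -/
def IsSource (G : DAG n m) (v : Fin n) : Prop := ∀ e, G.tgt e ≠ v

/-- A terminal is a vertex without outgoing edge. -/
def IsTerminal (G : DAG n m) (v : Fin n) : Prop := ∀ e, G.src e ≠ v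

/-- `G.IsPath u v p`: the list `p` of edges is a directed path from `u` to `v`. -/
inductive IsPath (G : DAG n m) : Fin n → Fin n → List (Fin m) → Prop where
  | nil (v : Fin n) : IsPath G v v []
  | cons (e : Fin m) {v : Fin n} {p : List (Fin m)} :
      IsPath G (G.tgt e) v p → IsPath G (G.src e) v (e :: p)

/-- The set of all paths from the sources to the terminals. -/
def stPaths (G : DAG n m) : Set (List (Fin m)) :=
  {p | ∃ s t, G.IsSource s ∧ G.IsTerminal t ∧ G.IsPath s t p}

/-- The length of a path for given edge lengths. -/
def pathLength (y : Fin m → ℝ) (p : List (Fin m)) : ℝ := (p.map y).sum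

/-- The longest length of a path from a source to a terminal, for given edge lengths (the set of
these paths is finite, and nonempty if `n` is positive). -/
noncomputable def longestPathLength (G : DAG n m) (y : Fin m → ℝ) : ℝ :=
  sSup (pathLength y '' G.stPaths)

/-- The polytope `K_G(a, x)`. -/
def polytope (G : DAG n m) (a : Fin m → ℕ) (x : ℝ) : Set (Fin m → ℝ) :=
  {y | (∀ e, y e ∈ Set.Icc (0 : ℝ) 1) ∧
    ∀ p ∈ G.stPaths, pathLength (fun e => (a e : ℝ) * y e) p ≤ x}

/-- The volume of `K_G(a, x)`. -/
noncomputable def vol (G : DAG n m) (a : Fin m → ℕ) (x : ℝ) : ℝ :=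
  (volume : Measure (Fin m → ℝ)).real (G.polytope a x)

/-- The input of the algorithm, as initial memory of the real RAM.  Natural-number arrays:
array `0` holds `n` and `m`, arrays `1` and `2` hold the tails and the heads of the edges.  Real
arrays: array `0` holds `x` and `ε`, array `1` holds the numbers `a e`.  All other cells hold
zero. -/
noncomputable def input (G : DAG n m) (a : Fin m → ℕ) (x ε : ℝ) : RealRAM.State where
  nat A i :=
    if A = 0 then (if i = 0 then n else if i = 1 then m else 0)
    else if h : i < m then
      (if A = 1 then (G.src ⟨i, h⟩ : ℕ) else if A = 2 then (G.tgt ⟨i, h⟩ : ℕ) else 0)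
    else 0
  real A i :=
    if A = 0 then (if i = 0 then x else if i = 1 then ε else 0)
    else if h : i < m then (if A = 1 then (a ⟨i, h⟩ : ℝ) else 0)
    else 0

end DAG

/-- Started on the initial memory `s`, the program `P` halts after exactly `t` steps with output
`v`, the content of cell `0` of the real array `2`. -/
def RealRAM.Program.Outputs (P : RealRAM.Program) (s : RealRAM.State) (v : ℝ) (t : ℕ) : Prop :=
  ∃ s', RealRAM.Exec P s s' t ∧ s'.real 2 0 = v

/-!
The distribution function is the volume because the vector of the edge lengths is a coordinatewise
scaling of a uniform point `y` of the unit cube (`measureReal_longestPathLength_le`).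

For the algorithm, let `M` be a natural number and round the edge lengths `a e * y e` down to
multiples of `x / M`.  The set of all `y` for which the rounded lengths of all paths sum up to at
most `M` grid units contains the polytope with bound `x` and is contained in the one with bound
`(1 + m / M) * x`, whose volume is at most `(1 + m / M) ^ m` times as large.  Hence its volume is a
sufficiently good approximation as soon as `2 m² ≤ M ε` and `2 m² ≤ M`
(`vol_le_part_and_part_le`).

This volume is a partition function.  For integral edge lengths, the condition that all paths have
length at most `M` holds if and only if the unique labelling of the vertices with
`c v = max (c u + L (u, v))` (maximum over the edges into `v`) has labels at most `M`.  The
indicator function of `arrival = c v` is the difference of those of `arrival < c v + 1` and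
`arrival < c v`, and each of these is a product over the edges into `v`.  If a state of a vertex is
a label together with one of the two signs, then the indicator function of the condition is a sum
over all assignments of states of a product of factors each of which depends on one vertex, or on
one edge and the states of its two ends (`sum_states_prod_eq`).  Integration over the independent
edge lengths replaces every edge factor by its mean, which is explicit (`volume_roundedPolytope`).

The partition function is computed without knowledge of a tree decomposition.  A table holds the
partition functions of connected vertex sets `C` for prescribed states of the boundary of `C`.
Since at most `k` boundary vertices are considered, the pairs of a set and states of its boundary
are enumerated by partial assignments of states to at most `k` vertices together with a vertex: `C`
is the component of the vertex in the graph without the vertices that have a state.  An entry is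
computed by summation over the state of one vertex `v` of `C`, the pivot (`Model.part_insert`), as
soon as the entries of all components of `C \ {v}` are present (`Model.part_eq_mul_sdiff`); this is
repeated `n` times, for all codes of partial assignments and all pivots.  If the treewidth is at
most `k`, then every component of the graph gets an entry: a connected set whose boundary lies in a
bag has its boundary in a bag that meets the set, and a vertex of the set in this bag serves as
pivot (`solvable_of_treewidth_le`).  With `N` a bound for the numbers of vertices, edges and states,
and `T` one for the number of partial assignments, this takes `O (N ^ 6 * T ^ 3)` steps
(`timeBound_fillTable`).

The algorithm is written with counted loops only, except for the search for `M`; such programs have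
a total semantics and a syntactic bound for the number of steps (`ForProgram.exec_run`).
-/

/-! ### Programs with counted loops -/

namespace RealRAM

/-- Programs all of whose loops are counted loops. -/
inductive ForProgram where
  | skip
  | setNat (A : ℕ) (i e : NExp)
  | setReal (A : ℕ) (i : NExp) (e : RExp)
  | seq (P Q : ForProgram)
  | ite (b : BExp) (P Q : ForProgram)
  | loop (i : ℕ) (b : NExp) (P : ForProgram)

/-- The scalar variable `A`: cell `0` of the natural-number array `A`. -/
abbrev NExp.var (A : ℕ) : NExp := .read A (.lit 0)

/-- The natural-number arrays that an expression reads. -/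
def NExp.reads : NExp → List ℕ
  | lit _ => []
  | read A i => A :: i.reads
  | add e f => e.reads ++ f.reads
  | sub e f => e.reads ++ f.reads

theorem NExp.eval_congr {s s' : State} :
    ∀ {e : NExp}, (∀ A ∈ e.reads, s.nat A = s'.nat A) → e.eval s = e.eval s'
  | lit _, _ => rfl
  | read A i, h => by
    simp only [reads, List.mem_cons, forall_eq_or_imp] at h
    simp only [eval, h.1, eval_congr h.2]
  | add e f, h => by
    simp only [reads, List.mem_append] at h
    simp only [eval, eval_congr fun A hA => h A (.inl hA), eval_congr fun A hA => h A (.inr hA)]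
  | sub e f, h => by
    simp only [reads, List.mem_append] at h
    simp only [eval, eval_congr fun A hA => h A (.inl hA), eval_congr fun A hA => h A (.inr hA)]

@[simp] theorem State.updateNat_nat (s : State) (A i v A' i' : ℕ) :
    (s.updateNat A i v).nat A' i' = if A' = A ∧ i' = i then v else s.nat A' i' := by
  by_cases hA : A' = A
  · subst hA
    by_cases hi : i' = i <;> simp [State.updateNat, hi]
  · simp [State.updateNat, hA]

@[simp] theorem State.updateNat_real (s : State) (A i v : ℕ) :
    (s.updateNat A i v).real = s.real := rfl

@[simp] theorem State.updateReal_nat (s : State) (A i : ℕ) (v : ℝ) :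
    (s.updateReal A i v).nat = s.nat := rfl

@[simp] theorem State.updateReal_real (s : State) (A i : ℕ) (v : ℝ) (A' i' : ℕ) :
    (s.updateReal A i v).real A' i' = if A' = A ∧ i' = i then v else s.real A' i' := by
  by_cases hA : A' = A
  · subst hA
    by_cases hi : i' = i <;> simp [State.updateReal, hi]
  · simp [State.updateReal, hA]

theorem State.updateNat_nat_of_ne (s : State) {A A' : ℕ} (i v : ℕ) (h : A' ≠ A) :
    (s.updateNat A i v).nat A' = s.nat A' := by
  simp [State.updateNat, h]

theorem State.updateReal_real_of_ne (s : State) {A A' : ℕ} (i : ℕ) (v : ℝ) (h : A' ≠ A) :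
    (s.updateReal A i v).real A' = s.real A' := by
  simp [State.updateReal, h]

namespace ForProgram

infixr:60 " ;; " => ForProgram.seq

/-- Translation into the language of the machine; `loop i b P` runs `P` for the values
`0, 1, …, b - 1` of the variable `i`. -/
def toProgram : ForProgram → Program
  | skip => .skip
  | setNat A i e => .setNat A i e
  | setReal A i e => .setReal A i e
  | seq P Q => .seq P.toProgram Q.toProgram
  | ite b P Q => .ite b P.toProgram Q.toProgram
  | loop i b P =>
    .seq (.setNat i (.lit 0) (.lit 0))
      (.loop (.natLE (.add (.var i) (.lit 1)) b)
        (.seq P.toProgram (.setNat i (.lit 0) (.add (.var i) (.lit 1)))))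

open Classical in
/-- The final memory state. -/
noncomputable def run : ForProgram → State → State
  | skip, s => s
  | setNat A i e, s => s.updateNat A (i.eval s) (e.eval s)
  | setReal A i e, s => s.updateReal A (i.eval s) (e.eval s)
  | seq P Q, s => Q.run (P.run s)
  | ite b P Q, s => if b.Holds s then P.run s else Q.run s
  | loop i b P, s =>
    Nat.rec (s.updateNat i 0 0) (fun j s' => (P.run s').updateNat i 0 (j + 1)) (b.eval s)

theorem run_seq (P Q : ForProgram) (s : State) : (P ;; Q).run s = Q.run (P.run s) := rfl

theorem run_setNat (A : ℕ) (i e : NExp) (s : State) :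
    (setNat A i e).run s = s.updateNat A (i.eval s) (e.eval s) := rfl

theorem run_setReal (A : ℕ) (i : NExp) (e : RExp) (s : State) :
    (setReal A i e).run s = s.updateReal A (i.eval s) (e.eval s) := rfl

theorem run_ite_pos {b : BExp} {s : State} (P Q : ForProgram) (h : b.Holds s) :
    (ite b P Q).run s = P.run s := if_pos h

theorem run_ite_neg {b : BExp} {s : State} (P Q : ForProgram) (h : ¬ b.Holds s) :
    (ite b P Q).run s = Q.run s := if_neg h

/-- The natural-number arrays that a program writes to. -/
def natWrites : ForProgram → List ℕ
  | skip => []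
  | setNat A _ _ => [A]
  | setReal _ _ _ => []
  | seq P Q => P.natWrites ++ Q.natWrites
  | ite _ P Q => P.natWrites ++ Q.natWrites
  | loop i _ P => i :: P.natWrites

/-- The real arrays that a program writes to. -/
def realWrites : ForProgram → List ℕ
  | skip => []
  | setNat _ _ _ => []
  | setReal A _ _ => [A]
  | seq P Q => P.realWrites ++ Q.realWrites
  | ite _ P Q => P.realWrites ++ Q.realWrites
  | loop _ _ P => P.realWrites

theorem run_nat_of_notMem {A : ℕ} : ∀ {P : ForProgram} (s : State), A ∉ P.natWrites →
    (P.run s).nat A = s.nat A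
  | skip, _, _ => rfl
  | setNat A' i e, s, h => by
    simp only [natWrites, List.mem_singleton] at h
    exact State.updateNat_nat_of_ne _ _ _ h
  | setReal _ _ _, _, _ => rfl
  | seq P Q, s, h => by
    simp only [natWrites, List.mem_append, not_or] at h
    simp only [run, run_nat_of_notMem _ h.1, run_nat_of_notMem _ h.2]
  | ite b P Q, s, h => by
    simp only [natWrites, List.mem_append, not_or] at h
    simp only [run]
    split
    · exact run_nat_of_notMem _ h.1
    · exact run_nat_of_notMem _ h.2
  | loop i b P, s, h => by
    simp only [natWrites, List.mem_cons, not_or] at h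
    simp only [run]
    induction b.eval s with
    | zero => exact State.updateNat_nat_of_ne _ _ _ h.1
    | succ j ih =>
      exact (State.updateNat_nat_of_ne _ _ _ h.1).trans ((run_nat_of_notMem _ h.2).trans ih)

theorem run_real_of_notMem {A : ℕ} : ∀ {P : ForProgram} (s : State), A ∉ P.realWrites →
    (P.run s).real A = s.real A
  | skip, _, _ => rfl
  | setNat _ _ _, _, _ => rfl
  | setReal A' i e, s, h => by
    simp only [realWrites, List.mem_singleton] at h
    exact State.updateReal_real_of_ne _ _ _ h
  | seq P Q, s, h => by
    simp only [realWrites, List.mem_append, not_or] at h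
    simp only [run, run_real_of_notMem _ h.1, run_real_of_notMem _ h.2]
  | ite b P Q, s, h => by
    simp only [realWrites, List.mem_append, not_or] at h
    simp only [run]
    split
    · exact run_real_of_notMem _ h.1
    · exact run_real_of_notMem _ h.2
  | loop i b P, s, h => by
    simp only [realWrites] at h
    simp only [run]
    induction b.eval s with
    | zero => rfl
    | succ j ih => exact (run_real_of_notMem _ h).trans ih

/-- The memory states `s` and `s'` differ only in arrays that `P` writes to. -/
def Frame (P : ForProgram) (s s' : State) : Prop :=
  (∀ A, A ∉ P.natWrites → s'.nat A = s.nat A) ∧ ∀ A, A ∉ P.realWrites → s'.real A = s.real A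

theorem frame_run (P : ForProgram) (s : State) : P.Frame s (P.run s) :=
  ⟨fun _ h => run_nat_of_notMem s h, fun _ h => run_real_of_notMem s h⟩

/-- The invariant rule for counted loops. -/
theorem run_loop_induct {i : ℕ} {b : NExp} {P : ForProgram} {s : State} {N : ℕ}
    (hN : b.eval s = N) (I : ℕ → State → Prop) (h0 : I 0 (s.updateNat i 0 0))
    (step : ∀ j s', j < N → s'.nat i 0 = j → (loop i b P).Frame s s' → I j s' →
      I (j + 1) ((P.run s').updateNat i 0 (j + 1))) :
    I N ((loop i b P).run s) := by
  subst hN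
  set f : ℕ → State := fun j =>
    Nat.rec (s.updateNat i 0 0) (fun j s' => (P.run s').updateNat i 0 (j + 1)) j with hf
  have hi : ∀ j, (f j).nat i 0 = j := by
    intro j; cases j <;> simp [hf]
  have hfr : ∀ j, (loop i b P).Frame s (f j) := by
    intro j
    induction j with
    | zero =>
      refine ⟨fun A hA => State.updateNat_nat_of_ne _ _ _ ?_, fun _ _ => rfl⟩
      exact fun h => hA (by simp [natWrites, h])
    | succ j ih =>
      refine ⟨fun A hA => ?_, fun A hA => ?_⟩
      · have h' := hA
        simp only [natWrites, List.mem_cons, not_or] at h'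
        exact (State.updateNat_nat_of_ne _ _ _ h'.1).trans
          ((run_nat_of_notMem _ h'.2).trans (ih.1 A hA))
      · exact (run_real_of_notMem (P := P) _ hA).trans (ih.2 A hA)
  have main : ∀ j, j ≤ b.eval s → I j (f j) := by
    intro j
    induction j with
    | zero => exact fun _ => h0
    | succ j ih => exact fun h => step j (f j) h (hi j) (hfr j) (ih (by omega))
  exact main _ le_rfl

/-- A syntactic condition: the arrays in `W` are never written, loop bounds depend only on these
arrays, and no loop body overwrites the loop counter. -/
def WF (W : List ℕ) : ForProgram → Prop
  | skip => True
  | setNat A _ _ => A ∉ W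
  | setReal _ _ _ => True
  | seq P Q => P.WF W ∧ Q.WF W
  | ite _ P Q => P.WF W ∧ Q.WF W
  | loop i b P => i ∉ W ∧ i ∉ P.natWrites ∧ (∀ A ∈ b.reads, A ∈ W) ∧ P.WF W

theorem WF.notMem_natWrites {W : List ℕ} : ∀ {P : ForProgram}, P.WF W →
    ∀ A ∈ W, A ∉ P.natWrites
  | skip, _, _, _ => by simp [natWrites]
  | setNat A' _ _, h, A, hA => by
    simp only [natWrites, List.mem_singleton]
    rintro rfl
    exact h hA
  | setReal _ _ _, _, _, _ => by simp [natWrites]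
  | seq P Q, h, A, hA => by
    simp [natWrites, h.1.notMem_natWrites A hA, h.2.notMem_natWrites A hA]
  | ite _ P Q, h, A, hA => by
    simp [natWrites, h.1.notMem_natWrites A hA, h.2.notMem_natWrites A hA]
  | loop i b P, h, A, hA => by
    simp only [natWrites, List.mem_cons, not_or]
    exact ⟨fun hi => h.1 (hi ▸ hA), h.2.2.2.notMem_natWrites A hA⟩

/-- A bound for the number of steps, for the values of the loop bounds in the memory `s`. -/
def time (s : State) : ForProgram → ℕ
  | skip => 1
  | setNat _ i e => i.cost + e.cost + 1
  | setReal _ i e => i.cost + e.cost + 1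
  | seq P Q => P.time s + Q.time s
  | ite b P Q => b.cost + 1 + (P.time s + Q.time s)
  | loop _ b P => b.eval s * (b.cost + 12 + P.time s) + (b.cost + 9)

theorem time_congr {W : List ℕ} {s s' : State} (h : ∀ A ∈ W, s.nat A = s'.nat A) :
    ∀ {P : ForProgram}, P.WF W → P.time s = P.time s'
  | skip, _ => rfl
  | setNat _ _ _, _ => rfl
  | setReal _ _ _, _ => rfl
  | seq P Q, hP => by simp only [time, time_congr h hP.1, time_congr h hP.2]
  | ite b P Q, hP => by simp only [time, time_congr h hP.1, time_congr h hP.2]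
  | loop i b P, hP => by
    simp only [time, time_congr h hP.2.2.2, NExp.eval_congr fun A hA => h A (hP.2.2.1 A hA)]

/-- Programs with counted loops terminate, with the final memory state `run` and at most `time`
steps. `WF` guarantees that the loop bounds, and hence `time`, do not change during the execution.
-/
theorem exec_run {W : List ℕ} : ∀ {P : ForProgram}, P.WF W → ∀ s : State,
    ∃ t ≤ P.time s, Exec P.toProgram s (P.run s) t
  | skip, _, s => ⟨1, le_rfl, .skip s⟩
  | setNat A i e, _, s => ⟨_, le_rfl, .setNat A i e s⟩
  | setReal A i e, _, s => ⟨_, le_rfl, .setReal A i e s⟩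
  | seq P Q, h, s => by
    obtain ⟨t, ht, hP⟩ := exec_run h.1 s
    obtain ⟨t', ht', hQ⟩ := exec_run h.2 (P.run s)
    rw [time_congr (fun A hA => run_nat_of_notMem s (h.1.notMem_natWrites A hA)) h.2] at ht'
    exact ⟨t + t', Nat.add_le_add ht ht', .seq hP hQ⟩
  | ite b P Q, h, s => by
    obtain ⟨t, ht, hP⟩ := exec_run h.1 s
    obtain ⟨t', ht', hQ⟩ := exec_run h.2 s
    by_cases hb : b.Holds s
    · refine ⟨_, ?_, by simp only [run, if_pos hb]; exact .iteTrue hb hP⟩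
      simp only [time]; omega
    · refine ⟨_, ?_, by simp only [run, if_neg hb]; exact .iteFalse hb hQ⟩
      simp only [time]; omega
  | loop i b P, h, s => by
    obtain ⟨hi, hiP, hb, hP⟩ := h
    set f : ℕ → State := fun j =>
      Nat.rec (s.updateNat i 0 0) (fun j s' => (P.run s').updateNat i 0 (j + 1)) j with hf
    have hcount : ∀ j, (f j).nat i 0 = j := by
      intro j; cases j <;> simp [hf]
    have hW : ∀ j, ∀ A ∈ W, (f j).nat A = s.nat A := by
      intro j A hA
      have hne : A ≠ i := fun h => hi (h ▸ hA)
      induction j with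
      | zero => exact State.updateNat_nat_of_ne _ _ _ hne
      | succ j ih =>
        exact (State.updateNat_nat_of_ne _ _ _ hne).trans
          ((run_nat_of_notMem _ (hP.notMem_natWrites A hA)).trans ih)
    have hbound : ∀ j, b.eval (f j) = b.eval s := fun j =>
      NExp.eval_congr fun A hA => hW j A (hb A hA)
    have main : ∀ d j, j + d = b.eval s →
        ∃ t ≤ d * (b.cost + 12 + P.time s) + (b.cost + 6),
          Exec (.loop (.natLE (.add (.var i) (.lit 1)) b)
            (.seq P.toProgram (.setNat i (.lit 0) (.add (.var i) (.lit 1)))))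
            (f j) (f (b.eval s)) t := by
      intro d
      induction d with
      | zero =>
        intro j hj
        obtain rfl : j = b.eval s := by omega
        refine ⟨_, ?_, .loopFalse ?_⟩
        · simp [BExp.cost, NExp.cost]; omega
        · simp [BExp.Holds, NExp.eval, hbound, hcount]
      | succ d ih =>
        intro j hj
        obtain ⟨t', ht', hE'⟩ := ih (j + 1) (by omega)
        obtain ⟨t, ht, hE⟩ := exec_run hP (f j)
        rw [time_congr (hW j) hP] at ht
        have hset : Exec (.setNat i (.lit 0) (.add (.var i) (.lit 1))) (P.run (f j)) (f (j + 1))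
            6 := by
          have h1 := Exec.setNat i (.lit 0) (.add (.var i) (.lit 1)) (P.run (f j))
          have h2 : (P.run (f j)).nat i 0 = j := by rw [run_nat_of_notMem _ hiP, hcount]
          simpa [NExp.eval, NExp.cost, h2] using h1
        refine ⟨_, ?_, .loopTrue ?_ (.seq hE hset) hE'⟩
        · simp only [BExp.cost, NExp.cost]
          rw [Nat.succ_mul]
          omega
        · simp only [BExp.Holds, NExp.eval, hbound, hcount]
          omega
    obtain ⟨t, ht, hE⟩ := main (b.eval s) 0 (by omega)
    refine ⟨_, ?_, .seq (.setNat i (.lit 0) (.lit 0) s) hE⟩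
    simp only [time, NExp.cost]
    omega

end ForProgram

end RealRAM

/-! ### Neighbours, boundaries and components -/

namespace DAG

variable {n m : ℕ}

/-- Adjacency in the underlying undirected graph. -/
def Nbr (G : DAG n m) (u v : Fin n) : Prop :=
  ∃ e, (G.src e = u ∧ G.tgt e = v) ∨ (G.src e = v ∧ G.tgt e = u)

theorem src_ne_tgt (G : DAG n m) (e : Fin m) : G.src e ≠ G.tgt e := fun h =>
  G.acyclic (G.src e) (.single ⟨e, rfl, h.symm⟩)

theorem Nbr.symm {G : DAG n m} {u v : Fin n} : G.Nbr u v → G.Nbr v u :=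
  fun ⟨e, he⟩ => ⟨e, he.symm⟩

theorem nbr_src_tgt (G : DAG n m) (e : Fin m) : G.Nbr (G.src e) (G.tgt e) := ⟨e, .inl ⟨rfl, rfl⟩⟩

theorem nbr_tgt_src (G : DAG n m) (e : Fin m) : G.Nbr (G.tgt e) (G.src e) := ⟨e, .inr ⟨rfl, rfl⟩⟩

theorem underlying_adj_iff (G : DAG n m) {u v : Fin n} : G.underlying.Adj u v ↔ G.Nbr u v := by
  simp only [underlying, SimpleGraph.fromRel_adj, Nbr]
  constructor
  · rintro ⟨-, ⟨e, he⟩ | ⟨e, he⟩⟩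
    · exact ⟨e, .inl he⟩
    · exact ⟨e, .inr he⟩
  · rintro ⟨e, ⟨rfl, rfl⟩ | ⟨rfl, rfl⟩⟩
    · exact ⟨G.src_ne_tgt e, .inl ⟨e, rfl, rfl⟩⟩
    · exact ⟨(G.src_ne_tgt e).symm, .inr ⟨e, rfl, rfl⟩⟩

open Classical in
/-- The vertices outside `C` that are adjacent to `C`. -/
noncomputable def boundary (G : DAG n m) (C : Finset (Fin n)) : Finset (Fin n) :=
  {u | u ∉ C ∧ ∃ w ∈ C, G.Nbr w u}

theorem mem_boundary {G : DAG n m} {C : Finset (Fin n)} {u : Fin n} :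
    u ∈ G.boundary C ↔ u ∉ C ∧ ∃ w ∈ C, G.Nbr w u := by
  simp [boundary]

open Classical in
/-- The vertices that can be reached from `v` by an undirected path all of whose vertices, except
possibly `v`, lie in `R`.  For `v ∈ R` this is the component of `v` in the graph induced by `R`. -/
noncomputable def comp (G : DAG n m) (R : Finset (Fin n)) (v : Fin n) : Finset (Fin n) :=
  {w | Relation.ReflTransGen (fun a b => G.Nbr a b ∧ b ∈ R) v w}

section comp

variable {G : DAG n m} {R : Finset (Fin n)} {u v w : Fin n}

theorem mem_comp : w ∈ G.comp R v ↔ Relation.ReflTransGen (fun a b => G.Nbr a b ∧ b ∈ R) v w := by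
  simp [comp]

theorem self_mem_comp : v ∈ G.comp R v := mem_comp.2 .refl

theorem comp_subset (hv : v ∈ R) : G.comp R v ⊆ R := by
  intro w hw
  rcases (mem_comp.1 hw).cases_tail with rfl | ⟨_, _, h⟩
  · exact hv
  · exact h.2

theorem mem_comp_of_nbr (hu : u ∈ G.comp R v) (h : G.Nbr u w) (hw : w ∈ R) : w ∈ G.comp R v :=
  mem_comp.2 ((mem_comp.1 hu).tail ⟨h, hw⟩)

/-- A set that contains `v` and is closed in `R` contains the component of `v`. -/
theorem comp_subset_of_closed {A : Finset (Fin n)} (hv : v ∈ A)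
    (h : ∀ a ∈ A, ∀ b ∈ R, G.Nbr a b → b ∈ A) : G.comp R v ⊆ A := by
  intro w hw
  induction mem_comp.1 hw with
  | refl => exact hv
  | tail h1 h2 ih => exact h _ (ih (mem_comp.2 h1)) _ h2.2 h2.1

theorem comp_mono {R' : Finset (Fin n)} (h : R ⊆ R') : G.comp R v ⊆ G.comp R' v := fun _ hw =>
  mem_comp.2 (Relation.ReflTransGen.mono (r := fun a b => G.Nbr a b ∧ b ∈ R)
    (fun _ _ hab => ⟨hab.1, h hab.2⟩) _ _ (mem_comp.1 hw))

/-- Components of a subset that is closed in a larger set are components of the larger set. -/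
theorem comp_eq_of_closed {R' : Finset (Fin n)} (hR : R' ⊆ R)
    (hcl : ∀ a ∈ R', ∀ b ∈ R, G.Nbr a b → b ∈ R') (hv : v ∈ R') : G.comp R' v = G.comp R v := by
  refine (comp_mono hR).antisymm ?_
  have h1 : G.comp R' v ⊆ R' := comp_subset hv
  exact comp_subset_of_closed self_mem_comp fun a ha b hb hab =>
    mem_comp_of_nbr ha hab (hcl a (h1 ha) b hb hab)

theorem comp_symm (hv : v ∈ R) (h : u ∈ G.comp R v) : v ∈ G.comp R u := by
  have key : ∀ w, Relation.ReflTransGen (fun a b => G.Nbr a b ∧ b ∈ R) v w →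
      Relation.ReflTransGen (fun a b => G.Nbr a b ∧ b ∈ R) w v := by
    intro w hw
    induction hw with
    | refl => exact .refl
    | @tail b c h1 h2 ih =>
      exact .head ⟨h2.1.symm, comp_subset hv (mem_comp.2 h1)⟩ ih
  exact mem_comp.2 (key u (mem_comp.1 h))

theorem comp_eq_of_mem (hv : v ∈ R) (hu : u ∈ G.comp R v) : G.comp R u = G.comp R v := by
  refine (comp_subset_of_closed hu fun a ha b hb hab => mem_comp_of_nbr ha hab hb).antisymm ?_
  exact comp_subset_of_closed (comp_symm hv hu)
    fun a ha b hb hab => mem_comp_of_nbr ha hab hb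

theorem boundary_comp_disjoint {w : Fin n} (hw : w ∈ G.boundary (G.comp R v)) :
    w ∉ R := by
  obtain ⟨h1, x, hx, hxw⟩ := mem_boundary.1 hw
  exact fun h => h1 (mem_comp_of_nbr hx hxw h)

theorem boundary_comp_subset (hv : v ∈ R) : G.boundary (G.comp R v) ⊆ G.boundary R := by
  intro w hw
  obtain ⟨_, x, hx, hxw⟩ := mem_boundary.1 hw
  exact mem_boundary.2 ⟨boundary_comp_disjoint hw, x, comp_subset hv hx, hxw⟩

end comp

/-! ### Partition functions with boundary conditions -/

/-- Weights for assignments of states `1, …, B` to the vertices of a graph: a weight for the state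
of every vertex, and a weight for the states of the tail and the head of every edge. -/
structure Model (m : ℕ) where
  B : ℕ
  w : ℕ → ℝ
  φ : Fin m → ℕ → ℕ → ℝ

namespace Model

variable (μ : Model m) (G : DAG n m)

open Classical in
/-- The sum, over all ways to choose states for the vertices in `R`, of the product of the weights
of these vertices and of the edges that have an end in `R`; the other vertices have the states
prescribed by `σ`. -/
noncomputable def part (R : Finset (Fin n)) (σ : Fin n → ℕ) : ℝ :=
  ∑ τ ∈ Fintype.piFinset fun u => if u ∈ R then Finset.Icc 1 μ.B else {σ u},
    (∏ u ∈ R, μ.w (τ u)) *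
      ∏ e with G.src e ∈ R ∨ G.tgt e ∈ R, μ.φ e (τ (G.src e)) (τ (G.tgt e))

open Classical in
/-- The product of the weights of the edges with end `v` and no end in `R`. -/
noncomputable def pivotWeight (R : Finset (Fin n)) (v : Fin n) (σ : Fin n → ℕ) : ℝ :=
  ∏ e with (G.src e = v ∨ G.tgt e = v) ∧ G.src e ∉ R ∧ G.tgt e ∉ R,
    μ.φ e (σ (G.src e)) (σ (G.tgt e))

theorem part_empty (σ : Fin n → ℕ) : μ.part G ∅ σ = 1 := by
  simp [part]

/-- Summation over the state of the vertex `v` comes last. -/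
theorem part_insert {R : Finset (Fin n)} {v : Fin n} (hv : v ∉ R) (σ : Fin n → ℕ) :
    μ.part G (insert v R) σ = ∑ t ∈ Finset.Icc 1 μ.B,
      μ.w t * μ.pivotWeight G R v (Function.update σ v t) *
        μ.part G R (Function.update σ v t) := by
  classical
  unfold part
  rw [← Finset.sum_fiberwise_of_maps_to (t := Finset.Icc 1 μ.B) (g := fun τ => τ v)]
  · refine Finset.sum_congr rfl fun t ht => ?_
    have hset : {τ ∈ Fintype.piFinset fun u =>
          if u ∈ insert v R then Finset.Icc 1 μ.B else {σ u} | τ v = t} =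
        Fintype.piFinset fun u =>
          if u ∈ R then Finset.Icc 1 μ.B else {Function.update σ v t u} := by
      ext τ
      simp only [Finset.mem_filter, Fintype.mem_piFinset]
      constructor
      · rintro ⟨h, rfl⟩ u
        specialize h u
        by_cases huR : u ∈ R
        · simpa [huR] using h
        · by_cases huv : u = v
          · subst huv; simp [huR]
          · simpa [huR, huv] using h
      · intro h
        refine ⟨fun u => ?_, by simpa [hv] using h v⟩
        specialize h u
        by_cases huR : u ∈ R
        · simpa [huR] using h
        · by_cases huv : u = v
          · subst huv
            simp only [huR, if_false, Function.update_self, Finset.mem_singleton] at h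
            simpa [h] using Finset.mem_Icc.1 ht
          · simpa [huR, huv] using h
    rw [hset, Finset.mul_sum]
    refine Finset.sum_congr rfl fun τ hτ => ?_
    have hτ' : ∀ u, u ∉ R → τ u = Function.update σ v t u := by
      intro u hu
      have := Fintype.mem_piFinset.1 hτ u
      simpa [hu] using this
    have hτv : τ v = t := by simpa using hτ' v hv
    rw [Finset.prod_insert hv, hτv]
    have hsplit : (∏ e with G.src e ∈ insert v R ∨ G.tgt e ∈ insert v R,
          μ.φ e (τ (G.src e)) (τ (G.tgt e))) =
        μ.pivotWeight G R v (Function.update σ v t) *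
          ∏ e with G.src e ∈ R ∨ G.tgt e ∈ R, μ.φ e (τ (G.src e)) (τ (G.tgt e)) := by
      rw [← Finset.prod_filter_mul_prod_filter_not _ (fun e => G.src e ∈ R ∨ G.tgt e ∈ R),
        mul_comm]
      congr 1
      · rw [Finset.filter_filter]
        refine Finset.prod_congr ?_ fun e he => ?_
        · ext e
          simp only [Finset.mem_filter, Finset.mem_univ, true_and, Finset.mem_insert]
          tauto
        · simp only [Finset.mem_filter] at he
          rw [hτ' _ he.2.2.1, hτ' _ he.2.2.2]
      · rw [Finset.filter_filter]
        refine Finset.prod_congr ?_ fun _ _ => rfl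
        ext e
        simp only [Finset.mem_filter, Finset.mem_univ, true_and, Finset.mem_insert]
        tauto
    rw [hsplit]
    ring
  · intro τ hτ
    have := Fintype.mem_piFinset.1 hτ v
    simpa using this

/-- The partition function depends only on the states of the boundary. -/
theorem part_congr {R : Finset (Fin n)} {σ σ' : Fin n → ℕ}
    (h : ∀ u ∈ G.boundary R, σ u = σ' u) : μ.part G R σ = μ.part G R σ' := by
  classical
  induction R using Finset.induction_on generalizing σ σ' with
  | empty => rw [part_empty, part_empty]
  | insert v R hv ih =>
    have hout : ∀ t u, (∃ x ∈ insert v R, G.Nbr x u) → u ∉ R →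
        Function.update σ v t u = Function.update σ' v t u := by
      intro t u hu huR
      by_cases huv : u = v
      · subst huv; simp
      · simp only [Function.update_of_ne huv]
        exact h u (mem_boundary.2 ⟨by simp [huv, huR], hu⟩)
    rw [part_insert _ _ hv, part_insert _ _ hv]
    refine Finset.sum_congr rfl fun t _ => ?_
    congr 1
    · congr 1
      refine Finset.prod_congr rfl fun e he => ?_
      simp only [Finset.mem_filter, Finset.mem_univ, true_and] at he
      obtain ⟨hev, hs, ht⟩ := he
      have hvv : Function.update σ v t v = Function.update σ' v t v := by simp
      rcases hev with hev | hev
      · rw [hev, hvv, hout t (G.tgt e) ⟨v, by simp, hev ▸ G.nbr_src_tgt e⟩ ht]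
      · rw [hev, hvv, hout t (G.src e) ⟨v, by simp, hev ▸ G.nbr_tgt_src e⟩ hs]
    · refine ih fun u hu => ?_
      obtain ⟨huR, x, hx, hxu⟩ := mem_boundary.1 hu
      exact hout t u ⟨x, by simp [hx], hxu⟩ huR

/-- The partition function of a union of sets without common edges is a product. -/
theorem part_union {D R : Finset (Fin n)} (hDR : Disjoint D R)
    (hno : ∀ a ∈ D, ∀ b ∈ R, ¬ G.Nbr a b) (σ : Fin n → ℕ) :
    μ.part G (D ∪ R) σ = μ.part G D σ * μ.part G R σ := by
  classical
  induction D using Finset.induction_on generalizing σ with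
  | empty => simp [part_empty]
  | insert v D hv ih =>
    rw [Finset.disjoint_insert_left] at hDR
    have hno' : ∀ a ∈ D, ∀ b ∈ R, ¬ G.Nbr a b := fun a ha => hno a (by simp [ha])
    rw [Finset.insert_union, part_insert _ _ (by simp [hv, hDR.1]), part_insert _ _ hv,
      Finset.sum_mul]
    refine Finset.sum_congr rfl fun t _ => ?_
    have h1 : μ.part G R (Function.update σ v t) = μ.part G R σ := by
      refine part_congr _ _ fun u hu => ?_
      obtain ⟨_, x, hx, hxu⟩ := mem_boundary.1 hu
      rcases eq_or_ne u v with rfl | huv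
      · exact absurd hxu.symm (hno u (by simp) x hx)
      · simp [huv]
    have h2 : μ.pivotWeight G (D ∪ R) v (Function.update σ v t) =
        μ.pivotWeight G D v (Function.update σ v t) := by
      refine Finset.prod_congr ?_ fun _ _ => rfl
      ext e
      simp only [Finset.mem_filter, Finset.mem_univ, true_and, Finset.mem_union, not_or]
      constructor
      · tauto
      · rintro ⟨h, hs, ht⟩
        refine ⟨h, ⟨hs, fun hs' => ?_⟩, ht, fun ht' => ?_⟩
        · rcases h with h | h
          · exact hDR.1 (h ▸ hs')
          · exact hno v (by simp) _ hs' (h ▸ G.nbr_tgt_src e)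
        · rcases h with h | h
          · exact hno v (by simp) _ ht' (h ▸ G.nbr_src_tgt e)
          · exact hDR.1 (h ▸ ht')
    rw [ih hDR.2 hno', h1, h2]
    ring

/-- A set `D` that is closed in `R` splits off. -/
theorem part_eq_mul_sdiff {D R : Finset (Fin n)} (hD : D ⊆ R)
    (hcl : ∀ a ∈ D, ∀ b ∈ R, G.Nbr a b → b ∈ D) (σ : Fin n → ℕ) :
    μ.part G R σ = μ.part G D σ * μ.part G (R \ D) σ := by
  rw [← part_union μ G Finset.disjoint_sdiff, Finset.union_sdiff_of_subset hD]
  intro a ha b hb hab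
  rw [Finset.mem_sdiff] at hb
  exact hb.2 (hcl a ha b hb.1 hab)

end Model

/-! ### Addresses -/

/-- The value of the first `N` digits of `f` in base `D`, the last digit being the least
significant one. -/
def digitCode (D : ℕ) (f : ℕ → ℕ) : ℕ → ℕ
  | 0 => 0
  | j + 1 => digitCode D f j * D + f j

theorem digitCode_congr {D : ℕ} {f g : ℕ → ℕ} {N : ℕ} (h : ∀ j < N, f j = g j) :
    digitCode D f N = digitCode D g N := by
  induction N with
  | zero => rfl
  | succ N ih => rw [digitCode, digitCode, ih fun j hj => h j (by omega), h N (by omega)]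

theorem digitCode_inj {D : ℕ} {f g : ℕ → ℕ} : ∀ {N : ℕ}, (∀ j < N, f j < D) →
    (∀ j < N, g j < D) → digitCode D f N = digitCode D g N → ∀ j < N, f j = g j
  | 0, _, _, _, j, hj => absurd hj (by omega)
  | N + 1, hf, hg, h, j, hj => by
    rw [digitCode, digitCode] at h
    have hfN := hf N (by omega)
    have hgN := hg N (by omega)
    have h1 : digitCode D f N = digitCode D g N := by
      have := congrArg (· / D) h
      simpa [Nat.add_div_of_dvd_right, Nat.div_eq_of_lt hfN, Nat.div_eq_of_lt hgN,
        Nat.mul_div_cancel _ (show 0 < D by omega)] using this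
    rcases Nat.lt_succ_iff_lt_or_eq.1 hj with hj | rfl
    · exact digitCode_inj (fun i hi => hf i (by omega)) (fun i hi => hg i (by omega)) h1 j hj
    · rw [h1] at h; omega

open Classical in
/-- The digits that describe a set `C` together with states `σ` of its boundary: `1` on `C`,
`σ u + 1` on the boundary and `0` elsewhere. -/
noncomputable def digit (G : DAG n m) (C : Finset (Fin n)) (σ : Fin n → ℕ) (j : ℕ) : ℕ :=
  if h : j < n then
    if (⟨j, h⟩ : Fin n) ∈ C then 1 else if (⟨j, h⟩ : Fin n) ∈ G.boundary C then σ ⟨j, h⟩ + 1 else 0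
  else 0

/-- The memory cell used for the set `C` with states `σ` of its boundary. -/
noncomputable def address (G : DAG n m) (B : ℕ) (C : Finset (Fin n)) (σ : Fin n → ℕ) : ℕ :=
  digitCode (B + 2) (G.digit C σ) n

/-- The states of the boundary of `C` lie between `1` and `B`. -/
def Admissible (G : DAG n m) (B : ℕ) (C : Finset (Fin n)) (σ : Fin n → ℕ) : Prop :=
  ∀ u ∈ G.boundary C, 1 ≤ σ u ∧ σ u ≤ B

section address

variable {G : DAG n m} {B : ℕ} {C C' : Finset (Fin n)} {σ σ' : Fin n → ℕ}

theorem address_congr (h : ∀ u ∈ G.boundary C, σ u = σ' u) :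
    G.address B C σ = G.address B C σ' := by
  refine digitCode_congr fun j hj => ?_
  simp only [digit, hj, dite_true]
  split_ifs with h1 h2
  · rfl
  · rw [h _ h2]
  · rfl

theorem Admissible.digit_lt (h : G.Admissible B C σ) (j : ℕ) : G.digit C σ j < B + 2 := by
  unfold digit
  split_ifs with h1 h2 h3
  · omega
  · have := h _ h3; omega
  · omega
  · omega

/-- Distinct pairs of a set and states of its boundary have distinct addresses. -/
theorem address_inj (h : G.Admissible B C σ) (h' : G.Admissible B C' σ')
    (heq : G.address B C σ = G.address B C' σ') :
    C = C' ∧ ∀ u ∈ G.boundary C, σ u = σ' u := by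
  have hd := digitCode_inj (fun j _ => h.digit_lt j) (fun j _ => h'.digit_lt j) heq
  have hC : C = C' := by
    ext u
    have := hd u u.2
    simp only [digit, u.2, dite_true, Fin.eta] at this
    constructor
    · intro hu
      by_contra hu'
      rw [if_pos hu, if_neg hu'] at this
      split_ifs at this with h3
      have := h' u h3
      omega
    · intro hu
      by_contra hu'
      rw [if_neg hu', if_pos hu] at this
      split_ifs at this with h3
      have := h u h3
      omega
  subst hC
  refine ⟨rfl, fun u hu => ?_⟩
  have := hd u u.2
  have hu' := (mem_boundary.1 hu).1
  simpa [digit, u.2, hu', hu] using this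

end address

end DAG

/-! ### Components and addresses on the machine -/

/-- Natural-number array: `M`, the number of grid points of the discretization. -/
notation "arrM" => 3
/-- Natural-number array: `B = 2 M + 1`, the number of states of a vertex. -/
notation "arrB" => 4
/-- Natural-number array: the number of codes of partial assignments. -/
notation "arrT" => 5
/-- Natural-number array: the states of the vertices, `0` for vertices without state. -/
notation "arrState" => 6
/-- Natural-number array: indicator of a component. -/
notation "arrComp" => 7
/-- Natural-number array: indicator of the vertices that are adjacent to a component. -/
notation "arrNear" => 8
/-- Natural-number array: indicator of the set whose components are computed. -/
notation "arrRem" => 9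
/-- Natural-number array: indicator of the addresses at which a value is stored. -/
notation "arrFlag" => 10
/-- Natural-number array: nonzero as long as all values that are needed have been found. -/
notation "arrOk" => 11
/-- Natural-number array: an address. -/
notation "arrAddr" => 12
/-- Natural-number array: the address at which a new value is stored. -/
notation "arrTarget" => 13
/-- Natural-number array: scratch. -/
notation "arrTmp" => 14
/-- Natural-number array: the quotient in a division with remainder. -/
notation "arrQuot" => 15
/-- Natural-number array: the remainder in a division with remainder. -/
notation "arrDig" => 16
/-- Natural-number array: state of the tail of an edge. -/
notation "arrTail" => 18
/-- Natural-number array: state of the head of an edge. -/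
notation "arrHead" => 19
/-- Real array: the table of values. -/
notation "arrVal" => 3
/-- Real array: a sum. -/
notation "arrSum" => 4
/-- Real array: a product. -/
notation "arrProd" => 5
/-- Real array: scratch. -/
notation "arrFac" => 6

/-! Cell `0` of an array is used for scalar variables. The arrays `20`, …, `36` hold the counters of
the loops; a nested loop never uses the counter of an enclosing one. -/

namespace RealRAM

/-- The number of vertices. -/
abbrev NExp.numV : NExp := .read 0 (.lit 0)

/-- The number of edges. -/
abbrev NExp.numE : NExp := .read 0 (.lit 1)

/-- The tail of the edge with index `e`. -/
abbrev NExp.srcOf (e : NExp) : NExp := .read 1 e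

/-- The head of the edge with index `e`. -/
abbrev NExp.tgtOf (e : NExp) : NExp := .read 2 e

namespace ForProgram

open NExp

/-- For all vertices `u`: cell `u` of the array `A` is overwritten by `e`, in which the variable
`27` has the value `u`. -/
def fill (A : ℕ) (e : NExp) : ForProgram :=
  loop 27 numV (setNat A (var 27) e)

/-- If the edge `26` lies in the set `arrRem` and meets the set `arrComp`, add its ends to
`arrComp`. -/
def growEdge : ForProgram :=
  ite
    (.and (.natLE (lit 1) (add (read arrComp (srcOf (var 26))) (read arrComp (tgtOf (var 26)))))
      (.natLE (lit 2) (add (read arrRem (srcOf (var 26))) (read arrRem (tgtOf (var 26))))))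
    (setNat arrComp (srcOf (var 26)) (lit 1) ;; setNat arrComp (tgtOf (var 26)) (lit 1))
    skip

/-- Compute the component of the vertex in the variable `v`, in the set `arrRem`. -/
def growComp (v : ℕ) : ForProgram :=
  fill arrComp (lit 0) ;; setNat arrComp (var v) (lit 1) ;;
  loop 25 numV (loop 26 numE growEdge)

/-- If the edge `28` meets the set `arrComp`, mark its ends. -/
def markNear : ForProgram :=
  ite
    (.natLE (lit 1) (add (read arrComp (srcOf (var 28))) (read arrComp (tgtOf (var 28)))))
    (setNat arrNear (srcOf (var 28)) (lit 1) ;; setNat arrNear (tgtOf (var 28)) (lit 1))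
    skip

/-- Append the digit of the vertex `29` to an address. -/
def addDigit : ForProgram :=
  setNat arrTmp (lit 0) (lit 0) ;;
  loop 30 (add (var arrB) (lit 2)) (setNat arrTmp (lit 0) (add (var arrTmp) (var arrAddr))) ;;
  ite (.natLE (lit 1) (read arrComp (var 29)))
    (setNat arrAddr (lit 0) (add (var arrTmp) (lit 1)))
    (ite (.natLE (lit 1) (read arrNear (var 29)))
      (setNat arrAddr (lit 0) (add (var arrTmp) (add (read arrState (var 29)) (lit 1))))
      (setNat arrAddr (lit 0) (var arrTmp)))

/-- Compute the address that belongs to the set `arrComp` and the states `arrState` of its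
boundary. -/
def findAddress : ForProgram :=
  fill arrNear (lit 0) ;;
  loop 28 numE markNear ;;
  setNat arrAddr (lit 0) (lit 0) ;;
  loop 29 numV addDigit

end ForProgram

end RealRAM

open RealRAM ForProgram

namespace DAG

variable {n m : ℕ}

/-- The part of the memory that holds the input and the parameters of the discretization. -/
structure InputMem (G : DAG n m) (a : Fin m → ℕ) (x : ℝ) (M : ℕ) (s : State) : Prop where
  numV : s.nat 0 0 = n
  numE : s.nat 0 1 = m
  src : ∀ e : Fin m, s.nat 1 e = G.src e
  tgt : ∀ e : Fin m, s.nat 2 e = G.tgt e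
  valX : s.real 0 0 = x
  valA : ∀ e : Fin m, s.real 1 e = a e
  valM : s.nat arrM 0 = M
  valB : s.nat arrB 0 = 2 * M + 1

variable {G : DAG n m} {a : Fin m → ℕ} {x : ℝ} {M : ℕ} {s s' : State}

theorem InputMem.congr (h : G.InputMem a x M s) (hn : ∀ A < 5, s'.nat A = s.nat A)
    (hr : ∀ A < 2, s'.real A = s.real A) : G.InputMem a x M s' := by
  obtain ⟨h1, h2, h3, h4, h5, h6, h7, h8⟩ := h
  constructor
  · rw [hn 0 (by omega), h1]
  · rw [hn 0 (by omega), h2]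
  · intro e; rw [hn 1 (by omega), h3]
  · intro e; rw [hn 2 (by omega), h4]
  · rw [hr 0 (by omega), h5]
  · intro e; rw [hr 1 (by omega), h6]
  · rw [hn 3 (by omega), h7]
  · rw [hn 4 (by omega), h8]

theorem InputMem.of_frame {P : ForProgram} (h : G.InputMem a x M s) (hf : P.Frame s s')
    (hn : ∀ A ∈ P.natWrites, 5 ≤ A) (hr : ∀ A ∈ P.realWrites, 2 ≤ A) : G.InputMem a x M s' :=
  h.congr (fun A hA => hf.1 A fun h => by have := hn A h; omega)
    (fun A hA => hf.2 A fun h => by have := hr A h; omega)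

/-- The array `A` holds the indicator function of `S`. -/
def Indicates (s : State) (A : ℕ) (S : Finset (Fin n)) : Prop :=
  ∀ u : Fin n, s.nat A u = if u ∈ S then 1 else 0

theorem Indicates.congr {A : ℕ} {S : Finset (Fin n)} (h : Indicates s A S)
    (hs : s'.nat A = s.nat A) : Indicates s' A S := by
  intro u; rw [hs]; exact h u

@[simp] theorem fill_natWrites (A : ℕ) (e : NExp) : (fill A e).natWrites = [27, A] := rfl

@[simp] theorem fill_realWrites (A : ℕ) (e : NExp) : (fill A e).realWrites = [] := rfl

/-- The expression `e` may read the cells of `A` with index at least `j`, which still have their old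
values when cell `j` is overwritten. -/
theorem run_fill {A : ℕ} {e : NExp} (hA : A ≠ 27) (hn : s.nat 0 0 = n) (f : ℕ → ℕ)
    (he : ∀ j s', j < n → (∀ A', A' ≠ A → A' ≠ 27 → s'.nat A' = s.nat A') → s'.nat 27 0 = j →
      (∀ u, j ≤ u → s'.nat A u = s.nat A u) → e.eval s' = f j) (u : Fin n) :
    ((fill A e).run s).nat A u = f u := by
  have key := run_loop_induct (i := 27) (b := .numV) (P := setNat A (.var 27) e) (s := s) (N := n)
    (by simpa [NExp.eval] using hn)
    (fun j s' => (∀ u < j, s'.nat A u = f u) ∧ ∀ u, j ≤ u → s'.nat A u = s.nat A u)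
    (by simp [hA]) (by
      intro j s' hj hi hf ⟨h1, h2⟩
      have hev : e.eval s' = f j := by
        refine he j s' hj (fun A' h h' => hf.1 A' ?_) hi h2
        simp [natWrites, h, h']
      constructor
      · intro u hu
        simp only [run, NExp.eval, hi, State.updateNat_nat, hA, false_and, if_false, true_and, hev]
        split_ifs with h
        · rw [h]
        · exact h1 u (by omega)
      · intro u hu
        simp only [run, NExp.eval, hi, State.updateNat_nat, hA, false_and, if_false, true_and]
        rw [if_neg (by omega)]
        exact h2 u (by omega))
  exact key.1 u u.2

@[simp] theorem growEdge_natWrites : growEdge.natWrites = [7, 7] := rfl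

@[simp] theorem growEdge_realWrites : growEdge.realWrites = [] := rfl

@[simp] theorem growComp_natWrites (v : ℕ) :
    (growComp v).natWrites = [27, 7, 7, 25, 26, 7, 7] := rfl

@[simp] theorem growComp_realWrites (v : ℕ) : (growComp v).realWrites = [] := rfl

/-- One round of `growComp`: an edge between the set and `R` adds its ends to the set. -/
theorem run_grow {R A : Finset (Fin n)} {v : Fin n} (hs : G.InputMem a x M s)
    (hR : Indicates s arrRem R) (hA : Indicates s arrComp A) (hAc : A ⊆ G.comp R v) (hv : v ∈ R) :
    ∃ A', Indicates ((loop 26 .numE growEdge).run s) arrComp A' ∧ A ⊆ A' ∧ A' ⊆ G.comp R v ∧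
      ∀ c ∈ A, ∀ b ∈ R, G.Nbr c b → b ∈ A' := by
  classical
  have key := run_loop_induct (i := 26) (b := .numE) (P := growEdge) (s := s) (N := m)
      (by simpa [NExp.eval] using hs.numE)
    (fun j s' => ∃ A', Indicates s' arrComp A' ∧ A ⊆ A' ∧ A' ⊆ G.comp R v ∧
      ∀ e : Fin m, (e : ℕ) < j → G.src e ∈ R → G.tgt e ∈ R → (G.src e ∈ A ∨ G.tgt e ∈ A) →
        G.src e ∈ A' ∧ G.tgt e ∈ A')
    ⟨A, fun u => by simpa using hA u, subset_rfl, hAc, by simp⟩ (by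
      rintro j s' hj hi hf ⟨A', h1, h2, h3, h4⟩
      have hs' : G.InputMem a x M s' := hs.of_frame hf (by simp [natWrites])
        (by simp [realWrites])
      have hR' : Indicates s' arrRem R := hR.congr (hf.1 _ (by simp [natWrites]))
      set e : Fin m := ⟨j, hj⟩ with he
      have hsrc : s'.nat 1 (s'.nat 26 0) = G.src e := by rw [hi]; exact hs'.src e
      have htgt : s'.nat 2 (s'.nat 26 0) = G.tgt e := by rw [hi]; exact hs'.tgt e
      have hcond : BExp.Holds s' (.and (.natLE (.lit 1) (.add (.read arrComp (.srcOf (.var 26)))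
            (.read arrComp (.tgtOf (.var 26))))) (.natLE (.lit 2)
            (.add (.read arrRem (.srcOf (.var 26))) (.read arrRem (.tgtOf (.var 26)))))) ↔
          (G.src e ∈ A' ∨ G.tgt e ∈ A') ∧ G.src e ∈ R ∧ G.tgt e ∈ R := by
        simp only [BExp.Holds, NExp.eval, hsrc, htgt, h1 (G.src e), h1 (G.tgt e), hR' (G.src e),
          hR' (G.tgt e)]
        by_cases g1 : G.src e ∈ A' <;> by_cases g2 : G.tgt e ∈ A' <;>
          by_cases g3 : G.src e ∈ R <;> by_cases g4 : G.tgt e ∈ R <;> simp [g1, g2, g3, g4]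
      have hlt : ∀ e' : Fin m, (e' : ℕ) < j + 1 → (e' : ℕ) < j ∨ e' = e := by
        intro e' h'
        rcases Nat.lt_succ_iff_lt_or_eq.1 h' with h' | h'
        · exact .inl h'
        · exact .inr (Fin.ext h')
      simp only [growEdge, run, hcond]
      split_ifs with hc
      · refine ⟨insert (G.src e) (insert (G.tgt e) A'), fun u => ?_, ?_, ?_, ?_⟩
        · simp only [NExp.eval, hsrc, State.updateNat_nat]
          have h26 : (26 : ℕ) ≠ 7 := by decide
          have h27 : (7 : ℕ) ≠ 26 := by decide
          have h28 : (2 : ℕ) ≠ 7 := by decide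
          simp only [h26, h27, h28, false_and, if_false, true_and, htgt, Fin.val_inj, h1 u,
            Finset.mem_insert]
          by_cases g1 : u = G.src e <;> by_cases g2 : u = G.tgt e <;> simp [g1, g2]
        · exact h2.trans ((Finset.subset_insert _ _).trans (Finset.subset_insert _ _))
        · intro u hu
          simp only [Finset.mem_insert] at hu
          obtain ⟨hc1, hc2, hc3⟩ := hc
          have hsc : G.src e ∈ G.comp R v := by
            rcases hc1 with h | h
            · exact h3 h
            · exact mem_comp_of_nbr (h3 h) (G.nbr_tgt_src e) hc2
          have htc : G.tgt e ∈ G.comp R v := mem_comp_of_nbr hsc (G.nbr_src_tgt e) hc3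
          rcases hu with rfl | rfl | hu
          · exact hsc
          · exact htc
          · exact h3 hu
        · intro e' he' hs1 ht1 hA1
          rcases hlt e' he' with h | rfl
          · have := h4 e' h hs1 ht1 hA1
            simp [this.1, this.2]
          · simp
      · refine ⟨A', fun u => by simpa using h1 u, h2, h3, ?_⟩
        intro e' he' hs1 ht1 hA1
        rcases hlt e' he' with h | rfl
        · exact h4 e' h hs1 ht1 hA1
        · exact absurd ⟨hA1.imp (fun h => h2 h) (fun h => h2 h), hs1, ht1⟩ hc)
  obtain ⟨A', h1, h2, h3, h4⟩ := key
  refine ⟨A', h1, h2, h3, ?_⟩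
  rintro c hc b hb ⟨e, ⟨rfl, rfl⟩ | ⟨rfl, rfl⟩⟩
  · exact (h4 e e.2 (comp_subset hv (hAc hc)) hb (.inl hc)).2
  · exact (h4 e e.2 hb (comp_subset hv (hAc hc)) (.inr hc)).1

/-- The component is complete after `n` rounds, since every round before that either adds a vertex
or leaves a set that is closed in `R`. -/
theorem run_growComp {R : Finset (Fin n)} {v : Fin n} {i : ℕ} (hs : G.InputMem a x M s)
    (hR : Indicates s arrRem R) (hv : v ∈ R) (hi : s.nat i 0 = v) (hi7 : i ≠ 7) (hi27 : i ≠ 27) :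
    Indicates ((growComp i).run s) arrComp (G.comp R v) := by
  classical
  unfold growComp
  simp only [run_seq, run_setNat]
  set s1 := (fill arrComp (.lit 0)).run s with hs1
  have hf1 : (fill arrComp (.lit 0)).Frame s s1 := frame_run _ _
  have h1 : ∀ u : Fin n, s1.nat 7 u = 0 :=
    run_fill (by decide) hs.numV (fun _ => 0) fun _ _ _ _ _ _ => rfl
  have hi1 : s1.nat i 0 = v := by
    rw [hf1.1 i (by simp [hi7, hi27]), hi]
  set s2 := s1.updateNat 7 (NExp.eval s1 (.var i)) (NExp.eval s1 (.lit 1)) with hs2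
  have hs2' : G.InputMem a x M s2 :=
    (hs.of_frame hf1 (by simp) (by simp)).of_frame
      (P := setNat 7 (.var i) (.lit 1)) (frame_run _ _) (by simp [natWrites])
      (by simp [realWrites])
  have hA : Indicates s2 arrComp {v} := by
    intro u
    simp [hs2, NExp.eval, hi1, h1, Fin.val_inj]
  have hR2 : Indicates s2 arrRem R := by
    refine hR.congr ?_
    rw [hs2, State.updateNat_nat_of_ne _ _ _ (by decide), hf1.1 _ (by simp)]
  have key := run_loop_induct (i := 25) (b := .numV) (P := loop 26 .numE growEdge)
    (s := s2) (N := n)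
      (by simpa [NExp.eval] using hs2'.numV)
    (fun j s' => ∃ A, Indicates s' arrComp A ∧ v ∈ A ∧ A ⊆ G.comp R v ∧
      ((∀ c ∈ A, ∀ b ∈ R, G.Nbr c b → b ∈ A) ∨ j + 1 ≤ A.card))
    ⟨{v}, fun u => by simpa using hA u, by simp, by simp [self_mem_comp], by simp⟩ (by
      rintro j s' hj hij hf ⟨A, h1, h2, h3, h4⟩
      have hs' : G.InputMem a x M s' := hs2'.of_frame hf (by simp [natWrites])
        (by simp [realWrites])
      have hR' : Indicates s' arrRem R := hR2.congr (hf.1 _ (by simp [natWrites]))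
      obtain ⟨A', g1, g2, g3, g4⟩ := run_grow hs' hR' h1 h3 hv
      refine ⟨A', fun u => by simpa using g1 u, g2 h2, g3, ?_⟩
      by_cases hAA : A' = A
      · left
        rw [hAA] at g4 ⊢
        exact g4
      · have hlt : A.card < A'.card :=
          Finset.card_lt_card (g2.ssubset_of_ne fun h => hAA h.symm)
        rcases h4 with h4 | h4
        · exact absurd (g3.trans (comp_subset_of_closed h2 h4)) fun h => hAA (h.antisymm g2)
        · right; omega)
  obtain ⟨A, h1, h2, h3, h4⟩ := key
  have hcl : ∀ c ∈ A, ∀ b ∈ R, G.Nbr c b → b ∈ A := by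
    rcases h4 with h4 | h4
    · exact h4
    · have := Finset.card_le_univ A
      rw [Fintype.card_fin] at this
      omega
  rw [h3.antisymm (comp_subset_of_closed h2 hcl)] at h1
  exact h1

@[simp] theorem markNear_natWrites : markNear.natWrites = [8, 8] := rfl

@[simp] theorem markNear_realWrites : markNear.realWrites = [] := rfl

@[simp] theorem addDigit_natWrites : addDigit.natWrites = [14, 30, 14, 12, 12, 12] := rfl

@[simp] theorem addDigit_realWrites : addDigit.realWrites = [] := rfl

@[simp] theorem findAddress_natWrites : findAddress.natWrites =
    [27, 8, 28, 8, 8, 12, 29, 14, 30, 14, 12, 12, 12] := rfl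

@[simp] theorem findAddress_realWrites : findAddress.realWrites = [] := rfl

theorem run_findAddress {C : Finset (Fin n)} {σ : Fin n → ℕ} (hs : G.InputMem a x M s)
    (hC : Indicates s arrComp C) (hσ : ∀ u : Fin n, s.nat arrState u = σ u) :
    (findAddress.run s).nat arrAddr 0 = G.address (2 * M + 1) C σ := by
  classical
  unfold findAddress
  simp only [run_seq, run_setNat]
  set s1 := (fill arrNear (.lit 0)).run s with hs1
  have hf1 : (fill arrNear (.lit 0)).Frame s s1 := frame_run _ _
  have h1 : ∀ u : Fin n, s1.nat 8 u = 0 :=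
    run_fill (by decide) hs.numV (fun _ => 0) fun _ _ _ _ _ _ => rfl
  have hs1' : G.InputMem a x M s1 :=
    hs.of_frame hf1 (by simp) (by simp)
  have hC1 : Indicates s1 arrComp C := hC.congr (hf1.1 _ (by simp))
  -- the vertices that are adjacent to `C`, and possibly some vertices of `C`
  have key1 := run_loop_induct (i := 28) (b := .numE) (P := markNear) (s := s1) (N := m)
      (by simpa [NExp.eval] using hs1'.numE)
    (fun j s' => ∀ u : Fin n, s'.nat arrNear u = if ∃ e : Fin m, (e : ℕ) < j ∧
      (G.src e ∈ C ∨ G.tgt e ∈ C) ∧ (u = G.src e ∨ u = G.tgt e) then 1 else 0)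
    (fun u => by simpa using h1 u) (by
      rintro j s' hj hi hf h
      have hs' : G.InputMem a x M s' := hs1'.of_frame hf (by simp [natWrites])
        (by simp [realWrites])
      have hC' : Indicates s' arrComp C := hC1.congr (hf.1 _ (by simp [natWrites]))
      set e : Fin m := ⟨j, hj⟩ with he
      have hsrc : s'.nat 1 (s'.nat 28 0) = G.src e := by rw [hi]; exact hs'.src e
      have htgt : s'.nat 2 (s'.nat 28 0) = G.tgt e := by rw [hi]; exact hs'.tgt e
      have hcond : BExp.Holds s' (.natLE (.lit 1) (.add (.read arrComp (.srcOf (.var 28)))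
          (.read arrComp (.tgtOf (.var 28))))) ↔ (G.src e ∈ C ∨ G.tgt e ∈ C) := by
        simp only [BExp.Holds, NExp.eval, hsrc, htgt, hC' (G.src e), hC' (G.tgt e)]
        by_cases g1 : G.src e ∈ C <;> by_cases g2 : G.tgt e ∈ C <;> simp [g1, g2]
      have hlt : ∀ u, (∃ e' : Fin m, (e' : ℕ) < j + 1 ∧
          (G.src e' ∈ C ∨ G.tgt e' ∈ C) ∧ (u = G.src e' ∨ u = G.tgt e')) ↔
          (∃ e' : Fin m, (e' : ℕ) < j ∧
            (G.src e' ∈ C ∨ G.tgt e' ∈ C) ∧ (u = G.src e' ∨ u = G.tgt e')) ∨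
          ((G.src e ∈ C ∨ G.tgt e ∈ C) ∧ (u = G.src e ∨ u = G.tgt e)) := by
        intro u
        constructor
        · rintro ⟨e', h', h''⟩
          rcases Nat.lt_succ_iff_lt_or_eq.1 h' with h' | h'
          · exact .inl ⟨e', h', h''⟩
          · obtain rfl : e' = e := Fin.ext h'
            exact .inr h''
        · rintro (⟨e', h', h''⟩ | h'')
          · exact ⟨e', by omega, h''⟩
          · exact ⟨e, by simp [he], h''⟩
      intro u
      simp only [markNear, run, hcond, hlt]
      split_ifs with hc h2 h2
      · simp only [NExp.eval, hsrc, State.updateNat_nat]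
        have e1 : (28 : ℕ) ≠ 8 := by decide
        have e2 : (8 : ℕ) ≠ 28 := by decide
        have e3 : (2 : ℕ) ≠ 8 := by decide
        simp only [e1, e2, e3, false_and, if_false, true_and, htgt, Fin.val_inj, h u]
        rcases h2 with h2 | h2
        · simp [h2]
        · rcases h2.2 with h2 | h2 <;> simp [h2]
      · simp only [NExp.eval, hsrc, State.updateNat_nat]
        have e1 : (28 : ℕ) ≠ 8 := by decide
        have e2 : (8 : ℕ) ≠ 28 := by decide
        have e3 : (2 : ℕ) ≠ 8 := by decide
        simp only [e1, e2, e3, false_and, if_false, true_and, htgt, Fin.val_inj, h u]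
        simp only [hc, true_and, not_or] at h2
        simp [h2.1, h2.2.1, h2.2.2]
      · simp only [State.updateNat_nat, h u]
        simp [h2.resolve_right fun h => hc h.1]
      · simp only [State.updateNat_nat, h u]
        rw [if_neg fun h => h2 (.inl h)]
        simp)
  set s2 := (loop 28 .numE markNear).run s1 with hs2
  have hf2 := frame_run (loop 28 .numE markNear) s1
  rw [← hs2] at hf2
  have hnear : ∀ u : Fin n, u ∉ C → s2.nat 8 u = if u ∈ G.boundary C then 1 else 0 := by
    intro u hu
    rw [key1 u]
    congr 1
    simp only [mem_boundary, hu, not_false_eq_true, true_and, eq_iff_iff]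
    constructor
    · rintro ⟨e, -, h, rfl | rfl⟩
      · exact ⟨_, h.resolve_left hu, G.nbr_tgt_src e⟩
      · exact ⟨_, h.resolve_right hu, G.nbr_src_tgt e⟩
    · rintro ⟨w, hw, e, ⟨rfl, rfl⟩ | ⟨rfl, rfl⟩⟩
      · exact ⟨e, e.2, .inl hw, .inr rfl⟩
      · exact ⟨e, e.2, .inr hw, .inl rfl⟩
  set s3 := s2.updateNat 12 (NExp.eval s2 (.lit 0)) (NExp.eval s2 (.lit 0)) with hs3
  have hs3' : G.InputMem a x M s3 :=
    (hs1'.of_frame hf2 (by simp [natWrites]) (by simp [realWrites])).of_frame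
      (P := setNat 12 (.lit 0) (.lit 0)) (frame_run _ _) (by simp [natWrites])
      (by simp [realWrites])
  have hC3 : Indicates s3 arrComp C := by
    refine hC1.congr ?_
    rw [hs3, State.updateNat_nat_of_ne _ _ _ (by decide), hf2.1 _ (by simp [natWrites])]
  have hσ3 : ∀ u : Fin n, s3.nat arrState u = σ u := by
    intro u
    rw [hs3, State.updateNat_nat_of_ne _ _ _ (by decide), hf2.1 _ (by simp [natWrites]),
      hf1.1 _ (by simp), hσ]
  have hn3 : ∀ u : Fin n, u ∉ C → s3.nat 8 u = if u ∈ G.boundary C then 1 else 0 := by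
    intro u hu
    rw [hs3, State.updateNat_nat_of_ne _ _ _ (by decide), hnear u hu]
  refine run_loop_induct (i := 29) (b := .numV) (P := addDigit) (N := n)
      (by simpa [NExp.eval] using hs3'.numV)
    (fun j s' => s'.nat 12 0 = digitCode (2 * M + 1 + 2) (G.digit C σ) j)
    ?_ ?_
  · simp [hs3, NExp.eval, digitCode]
  intro j s' hj hi hf h
  have hs' : G.InputMem a x M s' := hs3'.of_frame hf (by simp [natWrites]) (by simp [realWrites])
  simp only [addDigit, run_seq, run_setNat]
  set t1 := s'.updateNat 14 (NExp.eval s' (.lit 0)) (NExp.eval s' (.lit 0)) with ht1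
  have key2 := run_loop_induct (i := 30) (b := .add (.var arrB) (.lit 2))
    (P := setNat arrTmp (.lit 0) (.add (.var arrTmp) (.var arrAddr))) (s := t1) (N := 2 * M + 1 + 2)
    (by simp [NExp.eval, ht1, hs'.valB]) (fun i t => t.nat 14 0 = t1.nat 12 0 * i)
    (by simp [ht1, NExp.eval]) (by
      intro i t hi1 hi2 hft ht
      have h12 : t.nat 12 = t1.nat 12 := hft.1 _ (by simp [natWrites])
      simp [run, NExp.eval, ht, h12, Nat.mul_succ])
  set t2 := (loop 30 (.add (.var arrB) (.lit 2))
    (setNat arrTmp (.lit 0) (.add (.var arrTmp) (.var arrAddr)))).run t1 with ht2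
  have hf3 := frame_run (loop 30 (.add (.var arrB) (.lit 2))
    (setNat arrTmp (.lit 0) (.add (.var arrTmp) (.var arrAddr)))) t1
  rw [← ht2] at hf3
  have hfr : ∀ A, A ≠ 30 → A ≠ 14 → t2.nat A = s'.nat A := by
    intro A h30 h14
    rw [hf3.1 A (by simp [natWrites, h30, h14]), ht1, State.updateNat_nat_of_ne _ _ _ h14]
  have h14 : t2.nat 14 0 = digitCode (2 * M + 1 + 2) (G.digit C σ) j * (2 * M + 1 + 2) := by
    rw [key2, ht1, State.updateNat_nat_of_ne _ _ _ (by decide), h]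
  set u : Fin n := ⟨j, hj⟩ with hu
  have h29 : t2.nat 29 0 = u := by rw [hfr _ (by decide) (by decide), hi]
  have hc : t2.nat 7 u = if u ∈ C then 1 else 0 := by
    rw [hfr _ (by decide) (by decide), hf.1 _ (by simp [natWrites]), hC3 u]
  have hst : t2.nat 6 u = σ u := by
    rw [hfr _ (by decide) (by decide), hf.1 _ (by simp [natWrites]), hσ3 u]
  have hnr : u ∉ C → t2.nat 8 u = if u ∈ G.boundary C then 1 else 0 := by
    intro huC
    rw [hfr _ (by decide) (by decide), hf.1 _ (by simp [natWrites]), hn3 u huC]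
  have hd : G.digit C σ j = if u ∈ C then 1 else if u ∈ G.boundary C then σ u + 1 else 0 := by
    simp [digit, hj, hu]
  rw [digitCode, hd]
  by_cases huC : u ∈ C
  · simp [run, BExp.Holds, NExp.eval, h29, hc, huC, h14]
  · by_cases huN : u ∈ G.boundary C
    · simp [run, BExp.Holds, NExp.eval, h29, hc, hnr huC, huC, huN, hst, h14]
    · simp [run, BExp.Holds, NExp.eval, h29, hc, hnr huC, huC, huN, h14]

end DAG

/-! ### Products over components and over edges -/

namespace RealRAM

/-- Disjunction of tests. -/
def BExp.or (b c : BExp) : BExp := .not (.and (.not b) (.not c))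

/-- Equality of natural numbers. -/
def BExp.natEq (e f : NExp) : BExp := .and (.natLE e f) (.natLE f e)

@[simp] theorem BExp.holds_or {s : State} {b c : BExp} :
    (BExp.or b c).Holds s ↔ b.Holds s ∨ c.Holds s := by
  simp only [BExp.or, BExp.Holds]; tauto

@[simp] theorem BExp.holds_natEq {s : State} {e f : NExp} :
    (BExp.natEq e f).Holds s ↔ e.eval s = f.eval s := by
  simp only [BExp.natEq, BExp.Holds]; omega

namespace ForProgram

open NExp

/-- Multiply the product by the table entry of the component of the vertex `24`, and remove this
component from the set `arrRem`. -/
def takeComp : ForProgram :=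
  growComp 24 ;; findAddress ;;
  setNat arrOk (lit 0) (sub (var arrOk) (sub (lit 1) (read arrFlag (var arrAddr)))) ;;
  setReal arrProd (lit 0) (.mul (.read arrProd (lit 0)) (.read arrVal (var arrAddr))) ;;
  fill arrRem (sub (read arrRem (var 27)) (read arrComp (var 27)))

/-- Multiply the product by the table entries of all components of the set `arrRem`. -/
def takeComps : ForProgram :=
  loop 24 numV (ite (.natLE (lit 1) (read arrRem (var 24))) takeComp skip)

/-- Multiply the product by the weight of the edge `31`. -/
def edgeFactor : ForProgram :=
  ite (.natLE (read arrState (srcOf (var 31))) (add (var arrM) (lit 1)))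
    (setNat arrTail (lit 0) (sub (read arrState (srcOf (var 31))) (lit 1)))
    (setNat arrTail (lit 0) (sub (sub (read arrState (srcOf (var 31))) (lit 1)) (var arrM))) ;;
  ite (.natLE (read arrState (tgtOf (var 31))) (add (var arrM) (lit 1)))
    (setNat arrHead (lit 0) (read arrState (tgtOf (var 31))))
    (setNat arrHead (lit 0) (sub (sub (read arrState (tgtOf (var 31))) (lit 1)) (var arrM))) ;;
  setReal arrFac (lit 0) (.div
    (.mul (.ofNat (sub (var arrHead) (var arrTail))) (.read 0 (lit 0)))
    (.mul (.ofNat (var arrM)) (.read 1 (var 31)))) ;;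
  ite (.realLE (.read arrFac (lit 0)) (.ofNat (lit 1)))
    (setReal arrProd (lit 0) (.mul (.read arrProd (lit 0)) (.read arrFac (lit 0))))
    skip

/-- Multiply the product by the weights of all edges at the vertex `22` both ends of which have a
state. -/
def edgeFactors : ForProgram :=
  loop 31 numE (ite
    (.and (.or (.natEq (srcOf (var 31)) (var 22)) (.natEq (tgtOf (var 31)) (var 22)))
      (.and (.natLE (lit 1) (read arrState (srcOf (var 31))))
        (.natLE (lit 1) (read arrState (tgtOf (var 31))))))
    edgeFactor skip)

@[simp] theorem takeComp_natWrites : takeComp.natWrites =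
    (growComp 24).natWrites ++ (findAddress.natWrites ++ [11, 27, 9]) := rfl

@[simp] theorem takeComp_realWrites : takeComp.realWrites = [5] := rfl

@[simp] theorem takeComps_natWrites : takeComps.natWrites = 24 :: (takeComp.natWrites ++ []) := rfl

@[simp] theorem takeComps_realWrites : takeComps.realWrites = [5] := rfl

@[simp] theorem edgeFactor_natWrites : edgeFactor.natWrites = [18, 18, 19, 19] := rfl

@[simp] theorem edgeFactor_realWrites : edgeFactor.realWrites = [6, 5] := rfl

@[simp] theorem edgeFactors_natWrites : edgeFactors.natWrites = [31, 18, 18, 19, 19] := rfl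

@[simp] theorem edgeFactors_realWrites : edgeFactors.realWrites = [6, 5] := rfl

end ForProgram

end RealRAM

namespace DAG

variable {n m : ℕ} {G : DAG n m} {a : Fin m → ℕ} {x : ℝ} {M : ℕ} {s s' : State}

/-- The states `1, …, M + 1` stand for the labels `0, …, M` of a vertex with sign `1`, the states
`M + 2, …, 2 M + 1` for the labels `1, …, M` with sign `-1`. This is the label. -/
def tailLabel (M t : ℕ) : ℕ := if t ≤ M + 1 then t - 1 else t - 1 - M

/-- The strict upper bound for arrivals at a vertex: one more than the label if the sign is `1`, the
label itself if the sign is `-1`. -/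
def headLabel (M t : ℕ) : ℕ := if t ≤ M + 1 then t else t - 1 - M

/-- The model whose partition function is the probability that all paths are short, for edge
lengths that are rounded down to multiples of `x / M`. -/
noncomputable def pathModel (a : Fin m → ℕ) (x : ℝ) (M : ℕ) : Model m where
  B := 2 * M + 1
  w t := if t ≤ M + 1 then 1 else -1
  φ e t t' := min 1 (((headLabel M t' - tailLabel M t : ℕ) : ℝ) * x / (M * a e))

/-- All table entries that are marked as present are correct. -/
def TableSound (G : DAG n m) (a : Fin m → ℕ) (x : ℝ) (M : ℕ) (s : State) : Prop :=
  ∀ C σ, G.Admissible (2 * M + 1) C σ → s.nat arrFlag (G.address (2 * M + 1) C σ) ≠ 0 →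
    s.real arrVal (G.address (2 * M + 1) C σ) = (pathModel a x M).part G C σ

theorem TableSound.congr (h : G.TableSound a x M s) (hn : s'.nat arrFlag = s.nat arrFlag)
    (hr : s'.real arrVal = s.real arrVal) : G.TableSound a x M s' := by
  intro C σ hσ hf
  rw [hn] at hf
  rw [hr]
  exact h C σ hσ hf

theorem run_takeComp {R : Finset (Fin n)} {v : Fin n} {σ : Fin n → ℕ}
    (hs : G.InputMem a x M s) (hR : Indicates s arrRem R) (hv : v ∈ R) (hi : s.nat 24 0 = v)
    (hσ : ∀ u : Fin n, s.nat arrState u = σ u) :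
    Indicates (takeComp.run s) arrRem (R \ G.comp R v) ∧
    (takeComp.run s).nat arrOk 0 = s.nat arrOk 0 -
      (1 - s.nat arrFlag (G.address (2 * M + 1) (G.comp R v) σ)) ∧
    (takeComp.run s).real arrProd 0 = s.real arrProd 0 *
      s.real arrVal (G.address (2 * M + 1) (G.comp R v) σ) := by
  classical
  unfold takeComp
  simp only [run_seq, run_setNat, run_setReal]
  set s1 := (growComp 24).run s with hs1
  have hf1 : (growComp 24).Frame s s1 := frame_run _ _
  have hs1' : G.InputMem a x M s1 := hs.of_frame hf1 (by simp) (by simp)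
  have hC : Indicates s1 arrComp (G.comp R v) :=
    run_growComp hs hR hv hi (by decide) (by decide)
  set s2 := findAddress.run s1 with hs2
  have hf2 : findAddress.Frame s1 s2 := frame_run _ _
  have hs2' : G.InputMem a x M s2 := hs1'.of_frame hf2 (by simp) (by simp)
  have haddr : s2.nat arrAddr 0 = G.address (2 * M + 1) (G.comp R v) σ := by
    refine run_findAddress hs1' hC fun u => ?_
    rw [hf1.1 _ (by simp), hσ]
  have hok : s2.nat arrOk 0 = s.nat arrOk 0 := by rw [hf2.1 _ (by simp), hf1.1 _ (by simp)]
  have hfl : s2.nat arrFlag = s.nat arrFlag := by rw [hf2.1 _ (by simp), hf1.1 _ (by simp)]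
  have hval : s2.real arrVal = s.real arrVal := by rw [hf2.2 _ (by simp), hf1.2 _ (by simp)]
  have hprod : s2.real arrProd = s.real arrProd := by rw [hf2.2 _ (by simp), hf1.2 _ (by simp)]
  refine ⟨?_, ?_, ?_⟩
  · intro u
    rw [run_fill (s := State.updateReal _ _ _ _) (by decide)
      (by simpa using hs2'.numV) (fun j => s.nat 9 j - s2.nat 7 j)]
    · have h7 : s2.nat 7 u = if u ∈ G.comp R v then 1 else 0 := by
        rw [hf2.1 _ (by simp), hC u]
      simp only [h7, hR u, Finset.mem_sdiff]
      by_cases h1 : u ∈ R <;> by_cases h2 : u ∈ G.comp R v <;> simp [h1, h2]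
    · intro j t hj hA hi' hu
      simp only [NExp.eval, hi', hu j le_rfl, hA 7 (by decide) (by decide)]
      simp only [State.updateReal_nat, State.updateNat_nat]
      rw [hf2.1 9 (by simp), hf1.1 9 (by simp)]
      simp
  · rw [run_nat_of_notMem _ (by simp)]
    simp [NExp.eval, haddr, hok, hfl]
  · rw [run_real_of_notMem _ (by simp)]
    simp [NExp.eval, RExp.eval, haddr, hval, hprod]

/-- After `takeComps` has run through the set `R`: if no table entry was missing, the product has
been multiplied by the partition function of `R`; and if the entries of all components of `R` are
present, then no entry was missing. -/
theorem run_takeComps {R : Finset (Fin n)} {σ : Fin n → ℕ}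
    (hs : G.InputMem a x M s) (htab : G.TableSound a x M s) (hR : Indicates s arrRem R)
    (hσ : ∀ u : Fin n, s.nat arrState u = σ u) (hadm : G.Admissible (2 * M + 1) R σ)
    (hok : s.nat arrOk 0 ≤ 1) :
    (takeComps.run s).nat arrOk 0 ≤ 1 ∧
    ((takeComps.run s).nat arrOk 0 ≠ 0 → s.nat arrOk 0 ≠ 0 ∧
      (takeComps.run s).real arrProd 0 = s.real arrProd 0 * (pathModel a x M).part G R σ) ∧
    (s.nat arrOk 0 ≠ 0 →
      (∀ u ∈ R, s.nat arrFlag (G.address (2 * M + 1) (G.comp R u) σ) ≠ 0) →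
      (takeComps.run s).nat arrOk 0 ≠ 0) := by
  classical
  have key := run_loop_induct (i := 24) (b := .numV)
    (P := .ite (.natLE (.lit 1) (.read arrRem (.var 24))) takeComp skip) (s := s) (N := n)
    (by simpa [NExp.eval] using hs.numV)
    (fun j s' => ∃ R' ⊆ R, Indicates s' arrRem R' ∧ (∀ c ∈ R', ∀ b ∈ R, G.Nbr c b → b ∈ R') ∧
      (∀ u : Fin n, (u : ℕ) < j → u ∉ R') ∧
      s'.nat arrOk 0 ≤ 1 ∧
      (s'.nat arrOk 0 ≠ 0 → s.nat arrOk 0 ≠ 0 ∧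
        s'.real arrProd 0 * (pathModel a x M).part G R' σ =
          s.real arrProd 0 * (pathModel a x M).part G R σ) ∧
      (s.nat arrOk 0 ≠ 0 →
        (∀ u ∈ R, s.nat arrFlag (G.address (2 * M + 1) (G.comp R u) σ) ≠ 0) →
        s'.nat arrOk 0 ≠ 0))
    ⟨R, subset_rfl, fun u => by simpa using hR u, fun _ _ b hb _ => hb, by simp,
      by simpa using hok, by simp, by simp; tauto⟩ (by
      rintro j s' hj hi hf ⟨R', hR', h1, h2, h3, h0, h4, h5⟩
      have hs' : G.InputMem a x M s' := hs.of_frame hf (by simp [natWrites]) (by simp [realWrites])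
      have htab' : G.TableSound a x M s' :=
        htab.congr (hf.1 _ (by simp [natWrites])) (hf.2 _ (by simp [realWrites]))
      have hfl : s'.nat arrFlag = s.nat arrFlag := hf.1 _ (by simp [natWrites])
      set u : Fin n := ⟨j, hj⟩ with hu
      have hlt : ∀ u' : Fin n, (u' : ℕ) < j + 1 → (u' : ℕ) < j ∨ u' = u := by
        intro u' h'
        rcases Nat.lt_succ_iff_lt_or_eq.1 h' with h' | h'
        · exact .inl h'
        · exact .inr (Fin.ext h')
      have hcond : BExp.Holds s' (.natLE (.lit 1) (.read arrRem (.var 24))) ↔ u ∈ R' := by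
        have := h1 u
        simp only [BExp.Holds, NExp.eval, hi]
        rw [show j = (u : ℕ) from rfl, this]
        split_ifs with h <;> simp [h]
      by_cases huR : u ∈ R'
      · rw [run_ite_pos _ _ (hcond.2 huR)]
        have hcomp : G.comp R' u = G.comp R u := comp_eq_of_closed hR' h2 huR
        obtain ⟨g1, g2, g3⟩ := run_takeComp (v := u) (σ := σ) hs' h1 huR hi fun u => by
          rw [hf.1 _ (by simp [natWrites]), hσ]
        rw [hcomp, hfl] at g2
        rw [hcomp] at g1 g3
        have hDR : G.comp R u ⊆ R' := hcomp ▸ comp_subset huR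
        have hadm' : G.Admissible (2 * M + 1) (G.comp R u) σ := fun w hw =>
          hadm w (boundary_comp_subset (hR' huR) hw)
        refine ⟨R' \ G.comp R u, Finset.sdiff_subset.trans hR', fun w => by simpa using g1 w,
          ?_, ?_, ?_, ?_, ?_⟩
        · intro c hc b hb hcb
          rw [Finset.mem_sdiff] at hc ⊢
          exact ⟨h2 c hc.1 b hb hcb, fun h => hc.2 (mem_comp_of_nbr h hcb.symm (hR' hc.1))⟩
        · intro u' hu' hmem
          rw [Finset.mem_sdiff] at hmem
          rcases hlt u' hu' with h | rfl
          · exact h3 u' h hmem.1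
          · exact hmem.2 self_mem_comp
        · simp only [State.updateNat_nat, Nat.reduceEqDiff, false_and, if_false]
          omega
        · simp only [State.updateNat_real, State.updateNat_nat, Nat.reduceEqDiff, false_and,
            if_false]
          rw [g2]
          intro hne
          obtain ⟨k1, k2⟩ := h4 (by omega)
          refine ⟨k1, ?_⟩
          rw [g3, htab' _ _ hadm' (by rw [hfl]; omega), ← k2,
            (pathModel a x M).part_eq_mul_sdiff G hDR]
          · ring
          · intro c hc b hb hcb
            exact mem_comp_of_nbr hc hcb (hR' hb)
        · intro k1 k2
          simp only [State.updateNat_nat, Nat.reduceEqDiff, false_and, if_false]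
          rw [g2]
          have := k2 u (hR' huR)
          have := h5 k1 k2
          omega
      · rw [run_ite_neg _ _ (fun h => huR (hcond.1 h))]
        refine ⟨R', hR', fun w => by simpa [run] using h1 w, h2, ?_, by simpa [run] using h0,
          by simpa [run] using h4,
          by simpa [run] using h5⟩
        intro u' hu' hmem
        rcases hlt u' hu' with h | rfl
        · exact h3 u' h hmem
        · exact huR hmem)
  obtain ⟨R', -, -, -, h3, h0, h4, h5⟩ := key
  obtain rfl : R' = ∅ := Finset.eq_empty_of_forall_notMem fun u => h3 u u.2
  simp only [Model.part_empty, mul_one] at h4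
  exact ⟨h0, h4, h5⟩

theorem run_edgeFactor {e : Fin m} {σ : Fin n → ℕ} (hs : G.InputMem a x M s)
    (he : s.nat 31 0 = e) (hσ : ∀ u : Fin n, s.nat arrState u = σ u) :
    (edgeFactor.run s).real arrProd 0 =
      s.real arrProd 0 * (pathModel a x M).φ e (σ (G.src e)) (σ (G.tgt e)) := by
  have hsrc : s.nat 1 e = G.src e := hs.src e
  have htgt : s.nat 2 e = G.tgt e := hs.tgt e
  have hM := hs.valM
  have hx := hs.valX
  have ha := hs.valA e
  have h1 := hσ (G.src e)
  have h2 := hσ (G.tgt e)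
  simp only [pathModel, headLabel, tailLabel]
  by_cases c1 : σ (G.src e) ≤ M + 1 <;> by_cases c2 : σ (G.tgt e) ≤ M + 1 <;>
  · simp only [edgeFactor, run, BExp.Holds, NExp.eval, RExp.eval, he, hsrc, hM, h1, c1, c2,
      if_true, if_false, State.updateNat_nat, State.updateReal_real]
    simp [he, htgt, hM, hx, ha, h2, c2]
    rw [min_def, apply_ite State.real, ite_apply, ite_apply]
    split_ifs with g1 g2 g2
    all_goals first
      | rfl
      | exact absurd (le_of_not_ge g1) g2
      | (rw [le_antisymm g1 g2, mul_one]; simp)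
      | (rw [mul_one]; simp)

theorem run_edgeFactors {v : Fin n} {σ : Fin n → ℕ} (hs : G.InputMem a x M s)
    (hv : s.nat 22 0 = v) (hσ : ∀ u : Fin n, s.nat arrState u = σ u) :
    (edgeFactors.run s).real arrProd 0 = s.real arrProd 0 *
      ∏ e with (G.src e = v ∨ G.tgt e = v) ∧ 1 ≤ σ (G.src e) ∧ 1 ≤ σ (G.tgt e),
        (pathModel a x M).φ e (σ (G.src e)) (σ (G.tgt e)) := by
  set g : Fin m → ℝ := fun e =>
    if (G.src e = v ∨ G.tgt e = v) ∧ 1 ≤ σ (G.src e) ∧ 1 ≤ σ (G.tgt e) then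
      (pathModel a x M).φ e (σ (G.src e)) (σ (G.tgt e)) else 1 with hg
  have key := run_loop_induct (i := 31) (b := .numE)
    (P := .ite (.and
      (.or (.natEq (.srcOf (.var 31)) (.var 22)) (.natEq (.tgtOf (.var 31)) (.var 22)))
      (.and (.natLE (.lit 1) (.read arrState (.srcOf (.var 31))))
        (.natLE (.lit 1) (.read arrState (.tgtOf (.var 31)))))) edgeFactor skip)
    (s := s) (N := m)
      (by simpa [NExp.eval] using hs.numE)
    (fun j s' => s'.real arrProd 0 = s.real arrProd 0 *
      ∏ i ∈ Finset.range j, if h : i < m then g ⟨i, h⟩ else 1)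
    (by simp) (by
      intro j s' hj hi hf h
      have hs' : G.InputMem a x M s' := hs.of_frame hf (by simp [natWrites]) (by simp [realWrites])
      have hσ' : ∀ u : Fin n, s'.nat arrState u = σ u := by
        intro u; rw [hf.1 _ (by simp [natWrites]), hσ]
      set e : Fin m := ⟨j, hj⟩ with he
      have hsrc : s'.nat 1 (s'.nat 31 0) = G.src e := by rw [hi]; exact hs'.src e
      have htgt : s'.nat 2 (s'.nat 31 0) = G.tgt e := by rw [hi]; exact hs'.tgt e
      have hv' : s'.nat 22 0 = v := by rw [hf.1 _ (by simp [natWrites]), hv]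
      have hcond : BExp.Holds s' (.and (.or (.natEq (.srcOf (.var 31)) (.var 22))
          (.natEq (.tgtOf (.var 31)) (.var 22)))
          (.and (.natLE (.lit 1) (.read arrState (.srcOf (.var 31))))
          (.natLE (.lit 1) (.read arrState (.tgtOf (.var 31)))))) ↔
          (G.src e = v ∨ G.tgt e = v) ∧ 1 ≤ σ (G.src e) ∧ 1 ≤ σ (G.tgt e) := by
        simp only [BExp.holds_or, BExp.holds_natEq, BExp.Holds, NExp.eval, hsrc, htgt, hv', hσ',
          Fin.val_inj]
      rw [Finset.prod_range_succ, dif_pos hj, ← he, ← mul_assoc, ← h]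
      by_cases hc : (G.src e = v ∨ G.tgt e = v) ∧ 1 ≤ σ (G.src e) ∧ 1 ≤ σ (G.tgt e)
      · rw [run_ite_pos _ _ (hcond.2 hc), hg]
        simp only [State.updateNat_real, if_pos hc]
        exact run_edgeFactor hs' hi hσ'
      · rw [run_ite_neg _ _ (fun h => hc (hcond.1 h)), hg]
        simp [run, if_neg hc])
  refine key.trans ?_
  rw [Finset.prod_filter, Finset.prod_range]
  simp [hg]

end DAG

/-! ### Enumeration of the partial assignments -/

/-- Natural-number array: the vertex that receives a state. -/
notation "arrVert" => 17

namespace RealRAM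

namespace ForProgram

open NExp

/-- Division of `arrQuot` by `b`, with quotient in `arrQuot` and remainder in `arrDig`; correct if
`arrQuot` is at most `arrT`. -/
def divMod (b : NExp) : ForProgram :=
  setNat arrDig (lit 0) (var arrQuot) ;; setNat arrQuot (lit 0) (lit 0) ;;
  loop 33 (var arrT) (ite (.natLE b (var arrDig))
    (setNat arrDig (lit 0) (sub (var arrDig) b) ;;
      setNat arrQuot (lit 0) (add (var arrQuot) (lit 1)))
    skip)

/-- Split off a vertex and a state from the code in `arrQuot`, and give this state to the vertex. -/
def decodeStep : ForProgram :=
  divMod (add numV (lit 1)) ;; setNat arrVert (lit 0) (var arrDig) ;; divMod (var arrB) ;;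
  setNat arrState (var arrVert) (add (var arrDig) (lit 1))

/-- Decode the variable `21` to a partial assignment of states to at most `k` vertices. -/
def decode (k : ℕ) : ForProgram :=
  fill arrState (lit 0) ;; setNat arrQuot (lit 0) (var 21) ;; loop 32 (lit k) decodeStep

@[simp] theorem divMod_natWrites (b : NExp) :
    (divMod b).natWrites = [16, 15, 33, 16, 15] := rfl

@[simp] theorem divMod_realWrites (b : NExp) : (divMod b).realWrites = [] := rfl

@[simp] theorem decodeStep_natWrites :
    decodeStep.natWrites = [16, 15, 33, 16, 15, 17, 16, 15, 33, 16, 15, 6] := rfl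

@[simp] theorem decodeStep_realWrites : decodeStep.realWrites = [] := rfl

@[simp] theorem decode_natWrites (k : ℕ) : (decode k).natWrites =
    [27, 6, 15, 32, 16, 15, 33, 16, 15, 17, 16, 15, 33, 16, 15, 6] := rfl

@[simp] theorem decode_realWrites (k : ℕ) : (decode k).realWrites = [] := rfl

theorem run_divMod {b : NExp} {s : State} {d q : ℕ} (hd : 0 < d) (hq : s.nat arrQuot 0 = q)
    (hT : q ≤ s.nat arrT 0)
    (hb : ∀ s' : State, (∀ A, A ≠ 16 → A ≠ 15 → A ≠ 33 → s'.nat A = s.nat A) → b.eval s' = d) :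
    ((divMod b).run s).nat arrQuot 0 = q / d ∧ ((divMod b).run s).nat arrDig 0 = q % d := by
  unfold divMod
  simp only [run_seq, run_setNat]
  set s2 := (s.updateNat 16 (eval s (lit 0)) (eval s (var arrQuot))).updateNat 15
    (eval (s.updateNat 16 (eval s (lit 0)) (eval s (var arrQuot))) (lit 0))
    (eval (s.updateNat 16 (eval s (lit 0)) (eval s (var arrQuot))) (lit 0)) with hs2
  have h2 : ∀ A, A ≠ 16 → A ≠ 15 → s2.nat A = s.nat A := by
    intro A h h'
    rw [hs2, State.updateNat_nat_of_ne _ _ _ h', State.updateNat_nat_of_ne _ _ _ h]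
  have key := run_loop_induct (i := 33) (b := .var arrT) (P := .ite (.natLE b (var arrDig))
    (setNat arrDig (lit 0) (sub (var arrDig) b) ;;
      setNat arrQuot (lit 0) (add (var arrQuot) (lit 1))) skip) (s := s2) (N := s.nat arrT 0)
    (by simp [eval, h2])
    (fun j s' => s'.nat arrDig 0 + d * s'.nat arrQuot 0 = q ∧
      (s'.nat arrDig 0 < d ∨ j ≤ s'.nat arrQuot 0))
    (by simp [hs2, eval, hq]) (by
      rintro j s' hj hi hf ⟨h3, h4⟩
      have hbs : b.eval s' = d := by
        refine hb s' fun A h16 h15 h33 => ?_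
        rw [hf.1 A (by simp [natWrites, h16, h15, h33]), h2 A h16 h15]
      by_cases hc : d ≤ s'.nat arrDig 0
      · rw [run_ite_pos _ _ (by simpa [BExp.Holds, hbs, eval] using hc)]
        simp only [run, eval, hbs]
        simp only [State.updateNat_nat, Nat.reduceEqDiff, false_and, if_false, true_and, if_true]
        constructor
        · rw [Nat.mul_succ]; omega
        · omega
      · rw [run_ite_neg _ _ (by simpa [BExp.Holds, hbs, eval] using hc)]
        simp only [run, State.updateNat_nat, Nat.reduceEqDiff, false_and, if_false]
        exact ⟨h3, .inl (by omega)⟩)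
  obtain ⟨h3, h4⟩ := key
  set z := State.nat _ 16 0
  set p := State.nat _ 15 0
  have hz : z < d := by
    rcases h4 with h4 | h4
    · exact h4
    · have : p ≤ d * p := Nat.le_mul_of_pos_left _ hd
      omega
  constructor
  · rw [← h3, Nat.add_mul_div_left _ _ hd, Nat.div_eq_of_lt hz, Nat.zero_add]
  · rw [← h3, Nat.add_mul_mod_self_left, Nat.mod_eq_of_lt hz]

end ForProgram

end RealRAM

namespace DAG

/-- The assignment that is obtained from `σ` by giving states to (at most) `j` vertices, as
prescribed by the code `q`. The vertex `n`, which does not exist, serves as padding. -/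
def decodeFrom (n B : ℕ) : ℕ → ℕ → (ℕ → ℕ) → ℕ → ℕ
  | 0, _, σ => σ
  | j + 1, q, σ => decodeFrom n B j (q / (n + 1) / B)
      (Function.update σ (q % (n + 1)) (q / (n + 1) % B + 1))

theorem decodeFrom_congr {n B : ℕ} {u : ℕ} : ∀ {j q : ℕ} {σ σ' : ℕ → ℕ}, σ u = σ' u →
    decodeFrom n B j q σ u = decodeFrom n B j q σ' u
  | 0, _, _, _, h => h
  | j + 1, q, σ, σ', h => by
    refine decodeFrom_congr (j := j) ?_
    rw [Function.update_apply, Function.update_apply, h]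

theorem decodeFrom_le {n B : ℕ} (hB : 0 < B) {u : ℕ} : ∀ {j q : ℕ} {σ : ℕ → ℕ}, σ u ≤ B →
    decodeFrom n B j q σ u ≤ B
  | 0, _, _, h => h
  | j + 1, q, σ, h => by
    refine decodeFrom_le (j := j) hB ?_
    rw [Function.update_apply]
    split_ifs
    · exact Nat.mod_lt _ hB
    · exact h

/-- The partial assignment with code `c`. -/
def decodeState (n B k c : ℕ) (u : Fin n) : ℕ := decodeFrom n B k c (fun _ => 0) u

/-- Every assignment of states to at most `k` vertices has a code. -/
theorem exists_decodeFrom_eq {n B : ℕ} (hB : 0 < B) (σ : Fin n → ℕ) : ∀ {k : ℕ}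
    {Z : Finset (Fin n)}, Z.card ≤ k → (∀ u ∈ Z, 1 ≤ σ u ∧ σ u ≤ B) → ∀ σ₀ : ℕ → ℕ,
    ∃ c < ((n + 1) * B) ^ k, ∀ u : Fin n,
      decodeFrom n B k c σ₀ u = if u ∈ Z then σ u else σ₀ u
  | 0, Z, hZ, _, σ₀ => by
    obtain rfl : Z = ∅ := Finset.card_eq_zero.1 (by omega)
    exact ⟨0, by simp, by simp [decodeFrom]⟩
  | k + 1, Z, hZ, hσ, σ₀ => by
    -- the lowest digits of the code: a vertex and its state
    obtain ⟨z, t, hz, ht, Z', hZ', hsub, hval⟩ : ∃ z t, z < n + 1 ∧ t < B ∧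
        ∃ Z' : Finset (Fin n), Z'.card ≤ k ∧ Z' ⊆ Z ∧ ∀ u : Fin n,
          (if u ∈ Z' then σ u else Function.update σ₀ z (t + 1) u) =
            if u ∈ Z then σ u else σ₀ u := by
      rcases Z.eq_empty_or_nonempty with rfl | ⟨z, hz⟩
      · refine ⟨n, 0, by omega, hB, ∅, by simp, by simp, fun u => ?_⟩
        simp [u.2.ne]
      · have := hσ z hz
        refine ⟨z, σ z - 1, by omega, by omega, Z.erase z, ?_, Z.erase_subset z, fun u => ?_⟩
        · rw [Finset.card_erase_of_mem hz]; omega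
        · by_cases huz : u = z
          · subst huz
            simp [hz]; omega
          · have : (u : ℕ) ≠ z := fun h => huz (Fin.ext h)
            simp [huz, this]
    obtain ⟨c, hc, hcd⟩ := exists_decodeFrom_eq hB σ hZ' (fun u hu => hσ u (hsub hu))
      (Function.update σ₀ z (t + 1))
    refine ⟨z + (n + 1) * (t + B * c), ?_, fun u => ?_⟩
    · rw [pow_succ]
      have h1 : t + B * c < B * ((n + 1) * B) ^ k := by
        calc t + B * c < B + B * c := by omega
          _ = B * (c + 1) := by ring
          _ ≤ _ := Nat.mul_le_mul_left _ hc
      calc z + (n + 1) * (t + B * c) < (n + 1) + (n + 1) * (t + B * c) := by omega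
        _ = (n + 1) * (t + B * c + 1) := by ring
        _ ≤ (n + 1) * (B * ((n + 1) * B) ^ k) := Nat.mul_le_mul_left _ h1
        _ = _ := by ring
    · have e1 : (z + (n + 1) * (t + B * c)) % (n + 1) = z := by
        rw [Nat.add_mul_mod_self_left, Nat.mod_eq_of_lt hz]
      have e2 : (z + (n + 1) * (t + B * c)) / (n + 1) = t + B * c := by
        rw [Nat.add_mul_div_left _ _ (by omega), Nat.div_eq_of_lt hz, Nat.zero_add]
      have e3 : (t + B * c) % B = t := by
        rw [Nat.add_mul_mod_self_left, Nat.mod_eq_of_lt ht]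
      have e4 : (t + B * c) / B = c := by
        rw [Nat.add_mul_div_left _ _ hB, Nat.div_eq_of_lt ht, Nat.zero_add]
      rw [decodeFrom, e1, e2, e3, e4, hcd u, hval u]

variable {n m : ℕ} {G : DAG n m} {a : Fin m → ℕ} {x : ℝ} {M : ℕ} {s s' : State}

theorem run_decodeStep (hs : G.InputMem a x M s) (hT : s.nat arrQuot 0 ≤ s.nat arrT 0) :
    (decodeStep.run s).nat arrQuot 0 = s.nat arrQuot 0 / (n + 1) / (2 * M + 1) ∧
    (decodeStep.run s).nat arrState = Function.update (s.nat arrState)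
      (s.nat arrQuot 0 % (n + 1)) (s.nat arrQuot 0 / (n + 1) % (2 * M + 1) + 1) := by
  unfold decodeStep
  simp only [run_seq, run_setNat]
  set q := s.nat arrQuot 0 with hq
  obtain ⟨h1, h2⟩ := run_divMod (b := .add .numV (.lit 1)) (d := n + 1) (by omega) hq.symm hT
    (fun s' h => by simp [NExp.eval, h 0, hs.numV])
  set s1 := (divMod (.add .numV (.lit 1))).run s with hs1
  have hf1 : (divMod (.add .numV (.lit 1))).Frame s s1 := frame_run _ _
  have hs1' := hs.of_frame hf1 (by simp) (by simp)
  set s2 := s1.updateNat arrVert (NExp.eval s1 (.lit 0)) (NExp.eval s1 (.var arrDig)) with hs2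
  have hf2 : ∀ A, A ≠ 17 → s2.nat A = s1.nat A := fun A h => State.updateNat_nat_of_ne _ _ _ h
  have h5 : s2.nat arrT 0 = s.nat arrT 0 := by rw [hf2 _ (by decide), hf1.1 _ (by simp)]
  have h17 : s2.nat 17 0 = q % (n + 1) := by simp [hs2, NExp.eval, h2]
  obtain ⟨h3, h4⟩ := run_divMod (s := s2) (b := .var arrB) (d := 2 * M + 1) (q := q / (n + 1))
    (by omega)
    (by rw [hf2 _ (by decide), h1]) (by rw [h5]; exact (Nat.div_le_self _ _).trans hT)
    (fun s' h => by simp [NExp.eval, h 4, hf2 4, hs1'.valB])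
  set s3 := (divMod (.var arrB)).run s2 with hs3
  have hf3 : (divMod (.var arrB)).Frame s2 s3 := frame_run _ _
  have h6 : s3.nat arrState = s.nat arrState := by
    rw [hf3.1 _ (by simp), hf2 _ (by decide), hf1.1 _ (by simp)]
  have h17' : s3.nat 17 0 = q % (n + 1) := by rw [hf3.1 _ (by simp), h17]
  constructor
  · simp [NExp.eval, h3]
  · simp only [NExp.eval, h17', h4]
    funext u
    simp [h6, Function.update_apply]

theorem run_decode {k c : ℕ} (hs : G.InputMem a x M s) (hc : s.nat 21 0 = c)
    (hT : c ≤ s.nat arrT 0) (u : Fin n) :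
    ((decode k).run s).nat arrState u = decodeState n (2 * M + 1) k c u := by
  unfold decode
  simp only [run_seq, run_setNat]
  set s1 := (fill arrState (.lit 0)).run s with hs1
  have hf1 : (fill arrState (.lit 0)).Frame s s1 := frame_run _ _
  have h0 : ∀ u : Fin n, s1.nat 6 u = 0 :=
    run_fill (by decide) hs.numV (fun _ => 0) fun _ _ _ _ _ _ => rfl
  have hs1' := hs.of_frame hf1 (by simp) (by simp)
  set s2 := s1.updateNat arrQuot (NExp.eval s1 (.lit 0)) (NExp.eval s1 (.var 21)) with hs2
  have hf2 : ∀ A, A ≠ 15 → s2.nat A = s1.nat A := fun A h => State.updateNat_nat_of_ne _ _ _ h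
  have hs2' : G.InputMem a x M s2 := hs1'.congr (fun A hA => hf2 A (by omega)) fun _ _ => rfl
  have hq2 : s2.nat 15 0 = c := by
    simp [hs2, NExp.eval, hf1.1 21 (by simp), hc]
  have h5 : s2.nat 5 0 = s.nat 5 0 := by rw [hf2 _ (by decide), hf1.1 _ (by simp)]
  have key := run_loop_induct (i := 32) (b := .lit k) (P := decodeStep) (s := s2) (N := k) rfl
    (fun j s' => s'.nat 15 0 ≤ s.nat 5 0 ∧
      decodeFrom n (2 * M + 1) (k - j) (s'.nat 15 0) (s'.nat 6) =
        decodeFrom n (2 * M + 1) k c (s1.nat 6))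
    (by
      rw [State.updateNat_nat_of_ne s2 (A' := 15) _ _ (by decide),
        State.updateNat_nat_of_ne s2 (A' := 6) _ _ (by decide), hq2, hf2 6 (by decide)]
      exact ⟨hT, rfl⟩) (by
      rintro j s' hj hi hf ⟨h3, h4⟩
      have hs' := hs2'.of_frame hf (by simp [natWrites]) (by simp [realWrites])
      obtain ⟨g1, g2⟩ := run_decodeStep hs' (by rw [hf.1 5 (by simp [natWrites]), h5]; exact h3)
      rw [State.updateNat_nat_of_ne _ _ _ (by decide), State.updateNat_nat_of_ne _ _ _ (by decide),
        g1, g2, ← h4, show k - j = (k - (j + 1)) + 1 by omega, decodeFrom]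
      exact ⟨((Nat.div_le_self _ _).trans (Nat.div_le_self _ _)).trans h3, rfl⟩)
  have h7 := congrFun key.2 u
  rw [Nat.sub_self, decodeFrom] at h7
  rw [h7]
  exact decodeFrom_congr (h0 u)

end DAG

/-! ### Summation over the states of a pivot -/

namespace RealRAM

namespace ForProgram

open NExp

/-- Compute the component of the vertex `22` among the vertices without state. -/
def freeComp : ForProgram :=
  fill arrRem (sub (lit 1) (read arrState (var 27))) ;; growComp 22

/-- Add to the sum the contribution of the state `t + 1` of the vertex `22`, where `t` is the
variable `23`. -/
def addState : ForProgram :=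
  setNat arrState (var 22) (lit 0) ;; freeComp ;; fill arrRem (read arrComp (var 27)) ;;
  setNat arrRem (var 22) (lit 0) ;; setNat arrState (var 22) (add (var 23) (lit 1)) ;;
  ite (.natLE (var 23) (var arrM)) (setReal arrProd (lit 0) (.ofNat (lit 1)))
    (setReal arrProd (lit 0) (.sub (.ofNat (lit 0)) (.ofNat (lit 1)))) ;;
  edgeFactors ;; takeComps ;;
  setReal arrSum (lit 0) (.add (.read arrSum (lit 0)) (.read arrProd (lit 0)))

/-- Compute the table entry of the component of the vertex `22` by summation over the states of
this vertex, and store it unless some table entry that is needed is missing. -/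
def pivot : ForProgram :=
  freeComp ;; findAddress ;; setNat arrTarget (lit 0) (var arrAddr) ;;
  setNat arrOk (lit 0) (lit 1) ;; setReal arrSum (lit 0) (.ofNat (lit 0)) ;;
  loop 23 (var arrB) addState ;;
  ite (.natLE (lit 1) (var arrOk))
    (setReal arrVal (var arrTarget) (.read arrSum (lit 0)) ;;
      setNat arrFlag (var arrTarget) (lit 1))
    skip

/-- Try the vertex `22` as a pivot for the partial assignment with the code `21`. -/
def tryPivot (k : ℕ) : ForProgram :=
  decode k ;; ite (.natLE (read arrState (var 22)) (lit 0)) pivot skip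

/-- Fill the table. -/
def fillTable (k : ℕ) : ForProgram :=
  loop 20 numV (loop 21 (var arrT) (loop 22 numV (tryPivot k)))

/-- Multiply the table entries of the components of the whole graph. -/
def finish : ForProgram :=
  fill arrState (lit 0) ;; fill arrRem (lit 1) ;; setNat arrOk (lit 0) (lit 1) ;;
  setReal arrProd (lit 0) (.ofNat (lit 1)) ;; takeComps ;;
  setReal 2 (lit 0) (.read arrProd (lit 0))

@[simp] theorem freeComp_natWrites :
    freeComp.natWrites = [27, 9] ++ (growComp 22).natWrites := rfl

@[simp] theorem freeComp_realWrites : freeComp.realWrites = [] := rfl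

@[simp] theorem addState_natWrites : addState.natWrites =
    6 :: (freeComp.natWrites ++ ([27, 9, 9, 6] ++
      (edgeFactors.natWrites ++ (takeComps.natWrites ++ [])))) := rfl

@[simp] theorem addState_realWrites : addState.realWrites = [5, 5, 6, 5, 5, 4] := rfl

@[simp] theorem pivot_natWrites : pivot.natWrites =
    freeComp.natWrites ++ (findAddress.natWrites ++ ([13, 11, 23] ++
      (addState.natWrites ++ [10]))) := rfl

@[simp] theorem tryPivot_natWrites (k : ℕ) : (tryPivot k).natWrites =
    (decode k).natWrites ++ (pivot.natWrites ++ []) := rfl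

@[simp] theorem tryPivot_realWrites (k : ℕ) : (tryPivot k).realWrites =
    4 :: (addState.realWrites ++ [3]) := rfl

end ForProgram

end RealRAM

namespace DAG

variable {n m : ℕ} {G : DAG n m} {a : Fin m → ℕ} {x : ℝ} {M : ℕ} {s s' : State}

/-- The vertices without state. -/
def free (σ : Fin n → ℕ) : Finset (Fin n) := {u | σ u = 0}

theorem mem_free {σ : Fin n → ℕ} {u : Fin n} : u ∈ free σ ↔ σ u = 0 := by simp [free]

theorem run_freeComp {v : Fin n} {σ : Fin n → ℕ} (hs : G.InputMem a x M s)
    (hv : s.nat 22 0 = v) (hσ : ∀ u : Fin n, s.nat arrState u = σ u) (hσv : σ v = 0) :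
    Indicates (freeComp.run s) arrComp (G.comp (free σ) v) := by
  unfold freeComp
  simp only [run_seq]
  set s1 := (fill arrRem (.sub (.lit 1) (.read arrState (.var 27)))).run s with hs1
  have hf1 : (fill arrRem (.sub (.lit 1) (.read arrState (.var 27)))).Frame s s1 := frame_run _ _
  refine run_growComp (hs.of_frame hf1 (by simp) (by simp)) (fun u => ?_) (mem_free.2 hσv)
    (by rw [hf1.1 _ (by simp), hv]) (by decide) (by decide)
  rw [hs1, run_fill (by decide) hs.numV (fun j => 1 - s.nat 6 j)]
  · simp only [hσ u, mem_free]
    split_ifs with h <;> omega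
  · intro j t hj hA hi _
    simp only [NExp.eval, hi, hA 6 (by decide) (by decide)]

/-- When a vertex `v` without state receives a state, all vertices in the boundary of what remains
of its component have states. -/
theorem admissible_of_pivot {v : Fin n} {σ : Fin n → ℕ} {B t : ℕ} (hσB : ∀ u, σ u ≤ B)
    (ht : t < B) : G.Admissible B ((G.comp (free σ) v).erase v)
      (Function.update σ v (t + 1)) := by
  intro w hw
  obtain ⟨h1, y, hy, hyw⟩ := mem_boundary.1 hw
  by_cases hwv : w = v
  · subst hwv; simp; omega
  · have hwC : w ∉ G.comp (free σ) v := fun h => h1 (Finset.mem_erase.2 ⟨hwv, h⟩)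
    have h0 : σ w ≠ 0 := fun h =>
      hwC (mem_comp_of_nbr (Finset.mem_of_mem_erase hy) hyw (mem_free.2 h))
    have := hσB w
    simp only [Function.update_of_ne hwv]
    omega

/-- The edges that `edgeFactors` takes into account for a pivot are those at `v` whose ends lie
outside the remaining part of the component of `v`, because their ends are the ones that have
states. -/
theorem pivotWeight_eq {μ : Model m} {v : Fin n} {σ : Fin n → ℕ} {t : ℕ} (hσv : σ v = 0) :
    μ.pivotWeight G ((G.comp (free σ) v).erase v) v (Function.update σ v (t + 1)) =
      ∏ e with (G.src e = v ∨ G.tgt e = v) ∧ 1 ≤ Function.update σ v (t + 1) (G.src e) ∧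
        1 ≤ Function.update σ v (t + 1) (G.tgt e),
        μ.φ e (Function.update σ v (t + 1) (G.src e)) (Function.update σ v (t + 1) (G.tgt e)) := by
  classical
  have key : ∀ u, G.Nbr v u → u ≠ v → (u ∉ (G.comp (free σ) v).erase v ↔
      1 ≤ Function.update σ v (t + 1) u) := by
    intro u hvu huv
    rw [Function.update_of_ne huv, Finset.mem_erase, not_and, Nat.one_le_iff_ne_zero]
    constructor
    · intro h h0
      exact h huv (mem_comp_of_nbr self_mem_comp hvu (mem_free.2 h0))
    · intro h _ h'
      exact h (mem_free.1 (comp_subset (mem_free.2 hσv) h'))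
  have hv : v ∉ (G.comp (free σ) v).erase v ↔ 1 ≤ Function.update σ v (t + 1) v := by simp
  unfold Model.pivotWeight
  refine Finset.prod_congr ?_ fun _ _ => rfl
  ext e
  simp only [Finset.mem_filter, Finset.mem_univ, true_and]
  refine and_congr_right fun he => ?_
  rcases he with rfl | rfl
  · rw [key _ (G.nbr_src_tgt e) (G.src_ne_tgt e).symm, hv]
  · rw [key _ (G.nbr_tgt_src e) (G.src_ne_tgt e), hv]

/-- If no table entry is missing, the state `t + 1` contributes its term of `Model.part_insert`; if
all table entries that are needed are present, then none is found missing. -/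
theorem run_addState {v : Fin n} {σ : Fin n → ℕ} {t : ℕ} (hs : G.InputMem a x M s)
    (htab : G.TableSound a x M s) (hv : s.nat 22 0 = v) (ht : s.nat 23 0 = t)
    (htB : t < 2 * M + 1) (hσ : ∀ u : Fin n, u ≠ v → s.nat arrState u = σ u) (hσv : σ v = 0)
    (hσB : ∀ u, σ u ≤ 2 * M + 1) (hok : s.nat arrOk 0 ≤ 1) :
    (∀ u : Fin n, u ≠ v → (addState.run s).nat arrState u = σ u) ∧
    (addState.run s).nat arrOk 0 ≤ 1 ∧
    ((addState.run s).nat arrOk 0 ≠ 0 → s.nat arrOk 0 ≠ 0 ∧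
      (addState.run s).real arrSum 0 = s.real arrSum 0 + (pathModel a x M).w (t + 1) *
        (pathModel a x M).pivotWeight G ((G.comp (free σ) v).erase v) v
          (Function.update σ v (t + 1)) *
        (pathModel a x M).part G ((G.comp (free σ) v).erase v) (Function.update σ v (t + 1))) ∧
    (s.nat arrOk 0 ≠ 0 → (∀ u ∈ (G.comp (free σ) v).erase v,
      s.nat arrFlag (G.address (2 * M + 1) (G.comp ((G.comp (free σ) v).erase v) u)
        (Function.update σ v (t + 1))) ≠ 0) → (addState.run s).nat arrOk 0 ≠ 0) := by
  classical
  set R := (G.comp (free σ) v).erase v with hR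
  set τ := Function.update σ v (t + 1) with hτ
  unfold addState
  simp only [run_seq, run_setNat, run_setReal]
  set s1 := s.updateNat 6 (NExp.eval s (.var 22)) (NExp.eval s (.lit 0)) with hs1
  have hf1 : ∀ A, A ≠ 6 → s1.nat A = s.nat A := fun A h => State.updateNat_nat_of_ne _ _ _ h
  have hs1' : G.InputMem a x M s1 := hs.congr (fun A hA => hf1 A (by omega)) fun _ _ => rfl
  have hv1 : s1.nat 22 0 = v := by rw [hf1 _ (by decide), hv]
  have hσ1 : ∀ u : Fin n, s1.nat 6 u = σ u := by
    intro u
    by_cases huv : u = v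
    · subst huv; simp [hs1, NExp.eval, hv, hσv]
    · simp [hs1, NExp.eval, hv, Fin.val_inj, huv, hσ u huv]
  have hC := run_freeComp hs1' hv1 hσ1 hσv
  set s2 := freeComp.run s1 with hs2
  have hf2 : freeComp.Frame s1 s2 := frame_run _ _
  have hs2' := hs1'.of_frame hf2 (by simp) (by simp)
  have hrem : ∀ u : Fin n, ((fill arrRem (.read arrComp (.var 27))).run s2).nat 9 u =
      s2.nat 7 u := by
    intro u
    rw [run_fill (by decide) hs2'.numV (fun j => s2.nat 7 j)]
    intro j t hj hA hi _
    simp only [NExp.eval, hi, hA 7 (by decide) (by decide)]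
  set s3 := (fill arrRem (.read arrComp (.var 27))).run s2 with hs3
  have hf3 : (fill arrRem (.read arrComp (.var 27))).Frame s2 s3 := frame_run _ _
  have hs3' := hs2'.of_frame hf3 (by simp) (by simp)
  have hv3 : s3.nat 22 0 = v := by rw [hf3.1 _ (by simp), hf2.1 _ (by simp), hv1]
  set s4 := s3.updateNat 9 (NExp.eval s3 (.var 22)) (NExp.eval s3 (.lit 0)) with hs4
  have hf4 : ∀ A, A ≠ 9 → s4.nat A = s3.nat A := fun A h => State.updateNat_nat_of_ne _ _ _ h
  have hv4 : s4.nat 22 0 = v := by rw [hf4 _ (by decide), hv3]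
  have hR4 : Indicates s4 arrRem R := by
    intro u
    have h1 : s3.nat 9 u = if u ∈ G.comp (free σ) v then 1 else 0 := by rw [hrem u, hC u]
    by_cases huv : u = v
    · subst huv; simp [hs4, NExp.eval, hv3, hR]
    · simp [hs4, NExp.eval, hv3, hR, Fin.val_inj, huv, h1]
  set s5 := s4.updateNat 6 (NExp.eval s4 (.var 22)) (NExp.eval s4 (.add (.var 23) (.lit 1)))
    with hs5
  have hf5 : ∀ A, A ≠ 6 → s5.nat A = s4.nat A := fun A h => State.updateNat_nat_of_ne _ _ _ h
  have hs5' : G.InputMem a x M s5 := hs3'.congr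
    (fun A hA => by rw [hf5 A (by omega), hf4 A (by omega)]) fun _ _ => rfl
  have hfr : ∀ A, A ∉ [6, 27, 9, 7, 25, 26] → s5.nat A = s.nat A := by
    intro A hA
    simp only [List.mem_cons, List.not_mem_nil, or_false, not_or] at hA
    rw [hf5 A hA.1, hf4 A hA.2.2.1, hf3.1 A (by simp; tauto), hf2.1 A (by simp; tauto), hf1 A hA.1]
  have h23 : s4.nat 23 0 = t := by
    rw [hf4 _ (by decide), hf3.1 _ (by simp), hf2.1 _ (by simp), hf1 _ (by decide), ht]
  have hτ5 : ∀ u : Fin n, s5.nat 6 u = τ u := by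
    intro u
    by_cases huv : u = v
    · subst huv; simp [hs5, NExp.eval, hv4, h23, hτ]
    · have h6 : s4.nat 6 u = σ u := by
        rw [hf4 _ (by decide), hf3.1 _ (by simp), hf2.1 _ (by simp), hσ1]
      simp [hs5, NExp.eval, hv4, Fin.val_inj, huv, h6, hτ]
  have hreal : s5.real = s.real := by
    funext A
    change s3.real A = _
    rw [hf3.2 A (by simp), hf2.2 A (by simp)]
    rfl
  set I : ForProgram := .ite (.natLE (.var 23) (.var arrM)) (setReal arrProd (.lit 0)
    (.ofNat (.lit 1))) (setReal arrProd (.lit 0) (.sub (.ofNat (.lit 0)) (.ofNat (.lit 1)))) with hI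
  have hprod6 : (I.run s5).real 5 0 = (pathModel a x M).w (t + 1) := by
    have h23' : s5.nat 23 0 = t := by rw [hf5 _ (by decide), h23]
    simp only [hI, run, BExp.Holds, NExp.eval, h23', hs5'.valM, pathModel]
    by_cases htM : t ≤ M
    · simp [htM, RExp.eval, NExp.eval]
    · simp [htM, RExp.eval, NExp.eval]
  set s6 := I.run s5 with hs6
  have hf6 : I.Frame s5 s6 := frame_run _ _
  have hs6' := hs5'.of_frame hf6 (by simp [hI, natWrites]) (by simp [hI, realWrites])
  have hn6 : s6.nat = s5.nat := by funext A; exact hf6.1 A (by simp [hI, natWrites])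
  have h7 := run_edgeFactors (v := v) (σ := τ) hs6'
    (by rw [hn6, hf5 _ (by decide), hv4]) (by rw [hn6]; exact hτ5)
  rw [← pivotWeight_eq hσv, hprod6] at h7
  set s7 := edgeFactors.run s6 with hs7
  have hf7 : edgeFactors.Frame s6 s7 := frame_run _ _
  have hs7' := hs6'.of_frame hf7 (by simp) (by simp)
  have hfl7 : s7.nat 10 = s.nat 10 := by rw [hf7.1 _ (by simp), hn6, hfr _ (by simp)]
  have hok7 : s7.nat 11 = s.nat 11 := by rw [hf7.1 _ (by simp), hn6, hfr _ (by simp)]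
  have htab7 : G.TableSound a x M s7 := by
    refine htab.congr hfl7 ?_
    rw [hf7.2 _ (by simp), hf6.2 _ (by simp [hI, realWrites]), hreal]
  have hadm : G.Admissible (2 * M + 1) R τ := admissible_of_pivot hσB htB
  obtain ⟨k3, k1, k2⟩ := run_takeComps hs7' htab7
    (hR4.congr (by rw [hf7.1 _ (by simp), hn6, hf5 _ (by decide)]))
    (fun u => by rw [hf7.1 _ (by simp), hn6, hτ5]) hadm (by rw [hok7]; exact hok)
  have hf8 : takeComps.Frame s7 (takeComps.run s7) := frame_run _ _
  refine ⟨fun u huv => ?_, k3, fun h => ?_, fun h h' => ?_⟩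
  · rw [State.updateReal_nat, hf8.1 _ (by simp), hf7.1 _ (by simp), hn6, hτ5, hτ,
      Function.update_of_ne huv]
  · obtain ⟨g1, g2⟩ := k1 h
    refine ⟨by rwa [hok7] at g1, ?_⟩
    simp only [State.updateReal_real, RExp.eval, NExp.eval, and_self, if_true]
    rw [g2, h7, hf8.2 _ (by simp), hf7.2 _ (by simp), hf6.2 _ (by simp [hI, realWrites]), hreal]
  · exact k2 (by rwa [hok7]) (by rw [hfl7]; exact h')

/-- The table stays correct and does not lose entries, and it has an entry for the component of `v`
if the entries needed for its computation were present. -/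
theorem run_pivot {v : Fin n} {σ : Fin n → ℕ} (hs : G.InputMem a x M s)
    (htab : G.TableSound a x M s) (hv : s.nat 22 0 = v)
    (hσ : ∀ u : Fin n, s.nat arrState u = σ u) (hσv : σ v = 0) (hσB : ∀ u, σ u ≤ 2 * M + 1) :
    G.TableSound a x M (pivot.run s) ∧
    (∀ i, s.nat arrFlag i ≠ 0 → (pivot.run s).nat arrFlag i ≠ 0) ∧
    ((∀ t < 2 * M + 1, ∀ u ∈ (G.comp (free σ) v).erase v,
      s.nat arrFlag (G.address (2 * M + 1) (G.comp ((G.comp (free σ) v).erase v) u)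
        (Function.update σ v (t + 1))) ≠ 0) →
      (pivot.run s).nat arrFlag (G.address (2 * M + 1) (G.comp (free σ) v) σ) ≠ 0) := by
  classical
  set C := G.comp (free σ) v with hCdef
  unfold pivot
  simp only [run_seq, run_setNat, run_setReal]
  have hC := run_freeComp hs hv hσ hσv
  set s1 := freeComp.run s with hs1
  have hf1 : freeComp.Frame s s1 := frame_run _ _
  have hs1' := hs.of_frame hf1 (by simp) (by simp)
  have haddr : (findAddress.run s1).nat arrAddr 0 = G.address (2 * M + 1) C σ :=
    run_findAddress hs1' hC fun u => by rw [hf1.1 _ (by simp), hσ]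
  set s2 := findAddress.run s1 with hs2
  have hf2 : findAddress.Frame s1 s2 := frame_run _ _
  have hs2' := hs1'.of_frame hf2 (by simp) (by simp)
  set s3 := ((s2.updateNat 13 (NExp.eval s2 (.lit 0)) (NExp.eval s2 (.var arrAddr))).updateNat 11
    (NExp.eval (s2.updateNat 13 (NExp.eval s2 (.lit 0)) (NExp.eval s2 (.var arrAddr))) (.lit 0))
    (NExp.eval (s2.updateNat 13 (NExp.eval s2 (.lit 0)) (NExp.eval s2 (.var arrAddr)))
      (.lit 1))) with hs3
  have hf3 : ∀ A, A ≠ 13 → A ≠ 11 → s3.nat A = s2.nat A := by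
    intro A h h'
    rw [hs3, State.updateNat_nat_of_ne _ _ _ h', State.updateNat_nat_of_ne _ _ _ h]
  set s4 := s3.updateReal 4 (NExp.eval s3 (.lit 0)) (RExp.eval s3 (.ofNat (.lit 0))) with hs4
  have hr4 : ∀ A, A ≠ 4 → s4.real A = s.real A := by
    intro A h
    rw [hs4, State.updateReal_real_of_ne _ _ _ h]
    change s2.real A = _
    rw [hf2.2 _ (by simp), hf1.2 _ (by simp)]
  have hn4 : ∀ A, A ∉ [13, 11, 27, 8, 28, 12, 29, 14, 30, 9, 7, 25, 26] → s4.nat A = s.nat A := by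
    intro A hA
    simp only [List.mem_cons, List.not_mem_nil, or_false, not_or] at hA
    change s3.nat A = _
    rw [hf3 A hA.1 hA.2.1, hf2.1 A (by simp; tauto), hf1.1 A (by simp; tauto)]
  have hs4' : G.InputMem a x M s4 := by
    refine hs.congr (fun A hA => hn4 A ?_) fun A hA => hr4 A (by omega)
    simp only [List.mem_cons, List.not_mem_nil, or_false, not_or]
    omega
  have htab4 : G.TableSound a x M s4 := htab.congr (hn4 _ (by simp)) (hr4 _ (by decide))
  have h11 : s4.nat 11 0 = 1 := by simp [hs4, hs3, NExp.eval]
  have h13 : s4.nat 13 0 = G.address (2 * M + 1) C σ := by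
    simp [hs4, hs3, NExp.eval, haddr]
  have hsum4 : s4.real 4 0 = 0 := by simp [hs4, RExp.eval, NExp.eval]
  -- the summation over the states of the pivot
  have key := run_loop_induct (i := 23) (b := .var arrB) (P := addState) (s := s4)
    (N := 2 * M + 1) (by simpa [NExp.eval] using hs4'.valB)
    (fun j s' => (∀ u : Fin n, u ≠ v → s'.nat arrState u = σ u) ∧ s'.nat arrOk 0 ≤ 1 ∧
      (s'.nat arrOk 0 ≠ 0 → s'.real arrSum 0 = ∑ t ∈ Finset.range j, (pathModel a x M).w (t + 1) *
        (pathModel a x M).pivotWeight G (C.erase v) v (Function.update σ v (t + 1)) *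
        (pathModel a x M).part G (C.erase v) (Function.update σ v (t + 1))) ∧
      ((∀ t < 2 * M + 1, ∀ u ∈ C.erase v,
        s.nat arrFlag (G.address (2 * M + 1) (G.comp (C.erase v) u)
          (Function.update σ v (t + 1))) ≠ 0) → s'.nat arrOk 0 ≠ 0))
    (by
      refine ⟨fun u _ => ?_, ?_, fun _ => ?_, fun _ => ?_⟩
      · rw [State.updateNat_nat_of_ne _ _ _ (by decide), hn4 _ (by simp), hσ]
      · simp [h11]
      · simpa using hsum4
      · simp [h11]) (by
      rintro j s' hj hi hf ⟨h1, h2, h3, h4⟩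
      have hs' := hs4'.of_frame hf (by simp [natWrites]) (by simp [realWrites])
      have hfl : s'.nat 10 = s.nat 10 := by
        rw [hf.1 _ (by simp [natWrites]), hn4 _ (by simp)]
      have htab' := htab4.congr (s' := s') (hf.1 _ (by simp [natWrites]))
        (hf.2 _ (by simp [realWrites]))
      have hv' : s'.nat 22 0 = v := by
        rw [hf.1 _ (by simp [natWrites]), hn4 _ (by simp), hv]
      obtain ⟨g1, g2, g3, g4⟩ := run_addState hs' htab' hv' hi hj h1 hσv hσB h2
      simp only [State.updateNat_nat_of_ne (addState.run s') (A := 23) (A' := 6) _ _ (by decide),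
        State.updateNat_nat_of_ne (addState.run s') (A := 23) (A' := 11) _ _ (by decide),
        State.updateNat_real]
      refine ⟨g1, g2, fun h => ?_, fun h => ?_⟩
      · obtain ⟨e1, e2⟩ := g3 h
        rw [e2, h3 e1, Finset.sum_range_succ]
      · refine g4 (h4 h) ?_
        rw [hfl]
        exact h j hj)
  set s5 := (loop 23 (.var arrB) addState).run s4 with hs5
  have hf5 : (loop 23 (.var arrB) addState).Frame s4 s5 := frame_run _ _
  obtain ⟨-, k2, k3, k4⟩ := key
  have hfl5 : s5.nat 10 = s.nat 10 := by rw [hf5.1 _ (by simp [natWrites]), hn4 _ (by simp)]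
  have hval5 : s5.real 3 = s.real 3 := by
    rw [hf5.2 _ (by simp [realWrites]), hr4 _ (by decide)]
  have h13' : s5.nat 13 0 = G.address (2 * M + 1) C σ := by
    rw [hf5.1 _ (by simp [natWrites]), h13]
  have hadm : G.Admissible (2 * M + 1) C σ := fun w hw => by
    have h0 : σ w ≠ 0 := fun h => boundary_comp_disjoint hw (mem_free.2 h)
    have := hσB w
    omega
  have htot : ∑ t ∈ Finset.range (2 * M + 1), (pathModel a x M).w (t + 1) *
        (pathModel a x M).pivotWeight G (C.erase v) v (Function.update σ v (t + 1)) *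
        (pathModel a x M).part G (C.erase v) (Function.update σ v (t + 1)) =
      (pathModel a x M).part G C σ := by
    have h1 := (pathModel a x M).part_insert G (R := C.erase v) (v := v) (by simp) σ
    rw [Finset.insert_erase self_mem_comp] at h1
    rw [h1, Finset.range_eq_Ico, Finset.sum_Ico_add' (fun t => (pathModel a x M).w t *
        (pathModel a x M).pivotWeight G (C.erase v) v (Function.update σ v t) *
        (pathModel a x M).part G (C.erase v) (Function.update σ v t)) 0 (2 * M + 1) 1]
    rfl
  by_cases hok : s5.nat 11 0 = 0
  · rw [run_ite_neg _ _ (by simp [BExp.Holds, NExp.eval, hok])]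
    refine ⟨htab.congr hfl5 hval5, fun i hi => by simpa [run, hfl5] using hi, fun h => ?_⟩
    exact absurd hok (k4 h)
  · rw [run_ite_pos _ _ (by simp [BExp.Holds, NExp.eval]; omega), run_seq, run_setNat, run_setReal]
    have hfin : ∀ i, ((s5.updateReal 3 (NExp.eval s5 (.var arrTarget))
        (RExp.eval s5 (.read arrSum (.lit 0)))).updateNat 10
        (NExp.eval (s5.updateReal 3 (NExp.eval s5 (.var arrTarget))
          (RExp.eval s5 (.read arrSum (.lit 0)))) (.var arrTarget))
        (NExp.eval (s5.updateReal 3 (NExp.eval s5 (.var arrTarget))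
          (RExp.eval s5 (.read arrSum (.lit 0)))) (.lit 1))).nat 10 i =
        if i = G.address (2 * M + 1) C σ then 1 else s.nat 10 i := by
      intro i
      simp [NExp.eval, h13', hfl5]
    refine ⟨fun D τ hτ hne => ?_, fun i hi => ?_, fun _ => ?_⟩
    · rw [hfin] at hne
      simp only [State.updateNat_real, State.updateReal_real, NExp.eval, RExp.eval, h13', hval5,
        true_and]
      split_ifs with hD
      · obtain ⟨rfl, h2⟩ := address_inj hτ hadm hD
        rw [k3 hok, htot]
        exact (Model.part_congr _ _ h2).symm
      · rw [if_neg hD] at hne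
        exact htab D τ hτ hne
    · rw [hfin]
      split_ifs
      · exact one_ne_zero
      · exact hi
    · rw [hfin, if_pos rfl]
      exact one_ne_zero

end DAG

/-! ### Filling the table -/

namespace DAG

variable {n m : ℕ} {G : DAG n m} {a : Fin m → ℕ} {x : ℝ} {M k : ℕ} {s s' : State}

/-- Connected sets with at most `k` boundary vertices that can be taken apart by `r` rounds of
removing a vertex from every component, all components that arise being of the same kind. -/
def Solvable (G : DAG n m) (k : ℕ) : ℕ → Finset (Fin n) → Prop
  | 0, _ => False
  | r + 1, C => (∀ v ∈ C, G.comp C v = C) ∧ (G.boundary C).card ≤ k ∧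
      ∃ v ∈ C, ∀ u ∈ C.erase v, Solvable G k r (G.comp (C.erase v) u)

/-- The table has entries for all sets that are solvable in `r` rounds. -/
def TableComplete (G : DAG n m) (M k r : ℕ) (s : State) : Prop :=
  ∀ C, G.Solvable k r C → ∀ σ, G.Admissible (2 * M + 1) C σ →
    s.nat arrFlag (G.address (2 * M + 1) C σ) ≠ 0

/-- Every table entry that is present in `s` is present in `s'`. -/
def FlagsLE (s s' : State) : Prop := ∀ i, s.nat arrFlag i ≠ 0 → s'.nat arrFlag i ≠ 0

theorem FlagsLE.trans {s'' : State} (h : FlagsLE s s') (h' : FlagsLE s' s'') : FlagsLE s s'' :=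
  fun i hi => h' i (h i hi)

theorem TableComplete.mono {r : ℕ} (h : G.TableComplete M k r s) (hs : FlagsLE s s') :
    G.TableComplete M k r s' := fun C hC σ hσ => hs _ (h C hC σ hσ)

/-- If removing `v` from its component, in the graph without the vertices that have a state in the
assignment with code `c`, leaves sets that are solvable in `r` rounds, then there is a table entry
for this component. -/
def PivotDone (G : DAG n m) (M k r c : ℕ) (v : Fin n) (s : State) : Prop :=
  decodeState n (2 * M + 1) k c v = 0 →
  (∀ u ∈ (G.comp (free (decodeState n (2 * M + 1) k c)) v).erase v, G.Solvable k r
    (G.comp ((G.comp (free (decodeState n (2 * M + 1) k c)) v).erase v) u)) →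
  s.nat arrFlag (G.address (2 * M + 1) (G.comp (free (decodeState n (2 * M + 1) k c)) v)
    (decodeState n (2 * M + 1) k c)) ≠ 0

theorem PivotDone.mono {r c : ℕ} {v : Fin n} (h : G.PivotDone M k r c v s) (hs : FlagsLE s s') :
    G.PivotDone M k r c v s' := fun h1 h2 => hs _ (h h1 h2)

theorem run_tryPivot {v : Fin n} {c : ℕ} (hs : G.InputMem a x M s) (htab : G.TableSound a x M s)
    (hv : s.nat 22 0 = v) (hc : s.nat 21 0 = c) (hT : c ≤ s.nat arrT 0) :
    G.TableSound a x M ((tryPivot k).run s) ∧ FlagsLE s ((tryPivot k).run s) ∧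
    ∀ r, G.TableComplete M k r s → G.PivotDone M k r c v ((tryPivot k).run s) := by
  classical
  unfold tryPivot
  rw [run_seq]
  have hσ := run_decode (k := k) hs hc hT
  set s1 := (decode k).run s with hs1
  have hf1 : (decode k).Frame s s1 := frame_run _ _
  have hs1' := hs.of_frame hf1 (by simp) (by simp)
  have hfl : s1.nat 10 = s.nat 10 := hf1.1 _ (by simp)
  have htab1 : G.TableSound a x M s1 := htab.congr hfl (hf1.2 _ (by simp))
  have hv1 : s1.nat 22 0 = v := by rw [hf1.1 _ (by simp), hv]
  have hle : FlagsLE s s1 := fun i hi => by rwa [hfl]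
  by_cases h0 : decodeState n (2 * M + 1) k c v = 0
  · rw [run_ite_pos _ _ (by simp [BExp.Holds, NExp.eval, hv1, hσ, h0])]
    have hB : ∀ u : Fin n, decodeState n (2 * M + 1) k c u ≤ 2 * M + 1 := fun u =>
      decodeFrom_le (by omega) (Nat.zero_le _)
    obtain ⟨g1, g2, g3⟩ := run_pivot hs1' htab1 hv1 hσ h0 hB
    refine ⟨g1, hle.trans g2, fun r hr _ h => g3 fun t ht u hu => ?_⟩
    refine hr.mono hle _ (h u hu) _ fun w hw => ?_
    exact admissible_of_pivot hB ht w (boundary_comp_subset hu hw)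
  · rw [run_ite_neg _ _ (by simp [BExp.Holds, NExp.eval, hv1, hσ, h0])]
    exact ⟨htab1, hle, fun r _ h => absurd h h0⟩

theorem run_pivots {c : ℕ} (hs : G.InputMem a x M s) (htab : G.TableSound a x M s)
    (hc : s.nat 21 0 = c) (hT : c ≤ s.nat arrT 0) :
    G.TableSound a x M ((loop 22 .numV (tryPivot k)).run s) ∧
    FlagsLE s ((loop 22 .numV (tryPivot k)).run s) ∧
    ∀ r, G.TableComplete M k r s →
      ∀ v, G.PivotDone M k r c v ((loop 22 .numV (tryPivot k)).run s) := by
  have key := run_loop_induct (i := 22) (b := .numV) (P := tryPivot k) (s := s) (N := n)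
    (by simpa [NExp.eval] using hs.numV)
    (fun j s' => G.TableSound a x M s' ∧ FlagsLE s s' ∧
      ∀ r, G.TableComplete M k r s → ∀ v : Fin n, (v : ℕ) < j → G.PivotDone M k r c v s')
    ⟨htab.congr (State.updateNat_nat_of_ne _ _ _ (by decide)) rfl, fun i hi => by simpa using hi,
      by simp⟩ (by
      rintro j s' hj hi hf ⟨h1, h2, h3⟩
      have hs' := hs.of_frame hf (by simp [natWrites]) (by simp [realWrites])
      obtain ⟨g1, g2, g3⟩ := run_tryPivot (k := k) (v := ⟨j, hj⟩) hs' h1 hi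
        (by rw [hf.1 _ (by simp [natWrites]), hc]) (by rwa [hf.1 _ (by simp [natWrites])])
      have hle : FlagsLE ((tryPivot k).run s')
          (((tryPivot k).run s').updateNat 22 0 (j + 1)) := fun i hi => by simpa using hi
      refine ⟨g1.congr (State.updateNat_nat_of_ne _ _ _ (by decide)) rfl,
        (h2.trans g2).trans hle, fun r hr v hvj => ?_⟩
      rcases Nat.lt_succ_iff_lt_or_eq.1 hvj with h | h
      · exact (h3 r hr v h).mono (g2.trans hle)
      · obtain rfl : v = ⟨j, hj⟩ := Fin.ext h
        exact (g3 r (hr.mono h2)).mono hle)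
  exact ⟨key.1, key.2.1, fun r hr v => key.2.2 r hr v v.2⟩

theorem run_codes (hs : G.InputMem a x M s) (htab : G.TableSound a x M s) :
    G.TableSound a x M ((loop 21 (.var arrT) (loop 22 .numV (tryPivot k))).run s) ∧
    FlagsLE s ((loop 21 (.var arrT) (loop 22 .numV (tryPivot k))).run s) ∧
    ∀ r, G.TableComplete M k r s → ∀ c < s.nat arrT 0,
      ∀ v, G.PivotDone M k r c v
        ((loop 21 (.var arrT) (loop 22 .numV (tryPivot k))).run s) := by
  refine run_loop_induct (i := 21) (b := .var arrT) (P := loop 22 .numV (tryPivot k)) (s := s)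
    (N := s.nat arrT 0) rfl
    (fun j s' => G.TableSound a x M s' ∧ FlagsLE s s' ∧
      ∀ r, G.TableComplete M k r s → ∀ c < j, ∀ v : Fin n, G.PivotDone M k r c v s')
    ⟨htab.congr (State.updateNat_nat_of_ne _ _ _ (by decide)) rfl, fun i hi => by simpa using hi,
      by simp⟩ ?_
  rintro j s' hj hi hf ⟨h1, h2, h3⟩
  have hs' := hs.of_frame hf (by simp [natWrites]) (by simp [realWrites])
  obtain ⟨g1, g2, g3⟩ := run_pivots (k := k) hs' h1 hi
    (by rw [hf.1 _ (by simp [natWrites])]; exact hj.le)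
  have hle : FlagsLE ((loop 22 .numV (tryPivot k)).run s')
      (((loop 22 .numV (tryPivot k)).run s').updateNat 21 0 (j + 1)) :=
    fun i hi => by simpa using hi
  refine ⟨g1.congr (State.updateNat_nat_of_ne _ _ _ (by decide)) rfl,
    (h2.trans g2).trans hle, fun r hr c hcj v => ?_⟩
  rcases Nat.lt_succ_iff_lt_or_eq.1 hcj with h | rfl
  · exact (h3 r hr c h v).mono (g2.trans hle)
  · exact (g3 r (hr.mono h2) v).mono hle

/-- Each round through all codes and all pivots adds the sets that are solvable in one more
round. -/
theorem TableComplete.succ {r T : ℕ} (hT : ((n + 1) * (2 * M + 1)) ^ k ≤ T)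
    (h : ∀ c < T, ∀ v, G.PivotDone M k r c v s) : G.TableComplete M k (r + 1) s := by
  rintro C ⟨hconn, hcard, v, hv, hsub⟩ σ hσ
  obtain ⟨c, hc, hcσ⟩ := exists_decodeFrom_eq (B := 2 * M + 1) (by omega) σ hcard hσ (fun _ => 0)
  have hdec : ∀ u, decodeState n (2 * M + 1) k c u = if u ∈ G.boundary C then σ u else 0 := hcσ
  have hfree : ∀ u, u ∈ free (decodeState n (2 * M + 1) k c) ↔ u ∉ G.boundary C := by
    intro u
    rw [mem_free, hdec]
    split_ifs with hu
    · have := (hσ u hu).1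
      simp [hu]; omega
    · simp [hu]
  have hCfree : C ⊆ free (decodeState n (2 * M + 1) k c) := fun u hu =>
    (hfree u).2 fun h => (mem_boundary.1 h).1 hu
  have hcomp : G.comp (free (decodeState n (2 * M + 1) k c)) v = C := by
    rw [← comp_eq_of_closed hCfree _ hv, hconn v hv]
    intro b hb w hw hbw
    by_contra hwC
    exact (hfree w).1 hw (mem_boundary.2 ⟨hwC, b, hb, hbw⟩)
  have h1 := h c (hc.trans_le hT) v (mem_free.1 (hCfree hv))
  rw [hcomp] at h1
  rw [← address_congr (σ := decodeState n (2 * M + 1) k c)]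
  · exact h1 hsub
  · intro u hu
    rw [hdec, if_pos hu]

/-- After `n` rounds the table has an entry for every solvable set. -/
theorem run_fillTable (hs : G.InputMem a x M s) (htab : G.TableSound a x M s)
    (hT : ((n + 1) * (2 * M + 1)) ^ k ≤ s.nat arrT 0) :
    G.TableSound a x M ((fillTable k).run s) ∧ G.TableComplete M k n ((fillTable k).run s) := by
  refine run_loop_induct (i := 20) (b := .numV)
    (P := loop 21 (.var arrT) (loop 22 .numV (tryPivot k))) (s := s)
    (N := n)
      (by simpa [NExp.eval] using hs.numV)
    (fun j s' => G.TableSound a x M s' ∧ G.TableComplete M k j s')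
    ⟨htab.congr (State.updateNat_nat_of_ne _ _ _ (by decide)) rfl, fun _ h => h.elim⟩ ?_
  rintro j s' hj hi hf ⟨h1, h2⟩
  have hs' := hs.of_frame hf (by simp [natWrites]) (by simp [realWrites])
  obtain ⟨g1, -, g3⟩ := run_codes (k := k) hs' h1
  refine ⟨g1.congr (State.updateNat_nat_of_ne _ _ _ (by decide)) rfl, ?_⟩
  refine TableComplete.succ hT fun c hc v => ?_
  refine (g3 j h2 c ?_ v).mono fun i hi => by simpa using hi
  rwa [hf.1 _ (by simp [natWrites])]

/-- After the table has been filled, the output is the partition function of the whole graph. -/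
theorem run_finish (hs : G.InputMem a x M s) (htab : G.TableSound a x M s)
    (hcomp : G.TableComplete M k n s)
    (hsol : ∀ u, G.Solvable k n (G.comp Finset.univ u)) :
    (finish.run s).real 2 0 = (pathModel a x M).part G Finset.univ (fun _ => 0) := by
  unfold finish
  simp only [run_seq, run_setNat, run_setReal]
  have h1 : ∀ u : Fin n, ((fill arrState (.lit 0)).run s).nat 6 u = 0 :=
    run_fill (by decide) hs.numV (fun _ => 0) fun _ _ _ _ _ _ => rfl
  set s1 := (fill arrState (.lit 0)).run s with hs1
  have hf1 : (fill arrState (.lit 0)).Frame s s1 := frame_run _ _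
  have hs1' := hs.of_frame hf1 (by simp) (by simp)
  have h2 : ∀ u : Fin n, ((fill arrRem (.lit 1)).run s1).nat 9 u = 1 :=
    run_fill (by decide) hs1'.numV (fun _ => 1) fun _ _ _ _ _ _ => rfl
  set s2 := (fill arrRem (.lit 1)).run s1 with hs2
  have hf2 : (fill arrRem (.lit 1)).Frame s1 s2 := frame_run _ _
  have hs2' := hs1'.of_frame hf2 (by simp) (by simp)
  set s3 := s2.updateNat 11 (NExp.eval s2 (.lit 0)) (NExp.eval s2 (.lit 1)) with hs3
  have hf3 : ∀ A, A ≠ 11 → s3.nat A = s2.nat A := fun A h => State.updateNat_nat_of_ne _ _ _ h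
  set s4 := s3.updateReal 5 (NExp.eval s3 (.lit 0)) (RExp.eval s3 (.ofNat (.lit 1))) with hs4
  have hr4 : ∀ A, A ≠ 5 → s4.real A = s.real A := by
    intro A h
    rw [hs4, State.updateReal_real_of_ne _ _ _ h]
    change s2.real A = _
    rw [hf2.2 _ (by simp), hf1.2 _ (by simp)]
  have hn4 : ∀ A, A ≠ 11 → s4.nat A = s2.nat A := fun A h => hf3 A h
  have hs4' : G.InputMem a x M s4 := by
    refine hs2'.congr (fun A hA => hn4 A (by omega)) fun A hA => ?_
    rw [hr4 A (by omega), hf2.2 _ (by simp), hf1.2 _ (by simp)]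
  have hfl : s4.nat 10 = s.nat 10 := by
    rw [hn4 _ (by decide), hf2.1 _ (by simp), hf1.1 _ (by simp)]
  have hbd : ∀ w, w ∉ G.boundary Finset.univ := fun w hw => (mem_boundary.1 hw).1 (by simp)
  obtain ⟨-, k1, k2⟩ := run_takeComps (R := Finset.univ) (σ := fun _ => 0) hs4'
    (htab.congr hfl (hr4 _ (by decide)))
    (fun u => by rw [hn4 _ (by decide), h2 u]; simp)
    (fun u => by rw [hn4 _ (by decide), hf2.1 _ (by simp), h1 u])
    (fun w hw => absurd hw (hbd w)) (by simp [hs4, hs3, NExp.eval])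
  have h5 : s4.real 5 0 = 1 := by simp [hs4, NExp.eval, RExp.eval]
  obtain ⟨-, k3⟩ := k1 (k2 (by simp [hs4, hs3, NExp.eval]) fun u _ => by
    rw [hfl]
    exact hcomp _ (hsol u) _ fun w hw => absurd (boundary_comp_subset (by simp) hw) (hbd w))
  simp only [State.updateReal_real, NExp.eval, RExp.eval, and_self, if_true]
  rw [k3, h5, one_mul]

end DAG

/-! ### Graphs of bounded treewidth -/

namespace DAG

variable {n m : ℕ} {G : DAG n m} {k : ℕ}

theorem comp_comp_of_mem {R : Finset (Fin n)} {u v : Fin n} (hu : u ∈ R) (hv : v ∈ G.comp R u) :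
    G.comp (G.comp R u) v = G.comp R u := by
  rw [comp_eq_of_closed (comp_subset hu) (fun _ ha _ hb hab => mem_comp_of_nbr ha hab hb) hv]
  exact comp_eq_of_mem hu hv

/-- The nodes of a tree decomposition whose bags meet a connected set are connected. -/
theorem exists_walk_of_mem_comp (D : TreeDecomposition G.underlying) {C : Finset (Fin n)}
    {v w : Fin n} (hv : v ∈ C) (hw : w ∈ G.comp C v) {q q' : Fin D.size} (hq : v ∈ D.bag q)
    (hq' : w ∈ D.bag q') :
    ∃ r : D.tree.Walk q q', ∀ i ∈ r.support, ∃ c ∈ C, c ∈ D.bag i := by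
  have key : ∀ c ∈ C, ∀ i j, c ∈ D.bag i → c ∈ D.bag j →
      ∃ r : D.tree.Walk i j, ∀ l ∈ r.support, ∃ c ∈ C, c ∈ D.bag l := by
    intro c hc i j hi hj
    obtain ⟨r, hr⟩ := (D.isTree.connected i j).exists_isPath
    exact ⟨r, fun l hl => ⟨c, hc, D.inter i l j r hr hl (Finset.mem_inter.2 ⟨hi, hj⟩)⟩⟩
  induction mem_comp.1 hw generalizing q' with
  | refl => exact key v hv q q' hq hq'
  | @tail b c h1 h2 ih =>
    obtain ⟨q₁, hb, hc⟩ := D.edge b c (G.underlying_adj_iff.2 h2.1)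
    obtain ⟨r, hr⟩ := ih (mem_comp.2 h1) hb
    obtain ⟨r', hr'⟩ := key c h2.2 q₁ q' hc hq'
    refine ⟨r.append r', fun i hi => ?_⟩
    rcases (SimpleGraph.Walk.mem_support_append_iff _ _).1 hi with hi | hi
    · exact hr i hi
    · exact hr' i hi

/-- If the boundary of a connected set is contained in a bag, then it is contained in a bag that
meets the set: walk in the tree towards a bag that meets the set. -/
theorem exists_bag_of_boundary_subset (D : TreeDecomposition G.underlying) {C : Finset (Fin n)}
    (hconn : ∀ v ∈ C, G.comp C v = C) {v : Fin n} (hv : v ∈ C) {q : Fin D.size}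
    (hq : v ∈ D.bag q) {t : Fin D.size} (p : D.tree.Walk t q) (hp : p.IsPath)
    (ht : G.boundary C ⊆ D.bag t) : ∃ t', G.boundary C ⊆ D.bag t' ∧ ∃ w ∈ C, w ∈ D.bag t' := by
  induction p with
  | nil => exact ⟨_, ht, v, hv, hq⟩
  | @cons t t₁ q h p ih =>
    by_cases hC : ∃ w ∈ C, w ∈ D.bag t
    · exact ⟨t, ht, hC⟩
    rw [SimpleGraph.Walk.cons_isPath_iff] at hp
    refine ih hq hp.1 fun u hu => ?_
    obtain ⟨-, w, hw, hwu⟩ := mem_boundary.1 hu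
    obtain ⟨q', hwq, huq⟩ := D.edge w u (G.underlying_adj_iff.2 hwu)
    obtain ⟨r, hr⟩ := exists_walk_of_mem_comp D hv (by rwa [hconn v hv]) hq hwq
    classical
    have havoid : t ∉ (p.append r).bypass.support := by
      intro hmem
      rcases (SimpleGraph.Walk.mem_support_append_iff _ _).1
        (SimpleGraph.Walk.support_bypass_subset_support _ hmem) with hmem | hmem
      · exact hp.2 hmem
      · exact hC (hr t hmem)
    refine D.inter t t₁ q' (.cons h (p.append r).bypass) ?_ ?_ (Finset.mem_inter.2 ⟨ht hu, huq⟩)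
    · exact (SimpleGraph.Walk.cons_isPath_iff _ _).2 ⟨SimpleGraph.Walk.bypass_isPath _, havoid⟩
    · simp

/-- If the boundary of a connected set `C` lies in a bag, it lies in a bag that contains a vertex
`v` of `C`. Then the boundary of `C` has at most `k` vertices, and the boundary of every component
of `C \ {v}` lies in this bag. -/
theorem solvable_of_boundary_subset (D : TreeDecomposition G.underlying)
    (hD : ∀ i, (D.bag i).card ≤ k + 1) : ∀ (r : ℕ) {C : Finset (Fin n)} {t : Fin D.size},
    C.Nonempty → (∀ v ∈ C, G.comp C v = C) → G.boundary C ⊆ D.bag t → C.card ≤ r →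
    G.Solvable k r C
  | 0, C, _, hne, _, _, hcard => absurd hne.card_pos (by omega)
  | r + 1, C, t, ⟨c, hc⟩, hconn, ht, hcard => by
    obtain ⟨q, hq⟩ := D.cover c
    obtain ⟨p, hp⟩ := (D.isTree.connected t q).exists_isPath
    obtain ⟨t', ht', v, hv, hvt⟩ := exists_bag_of_boundary_subset D hconn hc hq p hp ht
    have hvb : v ∉ G.boundary C := fun h => (mem_boundary.1 h).1 hv
    refine ⟨hconn, ?_, v, hv, fun u hu => ?_⟩
    · have h1 := Finset.card_le_card (Finset.insert_subset hvt ht')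
      rw [Finset.card_insert_of_notMem hvb] at h1
      have := hD t'
      omega
    · refine solvable_of_boundary_subset D hD r (t := t') ⟨u, self_mem_comp⟩
        (fun w hw => comp_comp_of_mem hu hw) ?_ ?_
      · intro w hw
        obtain ⟨h1, y, hy, hyw⟩ := mem_boundary.1 (boundary_comp_subset hu hw)
        by_cases hwv : w = v
        · rwa [hwv]
        · exact ht' (mem_boundary.2 ⟨fun h => h1 (Finset.mem_erase.2 ⟨hwv, h⟩), y,
            Finset.mem_of_mem_erase hy, hyw⟩)
      · have h1 := Finset.card_le_card (comp_subset (G := G) hu)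
        rw [Finset.card_erase_of_mem hv] at h1
        omega

theorem exists_treeDecomposition (h : treewidth G.underlying ≤ k) :
    ∃ D : TreeDecomposition G.underlying, ∀ i, (D.bag i).card ≤ k + 1 := by
  obtain ⟨D, hD⟩ := exists_width_eq_treewidth G.underlying
  refine ⟨D, fun i => ?_⟩
  have h1 : (D.bag i).card ≤ Finset.univ.sup fun i => (D.bag i).card :=
    Finset.le_sup (f := fun i => (D.bag i).card) (Finset.mem_univ i)
  have h2 : (Finset.univ.sup fun i => (D.bag i).card) - 1 ≤ k := hD.trans_le h
  omega

/-- The components of a graph of treewidth at most `k` are solvable. -/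
theorem solvable_of_treewidth_le (h : treewidth G.underlying ≤ k) (u : Fin n) :
    G.Solvable k n (G.comp Finset.univ u) := by
  obtain ⟨D, hD⟩ := exists_treeDecomposition h
  obtain ⟨t, -⟩ := D.cover u
  refine solvable_of_boundary_subset D hD n (t := t) ⟨u, self_mem_comp⟩
    (fun w hw => comp_comp_of_mem (Finset.mem_univ u) hw) ?_ ?_
  · intro w hw
    exact absurd (Finset.mem_univ w) (mem_boundary.1 (boundary_comp_subset (by simp) hw)).1
  · simpa using Finset.card_le_univ (G.comp Finset.univ u)

/-- A graph with an edge has positive treewidth. -/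
theorem one_le_of_treewidth_le (h : treewidth G.underlying ≤ k) (hm : 0 < m) : 1 ≤ k := by
  obtain ⟨D, hD⟩ := exists_treeDecomposition h
  have hadj := G.underlying_adj_iff.2 (G.nbr_src_tgt ⟨0, hm⟩)
  obtain ⟨i, h1, h2⟩ := D.edge _ _ hadj
  have := Finset.one_lt_card.2 ⟨_, h1, _, h2, hadj.ne⟩
  have := hD i
  omega

end DAG

/-! ### Longest paths and labellings -/

namespace DAG

variable {n m : ℕ} {G : DAG n m}

theorem IsPath.append {u v w : Fin n} {p q : List (Fin m)} (hp : G.IsPath u v p)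
    (hq : G.IsPath v w q) : G.IsPath u w (p ++ q) := by
  induction hp with
  | nil => exact hq
  | cons e _ ih => exact .cons e (ih hq)

theorem IsPath.reflTransGen_src {u v : Fin n} {p : List (Fin m)} (hp : G.IsPath u v p) {e : Fin m}
    (he : e ∈ p) :
    Relation.ReflTransGen (fun u w => ∃ e, G.src e = u ∧ G.tgt e = w) u (G.src e) := by
  induction hp with
  | nil => simp at he
  | cons e' _ ih =>
    rcases List.mem_cons.1 he with rfl | he
    · exact .refl
    · exact .head ⟨e', rfl, rfl⟩ (ih he)

theorem IsPath.nodup {u v : Fin n} {p : List (Fin m)} (hp : G.IsPath u v p) : p.Nodup := by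
  induction hp with
  | nil => exact List.nodup_nil
  | cons e hp ih =>
    refine List.nodup_cons.2 ⟨fun he => ?_, ih⟩
    exact G.acyclic _ (.head' ⟨e, rfl, rfl⟩ (hp.reflTransGen_src he))

theorem wellFounded (G : DAG n m) : WellFounded fun u w => ∃ e, G.src e = u ∧ G.tgt e = w := by
  have : Std.Irrefl (Relation.TransGen fun u w => ∃ e, G.src e = u ∧ G.tgt e = w) := ⟨G.acyclic⟩
  exact Subrelation.wf (fun h => .single h)
    (Finite.wellFounded_of_trans_of_irrefl
      (Relation.TransGen fun u w => ∃ e, G.src e = u ∧ G.tgt e = w))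

theorem wellFounded_swap (G : DAG n m) :
    WellFounded fun w u => ∃ e, G.src e = u ∧ G.tgt e = w := by
  have : Std.Irrefl (Relation.TransGen fun w u => ∃ e, G.src e = u ∧ G.tgt e = w) := by
    refine ⟨fun v hv => G.acyclic v ?_⟩
    exact Relation.transGen_swap.1 hv
  exact Subrelation.wf (fun h => .single h)
    (Finite.wellFounded_of_trans_of_irrefl
      (Relation.TransGen fun w u => ∃ e, G.src e = u ∧ G.tgt e = w))

/-- The largest value, over the edges that enter `v`, of the label of the tail plus the length of
the edge. -/
def arrival (G : DAG n m) (L : Fin m → ℕ) (c : Fin n → ℕ) (v : Fin n) : ℕ :=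
  Finset.sup {e | G.tgt e = v} fun e => c (G.src e) + L e

theorem le_arrival {L : Fin m → ℕ} {c : Fin n → ℕ} (e : Fin m) :
    c (G.src e) + L e ≤ G.arrival L c (G.tgt e) :=
  Finset.le_sup (f := fun e => c (G.src e) + L e) (by simp)

/-- Lengths of longest paths to the vertices: the only labelling for which every label equals the
`arrival`. -/
theorem exists_label (G : DAG n m) (L : Fin m → ℕ) :
    ∃ z : Fin n → ℕ, ∀ c : Fin n → ℕ, (∀ v, c v = G.arrival L c v) ↔ c = z := by
  classical
  set z : Fin n → ℕ := G.wellFounded.fix fun v ih =>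
    Finset.sup (Finset.attach {e | G.tgt e = v}) fun e =>
      ih (G.src e) ⟨e, rfl, (Finset.mem_filter.1 e.2).2⟩ + L e with hz
  have hfix : ∀ v, z v = G.arrival L z v := by
    intro v
    rw [hz, WellFounded.fix_eq, arrival]
    exact Finset.sup_attach _ fun e => z (G.src e) + L e
  refine ⟨z, fun c => ⟨fun hc => ?_, fun hc => hc ▸ hfix⟩⟩
  funext v
  induction v using G.wellFounded.induction with
  | _ v ih =>
    rw [hc, hfix]
    refine Finset.sup_congr rfl fun e he => ?_
    rw [ih (G.src e) ⟨e, rfl, (Finset.mem_filter.1 he).2⟩]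

section label

variable {L : Fin m → ℕ} {z : Fin n → ℕ}

theorem IsPath.label_add_sum_le (hz : ∀ v, z v = G.arrival L z v) {u v : Fin n}
    {p : List (Fin m)} (hp : G.IsPath u v p) : z u + (p.map L).sum ≤ z v := by
  induction hp with
  | nil => simp
  | cons e _ ih =>
    have h1 : z (G.src e) + L e ≤ z (G.tgt e) := (le_arrival e).trans_eq (hz _).symm
    simp only [List.map_cons, List.sum_cons]
    omega

theorem exists_path_sum_eq_label (hz : ∀ v, z v = G.arrival L z v) (v : Fin n) :
    ∃ s p, G.IsSource s ∧ G.IsPath s v p ∧ (p.map L).sum = z v := by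
  induction v using G.wellFounded.induction with
  | _ v ih =>
    rcases Finset.eq_empty_or_nonempty {e | G.tgt e = v} with h | h
    · refine ⟨v, [], fun e he => ?_, .nil v, ?_⟩
      · have : e ∈ ({e | G.tgt e = v} : Finset (Fin m)) := by simpa using he
        simp [h] at this
      · rw [hz, arrival, h]; simp
    · obtain ⟨e, he, hmax⟩ := Finset.exists_mem_eq_sup _ h fun e => z (G.src e) + L e
      have hev : G.tgt e = v := by simpa using he
      obtain ⟨s, p, hs, hp, hsum⟩ := ih (G.src e) ⟨e, rfl, hev⟩
      refine ⟨s, p ++ [e], hs, hp.append ?_, ?_⟩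
      · have := IsPath.cons e (IsPath.nil (G := G) (G.tgt e))
        rwa [hev] at this
      · rw [hz v, arrival, hmax, ← hsum]; simp

theorem exists_path_to_terminal (G : DAG n m) (v : Fin n) :
    ∃ t p, G.IsTerminal t ∧ G.IsPath v t p := by
  induction v using G.wellFounded_swap.induction with
  | _ v ih =>
    by_cases h : G.IsTerminal v
    · exact ⟨v, [], h, .nil v⟩
    · simp only [IsTerminal, not_forall, not_not] at h
      obtain ⟨e, rfl⟩ := h
      obtain ⟨t, p, ht, hp⟩ := ih (G.tgt e) ⟨e, rfl, rfl⟩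
      exact ⟨t, e :: p, ht, .cons e hp⟩

theorem exists_path_from_source (G : DAG n m) (v : Fin n) :
    ∃ s p, G.IsSource s ∧ G.IsPath s v p := by
  obtain ⟨z, hz⟩ := G.exists_label (fun _ => 0)
  obtain ⟨s, p, h1, h2, -⟩ := exists_path_sum_eq_label ((hz z).2 rfl) v
  exact ⟨s, p, h1, h2⟩

theorem forall_stPaths_sum_le_iff (hz : ∀ v, z v = G.arrival L z v) {M : ℕ} :
    (∀ p ∈ G.stPaths, (p.map L).sum ≤ M) ↔ ∀ v, z v ≤ M := by
  constructor
  · intro h v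
    obtain ⟨s, p, hs, hp, hsum⟩ := exists_path_sum_eq_label hz v
    obtain ⟨t, q, ht, hq⟩ := G.exists_path_to_terminal v
    have := h (p ++ q) ⟨s, t, hs, ht, hp.append hq⟩
    simp only [List.map_append, List.sum_append] at this
    omega
  · rintro h p ⟨s, t, -, -, hp⟩
    have := hp.label_add_sum_le hz
    have := h t
    omega

end label

theorem exists_stPath_mem (G : DAG n m) (e : Fin m) : ∃ p ∈ G.stPaths, e ∈ p := by
  obtain ⟨s, p, hs, hp⟩ := G.exists_path_from_source (G.src e)
  obtain ⟨t, q, ht, hq⟩ := G.exists_path_to_terminal (G.tgt e)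
  exact ⟨p ++ e :: q, ⟨s, t, hs, ht, hp.append (.cons e hq)⟩, by simp⟩

theorem finite_stPaths (G : DAG n m) : G.stPaths.Finite := by
  refine (List.finite_length_le (Fin m) m).subset ?_
  rintro p ⟨s, t, -, -, hp⟩
  simpa using hp.nodup.length_le_card

/-! ### The partition function counts labellings -/

open Classical in
/-- Summation over the states of `v` with label `c v` gives the indicator function of the condition
that `c v` is the `arrival` at `v`: the state with sign `1` contributes the indicator function of
`arrival ≤ c v`, the state with sign `-1` subtracts that of `arrival < c v`. -/
theorem sum_states_eq {L : Fin m → ℕ} {c : Fin n → ℕ} {M : ℕ} {v : Fin n} (hc : c v ≤ M)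
    {w : ℕ → ℝ} (hw : ∀ t, w t = if t ≤ M + 1 then 1 else -1) :
    ∑ t ∈ Finset.Icc 1 (2 * M + 1) with tailLabel M t = c v,
      w t * ∏ e with G.tgt e = v, (if L e < headLabel M t - c (G.src e) then 1 else 0) =
      if c v = G.arrival L c v then 1 else 0 := by
  have hprod : ∀ b, 0 < b →
      (∏ e with G.tgt e = v, if L e < b - c (G.src e) then (1 : ℝ) else 0) =
      if G.arrival L c v < b then 1 else 0 := by
    intro b hb
    rw [Finset.prod_ite_zero, Finset.prod_const_one]
    congr 1
    rw [arrival, Finset.sup_lt_iff hb, eq_iff_iff]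
    refine forall₂_congr fun e _ => ?_
    omega
  rcases Nat.eq_zero_or_pos (c v) with h0 | h0
  · have hset : ({t ∈ Finset.Icc 1 (2 * M + 1) | tailLabel M t = c v} : Finset ℕ) = {1} := by
      ext t
      rw [Finset.mem_filter, Finset.mem_Icc, Finset.mem_singleton, tailLabel]
      split_ifs <;> omega
    have h1 : headLabel M 1 = 1 := by simp [headLabel]
    rw [hset, Finset.sum_singleton, h1, hprod 1 one_pos, hw, if_pos (by omega), one_mul, h0]
    congr 1
    rw [eq_iff_iff]
    omega
  · have hset : ({t ∈ Finset.Icc 1 (2 * M + 1) | tailLabel M t = c v} : Finset ℕ) =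
        {c v + 1, c v + 1 + M} := by
      ext t
      rw [Finset.mem_filter, Finset.mem_Icc, Finset.mem_insert, Finset.mem_singleton, tailLabel]
      split_ifs <;> omega
    have h1 : headLabel M (c v + 1) = c v + 1 := by
      rw [headLabel, if_pos (by omega)]
    have h2 : headLabel M (c v + 1 + M) = c v := by
      rw [headLabel, if_neg (by omega)]; omega
    have hw1 : w (c v + 1) = 1 := by rw [hw, if_pos (by omega)]
    have hw2 : w (c v + 1 + M) = -1 := by rw [hw, if_neg (by omega)]
    rw [hset, Finset.sum_pair (by omega), h1, h2, hprod _ (Nat.succ_pos _), hprod _ h0, hw1, hw2]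
    split_ifs <;> first | (exfalso; omega) | norm_num

open Classical in
/-- The partition function for integral edge lengths `L` is the indicator function of the condition
that all paths have length at most `M`. -/
theorem sum_states_prod_eq (L : Fin m → ℕ) (M : ℕ) {w : ℕ → ℝ}
    (hw : ∀ t, w t = if t ≤ M + 1 then 1 else -1) :
    ∑ τ ∈ Fintype.piFinset fun _ : Fin n => Finset.Icc 1 (2 * M + 1),
      (∏ v, w (τ v)) * ∏ e, (if L e < headLabel M (τ (G.tgt e)) - tailLabel M (τ (G.src e))
        then 1 else 0) =
      if ∀ p ∈ G.stPaths, (p.map L).sum ≤ M then 1 else 0 := by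
  obtain ⟨z, hz⟩ := G.exists_label L
  rw [← Finset.sum_fiberwise_of_maps_to
    (t := Fintype.piFinset fun _ : Fin n => Finset.range (M + 1))
    (g := fun τ v => tailLabel M (τ v))]
  · have hfib : ∀ c ∈ Fintype.piFinset fun _ : Fin n => Finset.range (M + 1),
        (∑ τ ∈ Fintype.piFinset fun _ : Fin n => Finset.Icc 1 (2 * M + 1) with
          (fun v => tailLabel M (τ v)) = c,
          (∏ v, w (τ v)) * ∏ e, (if L e < headLabel M (τ (G.tgt e)) - tailLabel M (τ (G.src e))
            then (1 : ℝ) else 0)) = if c = z then 1 else 0 := by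
      intro c hc
      have hset : ({τ ∈ Fintype.piFinset fun _ : Fin n => Finset.Icc 1 (2 * M + 1) |
            (fun v => tailLabel M (τ v)) = c} : Finset (Fin n → ℕ)) =
          Fintype.piFinset fun v =>
            ({t ∈ Finset.Icc 1 (2 * M + 1) | tailLabel M t = c v} : Finset ℕ) := by
        ext τ
        simp only [Finset.mem_filter, Fintype.mem_piFinset, funext_iff, forall_and]
      have hterm : ∀ τ : Fin n → ℕ, (fun v => tailLabel M (τ v)) = c →
          (∏ v, w (τ v)) * ∏ e, (if L e < headLabel M (τ (G.tgt e)) - tailLabel M (τ (G.src e))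
            then (1 : ℝ) else 0) = ∏ v, (w (τ v) * ∏ e with G.tgt e = v,
              (if L e < headLabel M (τ v) - c (G.src e) then 1 else 0)) := by
        rintro τ rfl
        rw [Finset.prod_mul_distrib]
        congr 1
        rw [← Finset.prod_fiberwise Finset.univ G.tgt]
        refine Finset.prod_congr rfl fun v _ => Finset.prod_congr rfl fun e he => ?_
        rw [(Finset.mem_filter.1 he).2]
      rw [Finset.sum_congr rfl fun τ hτ => hterm τ (Finset.mem_filter.1 hτ).2, hset]
      refine (Finset.prod_univ_sum (fun v => {t ∈ Finset.Icc 1 (2 * M + 1) | tailLabel M t = c v})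
        fun v t => w t * ∏ e with G.tgt e = v,
          (if L e < headLabel M t - c (G.src e) then 1 else 0)).symm.trans ?_
      rw [Finset.prod_congr rfl fun v _ => sum_states_eq (by
        have := Fintype.mem_piFinset.1 hc v
        simp only [Finset.mem_range] at this
        omega) hw, Finset.prod_ite_zero, Finset.prod_const_one]
      congr 1
      simp only [Finset.mem_univ, true_imp_iff, eq_iff_iff]
      exact hz c
    rw [Finset.sum_congr rfl hfib, Finset.sum_ite_eq']
    congr 1
    rw [forall_stPaths_sum_le_iff ((hz z).2 rfl), eq_iff_iff, Fintype.mem_piFinset]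
    simp only [Finset.mem_range, Nat.lt_succ_iff]
  · intro τ hτ
    rw [Fintype.mem_piFinset] at hτ ⊢
    intro v
    have := hτ v
    simp only [Finset.mem_Icc] at this
    simp only [Finset.mem_range, tailLabel]
    split_ifs <;> omega

end DAG

/-! ### The law of the longest path length -/

namespace DAG

variable {n m : ℕ}

theorem longestPathLength_le_iff (G : DAG n m) (y : Fin m → ℝ) {x : ℝ} (hx : 0 ≤ x) :
    G.longestPathLength y ≤ x ↔ ∀ p ∈ G.stPaths, pathLength y p ≤ x := by
  constructor
  · intro h p hp
    exact (le_csSup (G.finite_stPaths.image _).bddAbove ⟨p, hp, rfl⟩).trans h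
  · intro h
    refine Real.sSup_le ?_ hx
    rintro _ ⟨p, hp, rfl⟩
    exact h p hp

theorem continuous_pathLength (p : List (Fin m)) :
    Continuous fun y : Fin m → ℝ => pathLength y p := by
  induction p with
  | nil => exact continuous_const
  | cons e p ih =>
    simp only [pathLength, List.map_cons, List.sum_cons] at ih ⊢
    exact (continuous_apply e).add ih

theorem isClosed_setOf_pathLength_le (G : DAG n m) (x : ℝ) :
    IsClosed {y : Fin m → ℝ | ∀ p ∈ G.stPaths, pathLength y p ≤ x} := by
  simp only [Set.ofPred_forall]
  exact isClosed_biInter fun p _ => isClosed_le (continuous_pathLength p) continuous_const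

/-- Lebesgue measure on the unit cube, as a product measure. -/
noncomputable def cubeMeasure (m : ℕ) : Measure (Fin m → ℝ) :=
  Measure.pi fun _ => volume.restrict (Set.Icc (0 : ℝ) 1)

theorem cubeMeasure_eq (m : ℕ) :
    cubeMeasure m = volume.restrict (Set.univ.pi fun _ : Fin m => Set.Icc (0 : ℝ) 1) := by
  rw [cubeMeasure, ← Measure.restrict_pi_pi, volume_pi]

instance (m : ℕ) : IsFiniteMeasure (cubeMeasure m) := by
  rw [cubeMeasure]
  infer_instance

theorem cubeMeasure_real {s : Set (Fin m → ℝ)} (hs : MeasurableSet s) :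
    (cubeMeasure m).real s =
      volume.real {y : Fin m → ℝ | (∀ e, y e ∈ Set.Icc (0 : ℝ) 1) ∧ y ∈ s} := by
  rw [cubeMeasure_eq, measureReal_restrict_apply hs]
  congr 1
  ext y
  simp only [Set.mem_inter_iff, Set.mem_pi, Set.mem_univ, true_imp_iff, Set.mem_ofPred_eq]
  exact and_comm

theorem cond_volume_Icc_eq_map {c : ℝ} (hc : 0 < c) :
    ProbabilityTheory.cond volume (Set.Icc 0 c) =
      (volume.restrict (Set.Icc (0 : ℝ) 1)).map (fun t => c * t) := by
  have hpre : (fun t => c * t) ⁻¹' Set.Icc 0 c = Set.Icc (0 : ℝ) 1 := by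
    ext t
    simp only [Set.mem_preimage, Set.mem_Icc]
    constructor
    · rintro ⟨h1, h2⟩
      exact ⟨by nlinarith, by nlinarith⟩
    · rintro ⟨h1, h2⟩
      exact ⟨by positivity, by nlinarith⟩
  rw [ProbabilityTheory.cond, ← hpre,
    ← Measure.restrict_map (measurable_const_mul c) measurableSet_Icc, Real.map_volume_mul_left hc.ne',
    Measure.restrict_smul, Real.volume_Icc, sub_zero,
    abs_of_pos (inv_pos.2 hc), ENNReal.ofReal_inv_of_pos hc]

/-- The distribution function of the longest path length is the volume of the polytope. -/
theorem measureReal_longestPathLength_le (G : DAG n m) {a : Fin m → ℕ} {x : ℝ}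
    (ha : ∀ e, 0 < a e) (hx : 0 ≤ x) {Ω : Type*} [MeasurableSpace Ω] {μ : Measure Ω}
    [IsProbabilityMeasure μ] {Y : Fin m → Ω → ℝ} (hY : ∀ e, Measurable (Y e))
    (hind : iIndepFun Y μ)
    (hunif : ∀ e, pdf.IsUniform (Y e) (Set.Icc 0 (a e : ℝ)) μ volume) :
    μ.real {ω | G.longestPathLength (fun e => Y e ω) ≤ x} = G.vol a x := by
  have hlaw : μ.map (fun ω e => Y e ω) =
      (cubeMeasure m).map (fun y e => (a e : ℝ) * y e) := by
    rw [(iIndepFun_iff_map_fun_eq_pi_map fun e => (hY e).aemeasurable).1 hind, cubeMeasure,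
      Measure.pi_map_pi fun e => (measurable_const_mul (a e : ℝ)).aemeasurable]
    congr 1
    funext e
    rw [hunif e, cond_volume_Icc_eq_map (by exact_mod_cast ha e)]
  have hS := (G.isClosed_setOf_pathLength_le x).measurableSet
  have hscale : Measurable fun (y : Fin m → ℝ) e => (a e : ℝ) * y e := by fun_prop
  calc μ.real {ω | G.longestPathLength (fun e => Y e ω) ≤ x}
      = (μ.map fun ω e => Y e ω).real {y | ∀ p ∈ G.stPaths, pathLength y p ≤ x} := by
        rw [map_measureReal_apply (measurable_pi_lambda _ hY) hS]
        congr 1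
        ext ω
        exact G.longestPathLength_le_iff _ hx
    _ = G.vol a x := by
        rw [hlaw, map_measureReal_apply hscale hS, cubeMeasure_real (hscale hS)]
        rfl

/-! ### The volume of the discretized polytope -/

/-- The integral edge lengths obtained by rounding the lengths `a e * y e` down to multiples of
`δ`. -/
noncomputable def roundedLength (a : Fin m → ℕ) (δ : ℝ) (y : Fin m → ℝ) (e : Fin m) : ℕ :=
  ⌊(a e : ℝ) * y e / δ⌋₊

/-- The points of the unit cube for which all paths have rounded length at most `M`. -/
def roundedPolytope (G : DAG n m) (a : Fin m → ℕ) (δ : ℝ) (M : ℕ) : Set (Fin m → ℝ) :=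
  {y | (∀ e, y e ∈ Set.Icc (0 : ℝ) 1) ∧
    ∀ p ∈ G.stPaths, (p.map (roundedLength a δ y)).sum ≤ M}

theorem measurable_sum_roundedLength (a : Fin m → ℕ) (δ : ℝ) (p : List (Fin m)) :
    Measurable fun y => (p.map (roundedLength a δ y)).sum := by
  induction p with
  | nil => exact measurable_const
  | cons e p ih =>
    simp only [List.map_cons, List.sum_cons]
    refine Measurable.add ?_ ih
    unfold roundedLength
    exact Nat.measurable_floor.comp (by fun_prop)

theorem measurableSet_setOf_roundedLength_le (G : DAG n m) (a : Fin m → ℕ) (δ : ℝ) (M : ℕ) :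
    MeasurableSet {y | ∀ p ∈ G.stPaths, (p.map (roundedLength a δ y)).sum ≤ M} := by
  simp only [Set.ofPred_forall]
  exact MeasurableSet.biInter G.finite_stPaths.countable fun p _ =>
    measurableSet_le (measurable_sum_roundedLength a δ p) measurable_const

theorem volume_real_Icc_inter_Iio {c : ℝ} (hc : 0 ≤ c) :
    volume.real (Set.Icc (0 : ℝ) 1 ∩ Set.Iio c) = min 1 c := by
  rcases le_or_gt c 1 with h | h
  · have : Set.Icc (0 : ℝ) 1 ∩ Set.Iio c = Set.Ico 0 c := by
      ext t
      simp only [Set.mem_inter_iff, Set.mem_Icc, Set.mem_Iio, Set.mem_Ico]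
      constructor
      · rintro ⟨⟨h1, -⟩, h3⟩
        exact ⟨h1, h3⟩
      · rintro ⟨h1, h2⟩
        exact ⟨⟨h1, (h2.trans_le h).le⟩, h2⟩
    rw [this, Real.volume_real_Ico_of_le hc, sub_zero, min_eq_right h]
  · have : Set.Icc (0 : ℝ) 1 ∩ Set.Iio c = Set.Icc 0 1 :=
      Set.inter_eq_left.2 fun t ht => ht.2.trans_lt h
    rw [this, Real.volume_real_Icc_of_le zero_le_one, sub_zero, min_eq_left h.le]

theorem integrable_roundedLength_lt {b : ℕ} {δ : ℝ} (d : ℕ) :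
    Integrable (fun t => if ⌊(b : ℝ) * t / δ⌋₊ < d then (1 : ℝ) else 0)
      (volume.restrict (Set.Icc (0 : ℝ) 1)) := by
  have hm : Measurable fun t : ℝ => ⌊(b : ℝ) * t / δ⌋₊ := Nat.measurable_floor.comp (by fun_prop)
  refine Integrable.of_bound (C := 1) (Measurable.aestronglyMeasurable (Measurable.ite
    (measurableSet_lt hm measurable_const) measurable_const measurable_const))
    (Filter.Eventually.of_forall fun t => ?_)
  split_ifs <;> simp

theorem integral_roundedLength_lt {b : ℕ} (hb : 0 < b) {δ : ℝ} (hδ : 0 < δ) (d : ℕ) :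
    ∫ t in Set.Icc (0 : ℝ) 1, (if ⌊(b : ℝ) * t / δ⌋₊ < d then (1 : ℝ) else 0) =
      min 1 (d * δ / b) := by
  have hb' : (0 : ℝ) < b := by exact_mod_cast hb
  have h : ∀ t ∈ Set.Icc (0 : ℝ) 1, (if ⌊(b : ℝ) * t / δ⌋₊ < d then (1 : ℝ) else 0) =
      (Set.Iio (d * δ / b : ℝ)).indicator 1 t := by
    intro t ht
    have h0 : 0 ≤ (b : ℝ) * t / δ := by have := ht.1; positivity
    have : ⌊(b : ℝ) * t / δ⌋₊ < d ↔ t ∈ Set.Iio (d * δ / b : ℝ) := by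
      rw [Nat.floor_lt h0, div_lt_iff₀ hδ, Set.mem_Iio, lt_div_iff₀ hb', mul_comm (b : ℝ)]
    simp only [this, Set.indicator_apply, Pi.one_apply]
  rw [setIntegral_congr_fun measurableSet_Icc h, integral_indicator_one measurableSet_Iio,
    measureReal_restrict_apply measurableSet_Iio, Set.inter_comm,
    volume_real_Icc_inter_Iio (by positivity)]

theorem part_univ (G : DAG n m) (μ : Model m) (σ : Fin n → ℕ) :
    μ.part G Finset.univ σ = ∑ τ ∈ Fintype.piFinset fun _ : Fin n => Finset.Icc 1 μ.B,
      (∏ v, μ.w (τ v)) * ∏ e, μ.φ e (τ (G.src e)) (τ (G.tgt e)) := by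
  classical
  unfold Model.part
  simp

/-- The partition function of `pathModel` is the volume of the discretized polytope: integrate the
counting formula `sum_states_prod_eq` over the unit cube. -/
theorem volume_roundedPolytope (G : DAG n m) {a : Fin m → ℕ} {x : ℝ} {M : ℕ}
    (ha : ∀ e, 0 < a e) (hx : 0 < x) (hM : 0 < M) (σ : Fin n → ℕ) :
    volume.real (G.roundedPolytope a (x / M) M) = (pathModel a x M).part G Finset.univ σ := by
  classical
  set δ : ℝ := x / M with hδ
  have hM' : (0 : ℝ) < M := by exact_mod_cast hM
  have hδ0 : 0 < δ := by positivity
  have hint : ∀ τ : Fin n → ℕ, Integrable (fun y : Fin m → ℝ => ∏ e,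
      (if roundedLength a δ y e < headLabel M (τ (G.tgt e)) - tailLabel M (τ (G.src e))
        then (1 : ℝ) else 0)) (cubeMeasure m) := fun τ =>
    Integrable.fintype_prod (μ := fun _ : Fin m => volume.restrict (Set.Icc (0 : ℝ) 1))
      (f := fun e t => if ⌊(a e : ℝ) * t / δ⌋₊ < headLabel M (τ (G.tgt e)) -
        tailLabel M (τ (G.src e)) then (1 : ℝ) else 0) fun e => integrable_roundedLength_lt _
  calc volume.real (G.roundedPolytope a δ M)
      = (cubeMeasure m).real {y | ∀ p ∈ G.stPaths, (p.map (roundedLength a δ y)).sum ≤ M} :=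
        (cubeMeasure_real (G.measurableSet_setOf_roundedLength_le a δ M)).symm
    _ = ∫ y, (if ∀ p ∈ G.stPaths, (p.map (roundedLength a δ y)).sum ≤ M then (1 : ℝ) else 0)
          ∂cubeMeasure m := by
        rw [← integral_indicator_one (G.measurableSet_setOf_roundedLength_le a δ M)]
        refine integral_congr_ae (Filter.Eventually.of_forall fun y => ?_)
        simp only [Set.indicator_apply, Set.mem_ofPred_eq, Pi.one_apply]
    _ = ∫ y, ∑ τ ∈ Fintype.piFinset fun _ : Fin n => Finset.Icc 1 (2 * M + 1),
          (∏ v, (pathModel a x M).w (τ v)) * ∏ e,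
            (if roundedLength a δ y e < headLabel M (τ (G.tgt e)) - tailLabel M (τ (G.src e))
              then (1 : ℝ) else 0) ∂cubeMeasure m := by
        refine integral_congr_ae (Filter.Eventually.of_forall fun y => ?_)
        exact (G.sum_states_prod_eq (roundedLength a δ y) M fun t => rfl).symm
    _ = ∑ τ ∈ Fintype.piFinset fun _ : Fin n => Finset.Icc 1 (2 * M + 1),
          (∏ v, (pathModel a x M).w (τ v)) *
            ∏ e, (pathModel a x M).φ e (τ (G.src e)) (τ (G.tgt e)) := by
        rw [integral_finsetSum _ fun τ _ => (hint τ).const_mul _]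
        refine Finset.sum_congr rfl fun τ _ => ?_
        rw [integral_const_mul]
        congr 1
        refine (integral_fintype_prod_eq_prod (fun e t => if ⌊(a e : ℝ) * t / δ⌋₊ <
          headLabel M (τ (G.tgt e)) - tailLabel M (τ (G.src e)) then (1 : ℝ) else 0)).trans ?_
        refine Finset.prod_congr rfl fun e _ => ?_
        rw [integral_roundedLength_lt (ha e) hδ0, pathModel]
        congr 1
        have := ha e
        rw [hδ]
        field_simp
    _ = (pathModel a x M).part G Finset.univ σ := (G.part_univ _ σ).symm

/-! ### The error of the discretization -/

theorem polytope_subset_roundedPolytope (G : DAG n m) (a : Fin m → ℕ) {x : ℝ} {M : ℕ}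
    (hx : 0 < x) (hM : 0 < M) : G.polytope a x ⊆ G.roundedPolytope a (x / M) M := by
  rintro y ⟨h1, h2⟩
  refine ⟨h1, fun p hp => ?_⟩
  have hM' : (0 : ℝ) < M := by exact_mod_cast hM
  have hδ : 0 < x / M := by positivity
  have key : ∀ q : List (Fin m), ((q.map (roundedLength a (x / M) y)).sum : ℝ) * (x / M) ≤
      pathLength (fun e => (a e : ℝ) * y e) q := by
    intro q
    induction q with
    | nil => simp [pathLength]
    | cons e q ih =>
      simp only [pathLength, List.map_cons, List.sum_cons, Nat.cast_add] at ih ⊢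
      have h0 : 0 ≤ (a e : ℝ) * y e / (x / M) := by have := (h1 e).1; positivity
      have := Nat.floor_le h0
      rw [le_div_iff₀ hδ] at this
      have e1 : (roundedLength a (x / M) y e : ℝ) * (x / M) ≤ a e * y e := this
      linarith
  have h := (key p).trans (h2 p hp)
  rw [← le_div_iff₀ hδ, div_div_cancel₀ hx.ne'] at h
  exact_mod_cast h

theorem roundedPolytope_subset_polytope (G : DAG n m) (a : Fin m → ℕ) {x : ℝ} {M : ℕ}
    (hx : 0 < x) (hM : 0 < M) :
    G.roundedPolytope a (x / M) M ⊆ G.polytope a ((1 + m / M) * x) := by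
  rintro y ⟨h1, h2⟩
  refine ⟨h1, fun p hp => ?_⟩
  have hM' : (0 : ℝ) < M := by exact_mod_cast hM
  have hδ : 0 < x / M := by positivity
  have key : ∀ q : List (Fin m), pathLength (fun e => (a e : ℝ) * y e) q ≤
      (((q.map (roundedLength a (x / M) y)).sum : ℝ) + q.length) * (x / M) := by
    intro q
    induction q with
    | nil => simp [pathLength]
    | cons e q ih =>
      simp only [pathLength, List.map_cons, List.sum_cons, Nat.cast_add, List.length_cons,
        Nat.cast_one] at ih ⊢
      have := (Nat.lt_floor_add_one ((a e : ℝ) * y e / (x / M))).le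
      rw [div_le_iff₀ hδ] at this
      have e1 : (a e : ℝ) * y e ≤ ((roundedLength a (x / M) y e : ℝ) + 1) * (x / M) := this
      linarith
  obtain ⟨s, t, -, -, hst⟩ := id hp
  have hlen : (p.length : ℝ) ≤ m := by
    exact_mod_cast by simpa using hst.nodup.length_le_card
  have hsum : ((p.map (roundedLength a (x / M) y)).sum : ℝ) ≤ M := by exact_mod_cast h2 p hp
  calc _ ≤ _ := key p
    _ ≤ (M + m) * (x / M) := by gcongr
    _ = (1 + m / M) * x := by field_simp

theorem volume_polytope_ne_top (G : DAG n m) (a : Fin m → ℕ) (x : ℝ) :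
    volume (G.polytope a x) ≠ ⊤ := by
  have hsub : G.polytope a x ⊆ Set.Icc 0 1 := fun y hy =>
    ⟨fun e => (hy.1 e).1, fun e => (hy.1 e).2⟩
  exact measure_ne_top_of_subset hsub isCompact_Icc.measure_lt_top.ne

open scoped Pointwise in
/-- The polytope with bound `r * x` is contained in the `r`-fold dilation of the one with bound `x`.
-/
theorem vol_mul_le (G : DAG n m) (a : Fin m → ℕ) (x : ℝ) {r : ℝ} (hr : 1 ≤ r) :
    G.vol a (r * x) ≤ r ^ m * G.vol a x := by
  have hr0 : 0 < r := by linarith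
  have hsub : G.polytope a (r * x) ⊆ r • G.polytope a x := by
    rintro y ⟨h1, h2⟩
    refine ⟨r⁻¹ • y, ⟨fun e => ⟨?_, ?_⟩, fun p hp => ?_⟩, smul_inv_smul₀ hr0.ne' y⟩
    · exact mul_nonneg (inv_nonneg.2 hr0.le) (h1 e).1
    · exact mul_le_one₀ (inv_le_one_of_one_le₀ hr) (h1 e).1 (h1 e).2
    · have hp' : pathLength (fun e => (a e : ℝ) * (r⁻¹ • y) e) p =
          r⁻¹ * pathLength (fun e => (a e : ℝ) * y e) p := by
        rw [pathLength, pathLength, ← List.sum_map_mul_left]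
        congr 1
        refine List.map_congr_left fun e _ => ?_
        simp only [Pi.smul_apply, smul_eq_mul]
        ring
      rw [hp', inv_mul_le_iff₀ hr0]
      exact h2 p hp
  have hvol : volume (r • G.polytope a x) = ENNReal.ofReal (r ^ m) * volume (G.polytope a x) := by
    rw [Measure.addHaar_smul, Module.finrank_fin_fun, abs_of_pos (by positivity)]
  have hfin : volume (r • G.polytope a x) ≠ ⊤ := by
    rw [hvol]
    exact ENNReal.mul_ne_top ENNReal.ofReal_ne_top (G.volume_polytope_ne_top a x)
  calc G.vol a (r * x) ≤ volume.real (r • G.polytope a x) := measureReal_mono hsub hfin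
    _ = r ^ m * G.vol a x := by
      rw [measureReal_def, hvol, ENNReal.toReal_mul, ENNReal.toReal_ofReal (by positivity)]
      rfl

/-- For positive `x` the polytope contains a small cube. -/
theorem vol_pos (G : DAG n m) (a : Fin m → ℕ) {x : ℝ} (hx : 0 < x) : 0 < G.vol a x := by
  set A : ℝ := ∑ e, (a e : ℝ) + 1 with hA
  have hA0 : 0 < A := by positivity
  set η : ℝ := min 1 (x / A) with hη
  have hη0 : 0 < η := lt_min one_pos (by positivity)
  have hsub : Set.Icc 0 (fun _ => η) ⊆ G.polytope a x := by
    rintro y ⟨h0, h1⟩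
    refine ⟨fun e => ⟨h0 e, (h1 e).trans (min_le_left _ _)⟩, ?_⟩
    rintro p ⟨s, t, -, -, hp⟩
    calc pathLength (fun e => (a e : ℝ) * y e) p
        = ∑ e ∈ p.toFinset, (a e : ℝ) * y e := by
          rw [pathLength, List.sum_toFinset _ hp.nodup]
      _ ≤ ∑ e, (a e : ℝ) * y e := Finset.sum_le_sum_of_subset_of_nonneg
          (Finset.subset_univ _) fun e _ _ => mul_nonneg (Nat.cast_nonneg _) (h0 e)
      _ ≤ ∑ e, (a e : ℝ) * η := Finset.sum_le_sum fun e _ =>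
          mul_le_mul_of_nonneg_left (h1 e) (Nat.cast_nonneg _)
      _ = (∑ e, (a e : ℝ)) * η := (Finset.sum_mul _ _ _).symm
      _ ≤ A * η := mul_le_mul_of_nonneg_right (by linarith) hη0.le
      _ ≤ A * (x / A) := mul_le_mul_of_nonneg_left (min_le_right _ _) hA0.le
      _ = x := by field_simp
  have hcube : 0 < volume.real (Set.Icc (0 : Fin m → ℝ) fun _ => η) := by
    rw [measureReal_def, Real.volume_Icc_pi_toReal (a := (0 : Fin m → ℝ)) fun _ => hη0.le]
    exact Finset.prod_pos fun _ _ => by simpa using hη0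
  exact hcube.trans_le (measureReal_mono hsub (G.volume_polytope_ne_top a x))

/-- The polytope with bound `0` lies in a hyperplane, since every edge lies on a path from a source
to a terminal. -/
theorem vol_zero (G : DAG n m) {a : Fin m → ℕ} (hm : 0 < m) (ha : ∀ e, 0 < a e) :
    G.vol a 0 = 0 := by
  set e : Fin m := ⟨0, hm⟩
  obtain ⟨p, hp, he⟩ := G.exists_stPath_mem e
  have hsub : G.polytope a 0 ⊆ {y | y e = 0} := by
    rintro y ⟨h1, h2⟩
    have hle : (a e : ℝ) * y e ≤ 0 := by
      refine le_trans ?_ (h2 p hp)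
      refine List.single_le_sum (fun z hz => ?_) _ (List.mem_map_of_mem he)
      obtain ⟨e', -, rfl⟩ := List.mem_map.1 hz
      exact mul_nonneg (Nat.cast_nonneg _) (h1 e').1
    have hae : (0 : ℝ) < a e := by exact_mod_cast ha e
    exact le_antisymm (by nlinarith) (h1 e).1
  have h0 : volume {y : Fin m → ℝ | y e = 0} = 0 :=
    Measure.pi_hyperplane (fun _ : Fin m => (volume : Measure ℝ)) e 0
  rw [vol, measureReal_def, measure_mono_null hsub h0, ENNReal.toReal_zero]

/-- For `x = 0` all edge weights vanish. -/
theorem part_pathModel_zero (G : DAG n m) (a : Fin m → ℕ) (M : ℕ) (hm : 0 < m)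
    (σ : Fin n → ℕ) : (pathModel a 0 M).part G Finset.univ σ = 0 := by
  rw [part_univ]
  refine Finset.sum_eq_zero fun τ _ => mul_eq_zero_of_right _ ?_
  exact Finset.prod_eq_zero (Finset.mem_univ ⟨0, hm⟩) (by simp [pathModel])

theorem one_add_div_pow_le {m M : ℕ} {ε : ℝ} (hM : 0 < M) (h1 : 2 * (m : ℝ) * m ≤ M * ε)
    (h2 : 2 * (m : ℝ) * m ≤ M) : (1 + (m : ℝ) / M) ^ m ≤ 1 + ε := by
  have hM' : (0 : ℝ) < M := by exact_mod_cast hM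
  set z : ℝ := m * m / M with hz
  have hz0 : 0 ≤ z := by positivity
  have hz1 : 2 * z ≤ ε := by
    rw [hz, ← mul_div_assoc, div_le_iff₀ hM']
    linarith
  have hz2 : z ≤ 1 := by
    rw [hz, div_le_one hM']
    nlinarith [mul_self_nonneg (m : ℝ)]
  calc (1 + (m : ℝ) / M) ^ m ≤ Real.exp ((m : ℝ) / M) ^ m := by
        gcongr
        linarith [Real.add_one_le_exp ((m : ℝ) / M)]
    _ = Real.exp z := by
        rw [← Real.exp_nat_mul, hz]
        congr 1
        ring
    _ ≤ 1 + 2 * z := by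
        have := Real.abs_exp_sub_one_le (x := z) (by rwa [abs_of_nonneg hz0])
        rw [abs_of_nonneg hz0] at this
        linarith [le_abs_self (Real.exp z - 1)]
    _ ≤ 1 + ε := by linarith

/-- The partition function of `pathModel` approximates the volume of the polytope. -/
theorem vol_le_part_and_part_le (G : DAG n m) {a : Fin m → ℕ} {x ε : ℝ} {M : ℕ} (hm : 0 < m)
    (ha : ∀ e, 0 < a e) (hx : 0 ≤ x) (hM : 0 < M) (h1 : 2 * (m : ℝ) * m ≤ M * ε)
    (h2 : 2 * (m : ℝ) * m ≤ M) (σ : Fin n → ℕ) :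
    G.vol a x ≤ (pathModel a x M).part G Finset.univ σ ∧
      (pathModel a x M).part G Finset.univ σ ≤ (1 + ε) * G.vol a x := by
  rcases hx.eq_or_lt with rfl | hx
  · simp [G.vol_zero hm ha, G.part_pathModel_zero a M hm]
  rw [← G.volume_roundedPolytope ha hx hM]
  have hle := measureReal_mono (G.roundedPolytope_subset_polytope a hx hM)
    (G.volume_polytope_ne_top a _)
  refine ⟨measureReal_mono (G.polytope_subset_roundedPolytope a hx hM)
    (measure_ne_top_of_subset (G.roundedPolytope_subset_polytope a hx hM)
      (G.volume_polytope_ne_top a _)), ?_⟩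
  calc _ ≤ G.vol a ((1 + m / M) * x) := hle
    _ ≤ (1 + m / M) ^ m * G.vol a x :=
      G.vol_mul_le a x (le_add_of_nonneg_right (by positivity))
    _ ≤ (1 + ε) * G.vol a x :=
      mul_le_mul_of_nonneg_right (one_add_div_pow_le hM h1 h2) (G.vol_pos a hx).le

end DAG

/-! ### The number of steps -/

namespace RealRAM

namespace ForProgram

open NExp

/-- Bounds for all loop bounds that occur: at most `N` vertices, edges and states, and at most `T`
codes of partial assignments. -/
structure Bounds (k N T : ℕ) (s : State) : Prop where
  one_le : 1 ≤ T
  le_codes : k ≤ T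
  numV_lt : s.nat 0 0 < N
  numE_le : s.nat 0 1 ≤ N
  states_add_two_le : s.nat arrB 0 + 2 ≤ N
  codes_le : s.nat arrT 0 ≤ T

/-- The number of steps of the programs `P k` is of order `N ^ d * T ^ e`, uniformly in `k`. -/
def TimeBound (P : ℕ → ForProgram) (d e : ℕ) : Prop :=
  ∃ c, ∀ k N T s, Bounds k N T s → (P k).time s ≤ c * (N ^ d * T ^ e)

theorem Bounds.one_le_mul {k N T : ℕ} {s : State} (h : Bounds k N T s) (d e : ℕ) :
    1 ≤ N ^ d * T ^ e := by
  have hN : 0 < N := (Nat.zero_le _).trans_lt h.numV_lt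
  have hT : 0 < T := h.one_le
  exact Nat.one_le_iff_ne_zero.2 (by positivity)

theorem Bounds.pow_le {k N T : ℕ} {s : State} (h : Bounds k N T s) {d d' e e' : ℕ} (hd : d ≤ d')
    (he : e ≤ e') : N ^ d * T ^ e ≤ N ^ d' * T ^ e' := by
  have hN : 0 < N := (Nat.zero_le _).trans_lt h.numV_lt
  have hT : 0 < T := h.one_le
  exact Nat.mul_le_mul (Nat.pow_le_pow_right hN hd) (Nat.pow_le_pow_right hT he)

theorem TimeBound.mono {P : ℕ → ForProgram} {d d' e e' : ℕ} (h : TimeBound P d e) (hd : d ≤ d')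
    (he : e ≤ e') : TimeBound P d' e' := by
  obtain ⟨c, hc⟩ := h
  exact ⟨c, fun k N T s hs => (hc k N T s hs).trans (Nat.mul_le_mul_left _ (hs.pow_le hd he))⟩

theorem timeBound_const {P : ForProgram} {c : ℕ} (h : ∀ s, P.time s = c) :
    TimeBound (fun _ => P) 0 0 :=
  ⟨c, fun k N T s _ => by simp [h]⟩

theorem timeBound_skip : TimeBound (fun _ => skip) 0 0 := timeBound_const fun _ => rfl

theorem timeBound_setNat (A : ℕ) (i e : NExp) : TimeBound (fun _ => setNat A i e) 0 0 :=
  timeBound_const fun _ => rfl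

theorem timeBound_setReal (A : ℕ) (i : NExp) (e : RExp) : TimeBound (fun _ => setReal A i e) 0 0 :=
  timeBound_const fun _ => rfl

theorem TimeBound.seq {P Q : ℕ → ForProgram} {d e d' e' : ℕ} (hP : TimeBound P d e)
    (hQ : TimeBound Q d' e') : TimeBound (fun k => P k ;; Q k) (max d d') (max e e') := by
  obtain ⟨c, hc⟩ := hP.mono (le_max_left d d') (le_max_left e e')
  obtain ⟨c', hc'⟩ := hQ.mono (le_max_right d d') (le_max_right e e')
  refine ⟨c + c', fun k N T s hs => ?_⟩
  rw [add_mul]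
  exact Nat.add_le_add (hc k N T s hs) (hc' k N T s hs)

theorem TimeBound.ite (b : BExp) {P Q : ℕ → ForProgram} {d e d' e' : ℕ} (hP : TimeBound P d e)
    (hQ : TimeBound Q d' e') :
    TimeBound (fun k => ForProgram.ite b (P k) (Q k)) (max d d') (max e e') := by
  obtain ⟨c, hc⟩ := hP.seq hQ
  refine ⟨b.cost + 1 + c, fun k N T s hs => ?_⟩
  rw [add_mul]
  exact Nat.add_le_add (Nat.le_mul_of_pos_right _ (hs.one_le_mul _ _)) (hc k N T s hs)

theorem TimeBound.loop_of_le {i : ℕ} {b : ℕ → NExp} {P : ℕ → ForProgram} {d e d' e' c₀ : ℕ}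
    (hP : TimeBound P d e) (hcost : ∀ k, (b k).cost ≤ c₀)
    (hb : ∀ k N T s, Bounds k N T s → (b k).eval s ≤ N ^ d' * T ^ e') :
    TimeBound (fun k => loop i (b k) (P k)) (d + d') (e + e') := by
  obtain ⟨c, hc⟩ := hP
  refine ⟨2 * c₀ + 21 + c, fun k N T s hs => ?_⟩
  have h1 := hs.one_le_mul d e
  have h2 := hs.one_le_mul d' e'
  have h3 := hc k N T s hs
  have h4 := hb k N T s hs
  have h5 := hcost k
  rw [pow_add, pow_add, mul_mul_mul_comm]
  simp only [time]
  set X := N ^ d * T ^ e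
  set Z := N ^ d' * T ^ e'
  have h6 : 1 ≤ X * Z := Nat.mul_pos h1 h2
  calc (b k).eval s * ((b k).cost + 12 + (P k).time s) + ((b k).cost + 9)
      ≤ Z * (c₀ * X + 12 * X + c * X) + (c₀ * (X * Z) + 9 * (X * Z)) := by
        refine Nat.add_le_add (Nat.mul_le_mul h4 ?_) ?_
        · have := Nat.le_mul_of_pos_right c₀ h1
          omega
        · have := Nat.le_mul_of_pos_right c₀ h6
          omega
    _ = (2 * c₀ + 21 + c) * (X * Z) := by ring

theorem TimeBound.loop {i : ℕ} {b : NExp} {P : ℕ → ForProgram} {d e : ℕ} (hP : TimeBound P d e)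
    (hb : ∀ k N T s, Bounds k N T s → b.eval s ≤ N) :
    TimeBound (fun k => ForProgram.loop i b (P k)) (d + 1) e :=
  hP.loop_of_le (e' := 0) (fun _ => le_rfl) fun k N T s hs => by simpa using hb k N T s hs

theorem TimeBound.loop_codes {i : ℕ} {P : ℕ → ForProgram} {d e : ℕ} (hP : TimeBound P d e) :
    TimeBound (fun k => ForProgram.loop i (var arrT) (P k)) d (e + 1) :=
  hP.loop_of_le (d' := 0) (fun _ => le_rfl) fun k N T s hs => by
    simpa [NExp.eval] using hs.codes_le

theorem TimeBound.loop_lit {i : ℕ} {P : ℕ → ForProgram} {d e : ℕ} (hP : TimeBound P d e) :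
    TimeBound (fun k => ForProgram.loop i (lit k) (P k)) d (e + 1) :=
  hP.loop_of_le (d' := 0) (fun _ => le_rfl) fun k N T s hs => by
    simpa [NExp.eval] using hs.le_codes

theorem TimeBound.loop_numV {i : ℕ} {P : ℕ → ForProgram} {d e : ℕ} (hP : TimeBound P d e) :
    TimeBound (fun k => ForProgram.loop i numV (P k)) (d + 1) e :=
  hP.loop fun _ _ _ _ hs => hs.numV_lt.le

theorem TimeBound.loop_numE {i : ℕ} {P : ℕ → ForProgram} {d e : ℕ} (hP : TimeBound P d e) :
    TimeBound (fun k => ForProgram.loop i numE (P k)) (d + 1) e :=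
  hP.loop fun _ _ _ _ hs => hs.numE_le

theorem TimeBound.loop_states {i : ℕ} {P : ℕ → ForProgram} {d e : ℕ} (hP : TimeBound P d e) :
    TimeBound (fun k => ForProgram.loop i (var arrB) (P k)) (d + 1) e :=
  hP.loop fun _ _ _ _ hs => (Nat.le_add_right _ _).trans hs.states_add_two_le

theorem timeBound_fill (A : ℕ) (e : NExp) : TimeBound (fun _ => fill A e) 1 0 :=
  (timeBound_setNat _ _ _).loop_numV

theorem timeBound_growComp (v : ℕ) : TimeBound (fun _ => growComp v) 2 0 :=
  (timeBound_fill _ _).seq ((timeBound_setNat _ _ _).seq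
    (TimeBound.loop_numV (TimeBound.loop_numE (TimeBound.ite _
      ((timeBound_setNat _ _ _).seq (timeBound_setNat _ _ _)) timeBound_skip))))

theorem timeBound_findAddress : TimeBound (fun _ => findAddress) 2 0 :=
  (timeBound_fill _ _).seq ((TimeBound.loop_numE (TimeBound.ite _
      ((timeBound_setNat _ _ _).seq (timeBound_setNat _ _ _)) timeBound_skip)).seq
    ((timeBound_setNat _ _ _).seq (TimeBound.loop_numV ((timeBound_setNat _ _ _).seq
      ((TimeBound.loop (b := add (var arrB) (lit 2)) (timeBound_setNat _ _ _)
        fun _ _ _ _ hs => hs.states_add_two_le).seq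
        (TimeBound.ite _ (timeBound_setNat _ _ _)
          (TimeBound.ite _ (timeBound_setNat _ _ _) (timeBound_setNat _ _ _))))))))

theorem timeBound_takeComps : TimeBound (fun _ => takeComps) 3 0 :=
  TimeBound.loop_numV (TimeBound.ite _ ((timeBound_growComp _).seq (timeBound_findAddress.seq
    ((timeBound_setNat _ _ _).seq ((timeBound_setReal _ _ _).seq (timeBound_fill _ _)))))
      timeBound_skip)

theorem timeBound_edgeFactors : TimeBound (fun _ => edgeFactors) 1 0 :=
  TimeBound.loop_numE (TimeBound.ite _
    ((TimeBound.ite _ (timeBound_setNat _ _ _) (timeBound_setNat _ _ _)).seq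
      ((TimeBound.ite _ (timeBound_setNat _ _ _) (timeBound_setNat _ _ _)).seq
        ((timeBound_setReal _ _ _).seq (TimeBound.ite _ (timeBound_setReal _ _ _) timeBound_skip))))
    timeBound_skip)

theorem timeBound_freeComp : TimeBound (fun _ => freeComp) 2 0 :=
  (timeBound_fill _ _).seq (timeBound_growComp _)

theorem timeBound_addState : TimeBound (fun _ => addState) 3 0 :=
  (timeBound_setNat _ _ _).seq (timeBound_freeComp.seq ((timeBound_fill _ _).seq
    ((timeBound_setNat _ _ _).seq ((timeBound_setNat _ _ _).seq
      ((TimeBound.ite _ (timeBound_setReal _ _ _) (timeBound_setReal _ _ _)).seq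
        (timeBound_edgeFactors.seq (timeBound_takeComps.seq (timeBound_setReal _ _ _))))))))

theorem timeBound_pivot : TimeBound (fun _ => pivot) 4 0 :=
  timeBound_freeComp.seq (timeBound_findAddress.seq ((timeBound_setNat _ _ _).seq
    ((timeBound_setNat _ _ _).seq ((timeBound_setReal _ _ _).seq
      ((TimeBound.loop_states timeBound_addState).seq
        (TimeBound.ite _ ((timeBound_setReal _ _ _).seq (timeBound_setNat _ _ _))
          timeBound_skip))))))

theorem timeBound_divMod (b : NExp) : TimeBound (fun _ => divMod b) 0 1 :=
  (timeBound_setNat _ _ _).seq ((timeBound_setNat _ _ _).seq (TimeBound.loop_codes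
    (TimeBound.ite _ ((timeBound_setNat _ _ _).seq (timeBound_setNat _ _ _)) timeBound_skip)))

/-- Decoding has `k` divisions, by repeated subtraction, and both `k` and the number of subtractions
are bounded by `T`. -/
theorem timeBound_decode : TimeBound decode 1 2 :=
  (timeBound_fill _ _).seq ((timeBound_setNat _ _ _).seq (TimeBound.loop_lit
    ((timeBound_divMod _).seq ((timeBound_setNat _ _ _).seq
      ((timeBound_divMod _).seq (timeBound_setNat _ _ _))))))

theorem timeBound_fillTable : TimeBound fillTable 6 3 :=
  TimeBound.loop_numV (TimeBound.loop_codes (TimeBound.loop_numV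
    (timeBound_decode.seq (TimeBound.ite _ timeBound_pivot timeBound_skip))))

theorem timeBound_finish : TimeBound (fun _ => finish) 3 0 :=
  (timeBound_fill _ _).seq ((timeBound_fill _ _).seq ((timeBound_setNat _ _ _).seq
    ((timeBound_setReal _ _ _).seq (timeBound_takeComps.seq (timeBound_setReal _ _ _)))))

theorem wf_fillTable_seq_finish (k : ℕ) : (fillTable k ;; finish).WF [0, 1, 2, 3, 4, 5] := by
  simp [WF, fillTable, finish, tryPivot, decode, decodeStep, divMod, pivot, addState, freeComp,
    fill, growComp, growEdge, findAddress, markNear, addDigit, takeComps, takeComp, edgeFactors,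
    edgeFactor, natWrites, NExp.reads]

end ForProgram

end RealRAM

/-! ### The parameters of the discretization -/

namespace RealRAM

namespace ForProgram

open NExp

/-- The condition on `M` under which the discretization is fine enough: `2 m²` is at most `M ε`
and at most `M`. -/
def gridTest : BExp :=
  .and (.realLE (.mul (.mul (.ofNat (lit 2)) (.ofNat numE)) (.ofNat numE))
      (.mul (.ofNat (var arrM)) (.read 0 (lit 1))))
    (.realLE (.mul (.mul (.ofNat (lit 2)) (.ofNat numE)) (.ofNat numE)) (.ofNat (var arrM)))

/-- Find the smallest `M` that satisfies `gridTest`. -/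
def chooseGrid : Program :=
  .seq (.setNat arrM (lit 0) (lit 0))
    (.loop (.not gridTest) (.setNat arrM (lit 0) (add (var arrM) (lit 1))))

/-- Compute `B` from `M`. -/
def countStates : ForProgram := setNat arrB (lit 0) (add (add (var arrM) (var arrM)) (lit 1))

/-- Compute `((n + 1) * B) ^ k`. -/
def countCodes (k : ℕ) : ForProgram :=
  setNat arrT (lit 0) (lit 1) ;;
  loop 34 (lit k) (setNat arrTmp (lit 0) (lit 0) ;;
    loop 35 (add numV (lit 1)) (loop 36 (var arrB)
      (setNat arrTmp (lit 0) (add (var arrTmp) (var arrT)))) ;;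
    setNat arrT (lit 0) (var arrTmp))

/-- The approximation algorithm for treewidth `k`. -/
def approximateVolume (k : ℕ) : Program :=
  .seq chooseGrid (.seq countStates.toProgram
    (.seq (countCodes k).toProgram (fillTable k ;; finish).toProgram))

theorem gridTest_holds_iff {s : State} {m : ℕ} {ε : ℝ} (hE : s.nat 0 1 = m)
    (hε : s.real 0 1 = ε) : gridTest.Holds s ↔
      2 * (m : ℝ) * m ≤ s.nat arrM 0 * ε ∧ 2 * (m : ℝ) * m ≤ s.nat arrM 0 := by
  simp [gridTest, BExp.Holds, RExp.eval, NExp.eval, hE, hε]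

theorem ceil_le_iff_grid {m M : ℕ} {ε : ℝ} (hε : 0 < ε) :
    ⌈2 * (m : ℝ) * m / min ε 1⌉₊ ≤ M ↔ 2 * (m : ℝ) * m ≤ M * ε ∧ 2 * (m : ℝ) * m ≤ M := by
  have h0 : 0 < min ε 1 := lt_min hε one_pos
  rw [Nat.ceil_le, div_le_iff₀ h0, mul_min_of_nonneg _ _ (Nat.cast_nonneg M), le_min_iff, mul_one]

theorem updateNat_updateNat (s : State) (A i v w : ℕ) :
    (s.updateNat A i v).updateNat A i w = s.updateNat A i w := by
  simp [State.updateNat]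

theorem exec_chooseGrid {s : State} {m : ℕ} {ε : ℝ} (hE : s.nat 0 1 = m) (hr : s.real 0 1 = ε)
    (hε : 0 < ε) : ∃ t ≤ 50 * (⌈2 * (m : ℝ) * m / min ε 1⌉₊ + 1),
      Exec chooseGrid s (s.updateNat arrM 0 ⌈2 * (m : ℝ) * m / min ε 1⌉₊) t := by
  set M := ⌈2 * (m : ℝ) * m / min ε 1⌉₊ with hM
  have htest : ∀ j, gridTest.Holds (s.updateNat arrM 0 j) ↔ M ≤ j := fun j => by
    rw [gridTest_holds_iff (s := s.updateNat arrM 0 j) (m := m) (ε := ε) (by simpa using hE) hr,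
      hM, ceil_le_iff_grid hε]
    simp
  have main : ∀ d j, j + d = M → ∃ t ≤ 40 * d + 40,
      Exec (.loop (.not gridTest) (.setNat arrM (lit 0) (add (var arrM) (lit 1))))
        (s.updateNat arrM 0 j) (s.updateNat arrM 0 M) t := by
    intro d
    induction d with
    | zero =>
      rintro j rfl
      refine ⟨_, ?_, .loopFalse (not_not.2 ((htest _).2 le_rfl))⟩
      simp [gridTest, BExp.cost, RExp.cost, NExp.cost]
    | succ d ih =>
      intro j hj
      obtain ⟨t, ht, hexec⟩ := ih (j + 1) (by omega)
      have hset := Exec.setNat arrM (lit 0) (add (var arrM) (lit 1)) (s.updateNat arrM 0 j)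
      simp only [NExp.eval, updateNat_updateNat, State.updateNat_nat, and_self, if_true] at hset
      refine ⟨_, ?_, .loopTrue (fun h => ?_) hset hexec⟩
      · simp only [gridTest, BExp.cost, RExp.cost, NExp.cost]
        omega
      · have := (htest j).1 h
        omega
  obtain ⟨t, ht, hexec⟩ := main M 0 (by omega)
  refine ⟨_, ?_, .seq (.setNat arrM (lit 0) (lit 0) s) hexec⟩
  simp only [NExp.cost]
  omega

theorem run_countCodes (s : State) (k : ℕ) :
    ((countCodes k).run s).nat arrT 0 = ((s.nat 0 0 + 1) * s.nat arrB 0) ^ k := by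
  unfold countCodes
  simp only [run_seq, run_setNat]
  set s1 := s.updateNat 5 (NExp.eval s (lit 0)) (NExp.eval s (lit 1)) with hs1
  refine run_loop_induct (i := 34) (b := lit k) (s := s1) (N := k) rfl
    (fun j s' => s'.nat arrT 0 = ((s.nat 0 0 + 1) * s.nat arrB 0) ^ j) (by simp [hs1, NExp.eval])
    fun j s' _ _ hf ih => ?_
  have hs' : ∀ A, A < 5 → s'.nat A = s.nat A := fun A hA => by
    rw [hf.1 A (by simp [natWrites]; omega), hs1, State.updateNat_nat_of_ne _ _ _ (by omega)]
  simp only [run_seq, run_setNat]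
  set s2 := s'.updateNat 14 (NExp.eval s' (lit 0)) (NExp.eval s' (lit 0)) with hs2
  have hs2' : ∀ A, A ≠ 14 → s2.nat A = s'.nat A := fun A hA => State.updateNat_nat_of_ne _ _ _ hA
  have key := run_loop_induct (i := 35) (b := add numV (lit 1))
    (P := loop 36 (var arrB) (setNat arrTmp (lit 0) (add (var arrTmp) (var arrT)))) (s := s2)
    (N := s.nat 0 0 + 1) (by simp [NExp.eval, hs2', hs'])
    (fun i r => r.nat arrTmp 0 = i * (s.nat arrB 0 * s'.nat arrT 0))
    (by simp [hs2, NExp.eval]) (fun i r _ _ hfr ihr => by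
      have hinner := run_loop_induct (i := 36) (b := var arrB)
        (P := setNat arrTmp (lit 0) (add (var arrTmp) (var arrT))) (s := r)
        (N := s.nat arrB 0)
        (by simp [NExp.eval, hfr.1 4 (by simp [natWrites]), hs2', hs'])
        (fun l q => q.nat arrTmp 0 = r.nat arrTmp 0 + l * s'.nat arrT 0) (by simp)
        (fun l q _ _ hfq ihq => by
          have hq : q.nat 5 0 = s'.nat 5 0 := by
            rw [hfq.1 5 (by simp [natWrites]), hfr.1 5 (by simp [natWrites]), hs2' 5 (by decide)]
          simp only [run_setNat, NExp.eval, State.updateNat_nat, ihq, hq]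
          simp
          ring)
      simp only [State.updateNat_nat, hinner, ihr]
      simp
      ring)
  simp only [State.updateNat_nat, NExp.eval, key, ih]
  simp
  ring

theorem wf_countCodes (k : ℕ) : (countCodes k).WF [0, 1, 2, 3, 4] := by
  simp [WF, countCodes, natWrites, NExp.reads]

theorem timeBound_countCodes : TimeBound countCodes 2 1 :=
  (timeBound_setNat _ _ _).seq (TimeBound.loop_lit ((timeBound_setNat _ _ _).seq
    ((TimeBound.loop (b := add numV (lit 1)) (TimeBound.loop_states (timeBound_setNat _ _ _))
      fun _ _ _ _ hs => hs.numV_lt).seq (timeBound_setNat _ _ _))))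

end ForProgram

end RealRAM

namespace DAG

variable {n m : ℕ}

/-- The algorithm computes the partition function of `pathModel`. -/
theorem outputs_approximateVolume : ∃ c : ℕ, ∀ (k n m : ℕ) (G : DAG n m) (a : Fin m → ℕ)
    (x ε : ℝ) (M : ℕ), 0 < ε → 1 ≤ k → treewidth G.underlying ≤ k →
    M = ⌈2 * (m : ℝ) * m / min ε 1⌉₊ → ∃ t ≤ c * (n + m + 2 * M + 3) ^ (6 * (k + 1)),
      (approximateVolume k).Outputs (G.input a x ε)
        ((pathModel a x M).part G Finset.univ fun _ => 0) t := by
  obtain ⟨c₁, hc₁⟩ := timeBound_countCodes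
  obtain ⟨c₂, hc₂⟩ := timeBound_fillTable.seq timeBound_finish
  refine ⟨60 + c₁ + c₂, fun k n m G a x ε M hε hk htw hM => ?_⟩
  set N := n + m + 2 * M + 3 with hN
  set s := G.input a x ε with hs
  set s1 := s.updateNat arrM 0 M with hs1
  obtain ⟨t1, ht1, he1⟩ : ∃ t ≤ 50 * (M + 1), Exec chooseGrid s s1 t := by
    rw [hs1, hM]
    exact exec_chooseGrid (by simp [hs, input]) (by simp [hs, input]) hε
  set s2 := countStates.run s1 with hs2
  have he2 : Exec countStates.toProgram s1 s2 9 := Exec.setNat _ _ _ s1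
  set s3 := (countCodes k).run s2 with hs3
  obtain ⟨t3, ht3, he3⟩ := exec_run (wf_countCodes k) s2
  obtain ⟨t4, ht4, he4⟩ := exec_run (wf_fillTable_seq_finish k) s3
  have hf3 : (countCodes k).Frame s2 s3 := frame_run _ _
  have hmem2 : G.InputMem a x M s2 := by
    constructor
    all_goals simp [hs2, hs1, hs, input, countStates, run_setNat, NExp.eval]
    omega
  have hmem3 : G.InputMem a x M s3 :=
    hmem2.of_frame hf3 (by simp [countCodes, natWrites]) (by simp [countCodes, realWrites])
  have hflag : ∀ i, s3.nat arrFlag i = 0 := by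
    intro i
    rw [hf3.1 _ (by simp [countCodes, natWrites])]
    simp [hs2, hs1, hs, input, countStates, run_setNat]
  have htab3 : G.TableSound a x M s3 := fun C σ _ h => absurd (hflag _) h
  have hT3 : s3.nat arrT 0 = ((n + 1) * (2 * M + 1)) ^ k := by
    rw [hs3, run_countCodes, hmem2.numV, hmem2.valB]
  obtain ⟨htab4, hcomp⟩ := run_fillTable (k := k) hmem3 htab3 hT3.ge
  have hmem4 : G.InputMem a x M ((fillTable k).run s3) :=
    hmem3.of_frame (frame_run _ _)
      (by simp [fillTable, natWrites, growComp, findAddress, edgeFactors, takeComps, takeComp,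
        growEdge, markNear, addDigit])
      (by simp [fillTable, realWrites])
  refine ⟨_, ?_, _, .seq he1 (.seq he2 (.seq he3 he4)), ?_⟩
  · -- the bound for the number of steps
    set T := N ^ (2 * k) with hT
    have hTle : ((n + 1) * (2 * M + 1)) ^ k ≤ T := by
      rw [hT, pow_mul, pow_two]
      exact Nat.pow_le_pow_left (Nat.mul_le_mul (by omega) (by omega)) k
    -- the loop bound `k` is absorbed into `T`, so that the constants do not depend on `k`
    have hkT : k ≤ T := by
      refine (Nat.lt_pow_self (by omega : 1 < N)).le.trans (Nat.pow_le_pow_right (by omega) ?_)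
      omega
    have hT1 : 1 ≤ T := Nat.one_le_pow _ _ (by omega)
    have hT2 : s2.nat arrT 0 ≤ T := by
      have : s2.nat arrT 0 = 0 := by simp [hs2, hs1, hs, input, countStates, run_setNat]
      omega
    have hb2 : Bounds k N T s2 :=
      ⟨hT1, hkT, by rw [hmem2.numV]; omega, by rw [hmem2.numE]; omega,
        by rw [hmem2.valB]; omega, hT2⟩
    have hb3 : Bounds k N T s3 :=
      ⟨hT1, hkT, by rw [hmem3.numV]; omega, by rw [hmem3.numE]; omega,
        by rw [hmem3.valB]; omega, hT3.trans_le hTle⟩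
    have h3 := ((hc₁ k N T s2 hb2).trans
      (Nat.mul_le_mul_left c₁ (hb2.pow_le (by omega : 2 ≤ 6) (by omega : 1 ≤ 3))))
    have h4 := hc₂ k N T s3 hb3
    have hX : N ^ 6 * T ^ 3 = N ^ (6 * (k + 1)) := by
      rw [hT, ← pow_mul, ← pow_add]
      congr 1
      ring
    have hN6 : N ≤ N ^ (6 * (k + 1)) := Nat.le_self_pow (by omega) N
    simp only [max_eq_left (by omega : 3 ≤ 6), max_eq_left (by omega : 0 ≤ 3), hX] at h3 h4
    set X := N ^ (6 * (k + 1))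
    have h5 : t1 + 9 ≤ 60 * X := by omega
    calc t1 + (9 + (t3 + t4)) ≤ 60 * X + (c₁ * X + c₂ * X) := by omega
      _ = (60 + c₁ + c₂) * X := by ring
  · exact run_finish hmem4 htab4 hcomp fun u => solvable_of_treewidth_le htw u

/-- Comparison of the number of steps with the bound of the theorem. -/
theorem steps_le {n m k M : ℕ} {ε : ℝ} (hk : 1 ≤ k) (hm : 0 < m) (hn : 2 ≤ n) (hε : 0 < ε)
    (hM : M = ⌈2 * (m : ℝ) * m / min ε 1⌉₊) :
    ((n + m + 2 * M + 3 : ℕ) : ℝ) ^ (6 * (k + 1)) ≤ (3 * (k : ℝ) + 2) ^ 2 * n *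
      ((6 * (k : ℝ) + 6) * m * n / min ε 1) ^ (9 * k ^ 2 + 15 * k + 6) := by
  have h0 : 0 < min ε 1 := lt_min hε one_pos
  have h1 : min ε 1 ≤ 1 := min_le_right _ _
  have hm' : (1 : ℝ) ≤ m := by exact_mod_cast hm
  have hn' : (2 : ℝ) ≤ n := by exact_mod_cast hn
  set q : ℝ := m * n / min ε 1 with hq
  have hqmn : (m : ℝ) * n ≤ q := by
    rw [hq, le_div_iff₀ h0]
    nlinarith [mul_nonneg (zero_le_one.trans hm') (zero_le_two.trans hn')]
  have hq2 : 2 ≤ q := by nlinarith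
  have hnq : (n : ℝ) ≤ q := by nlinarith
  have hmq : (m : ℝ) ≤ q := by nlinarith
  have hMq : (M : ℝ) ≤ q ^ 2 + 1 := by
    have hlt : (M : ℝ) < 2 * (m : ℝ) * m / min ε 1 + 1 := by
      rw [hM]
      exact Nat.ceil_lt_add_one (by positivity)
    have : 2 * (m : ℝ) * m / min ε 1 ≤ m * q := by
      rw [hq, ← mul_div_assoc]
      refine div_le_div_of_nonneg_right ?_ h0.le
      nlinarith [mul_nonneg (mul_self_nonneg (m : ℝ)) (sub_nonneg.2 hn')]
    nlinarith
  have hN : ((n + m + 2 * M + 3 : ℕ) : ℝ) ≤ 12 * q ^ 2 := by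
    push_cast
    nlinarith
  have hk' : (1 : ℝ) ≤ k := by exact_mod_cast hk
  have hbase : 12 * q ≤ (6 * (k : ℝ) + 6) * m * n / min ε 1 := by
    rw [mul_assoc, mul_div_assoc, ← hq]
    nlinarith
  calc ((n + m + 2 * M + 3 : ℕ) : ℝ) ^ (6 * (k + 1)) ≤ ((12 * q) ^ 2) ^ (6 * (k + 1)) := by
        refine pow_le_pow_left₀ (Nat.cast_nonneg _) (hN.trans ?_) _
        nlinarith
    _ = (12 * q) ^ (12 * (k + 1)) := by
        rw [← pow_mul]
        congr 1
        ring
    _ ≤ (12 * q) ^ (9 * k ^ 2 + 15 * k + 6) :=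
        pow_le_pow_right₀ (by linarith) (by nlinarith)
    _ ≤ ((6 * (k : ℝ) + 6) * m * n / min ε 1) ^ (9 * k ^ 2 + 15 * k + 6) :=
        pow_le_pow_left₀ (by linarith) hbase _
    _ ≤ _ := by
        refine le_mul_of_one_le_left (pow_nonneg (by linarith) _) ?_
        nlinarith

end DAG

theorem theorem1 :
    -- the distribution function of the longest path length is the volume of the polytope
    (∀ (n m : ℕ) (G : DAG n m) (a : Fin m → ℕ) (x : ℝ), (∀ e, 0 < a e) → 0 ≤ x →
      ∀ (Ω : Type*) [MeasurableSpace Ω] (μ : Measure Ω) [IsProbabilityMeasure μ]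
        (Y : Fin m → Ω → ℝ), (∀ e, Measurable (Y e)) → iIndepFun Y μ →
        (∀ e, pdf.IsUniform (Y e) (Set.Icc 0 (a e : ℝ)) μ volume) →
        μ.real {ω | G.longestPathLength (fun e => Y e ω) ≤ x} = G.vol a x) ∧
    -- the approximation algorithm
    ∃ C : ℝ, ∀ k : ℕ, ∃ P : RealRAM.Program,
      ∀ (n m : ℕ) (G : DAG n m) (a : Fin m → ℕ) (x ε : ℝ), 0 < m → (∀ e, 0 < a e) →
        0 ≤ x → 0 < ε → treewidth G.underlying ≤ k →
        ∃ (V' : ℝ) (t : ℕ), P.Outputs (G.input a x ε) V' t ∧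
          (t : ℝ) ≤ C * ((3 * (k : ℝ) + 2) ^ 2 * n *
            ((6 * (k : ℝ) + 6) * m * n / min ε 1) ^ (9 * k ^ 2 + 15 * k + 6)) ∧
          G.vol a x ≤ V' ∧ V' ≤ (1 + ε) * G.vol a x ∧
          (0 < x → 1 ≤ V' / G.vol a x ∧ V' / G.vol a x ≤ 1 + ε) := by
  refine ⟨fun n m G a x ha hx Ω _ μ _ Y hY hind hunif =>
    G.measureReal_longestPathLength_le ha hx hY hind hunif, ?_⟩
  obtain ⟨c, hc⟩ := DAG.outputs_approximateVolume
  refine ⟨c, fun k => ⟨approximateVolume k, fun n m G a x ε hm ha hx hε htw => ?_⟩⟩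
  have hk := DAG.one_le_of_treewidth_le htw hm
  -- an edge has two different ends
  have hn : 2 ≤ n := by
    have h := Finset.card_le_univ {G.src ⟨0, hm⟩, G.tgt ⟨0, hm⟩}
    rwa [Finset.card_pair (G.src_ne_tgt _), Fintype.card_fin] at h
  obtain ⟨t, ht, hout⟩ := hc k n m G a x ε _ hε hk htw rfl
  obtain ⟨h1, h2⟩ := (ceil_le_iff_grid hε).1 (le_refl ⌈2 * (m : ℝ) * m / min ε 1⌉₊)
  have hM : 0 < ⌈2 * (m : ℝ) * m / min ε 1⌉₊ := by
    have := lt_min hε one_pos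
    rw [Nat.ceil_pos]
    positivity
  obtain ⟨h3, h4⟩ := G.vol_le_part_and_part_le hm ha hx hM h1 h2 fun _ => 0
  refine ⟨_, t, hout, ?_, h3, h4, fun hx => ?_⟩
  · calc (t : ℝ)
        ≤ c * ((n + m + 2 * ⌈2 * (m : ℝ) * m / min ε 1⌉₊ + 3 : ℕ) : ℝ) ^ (6 * (k + 1)) := by
          exact_mod_cast ht
      _ ≤ _ := mul_le_mul_of_nonneg_left (DAG.steps_le hk hm hn hε rfl) (Nat.cast_nonneg c)
  · have hpos := G.vol_pos a hx
    exact ⟨(one_le_div hpos).2 h3, (div_le_iff₀ hpos).2 h4⟩
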